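/- **Isotropic global law.** Let $I$ be a set and, for each $i \in I$, let $(X_N^{(i)}(j,k) : 1 \le j \le k \le N,\ N \in \mathbb{N})$ be a family of independent complex random variables such that: (a) for $j<k$, $\mathbb{E}[X^{(i)}_N(j,k)] = 0$ and $\mathbb{E}[|X^{(i)}_N(j,k)|^2] = \sigma_i^2$; (b) the diagonal entries $X_N^{(i)}(j,j)$ are real-valued (not necessarily centered) and of finite variance; (c) $\sup_{1\le j \le k\le N \in \mathbb{N}} \mathbb{E}[|X_N^{(i)}(j,k)|^m] < \infty$ for every $m \in \mathbb{N}$. The families for different $i$ are assumed to be independent. Complete $X_N^{(i)}$ to a Hermitian $N \times N$ matrix. Given band widths $b_N^{(i)} \in \mathbb{N}_0$, put $$\xi_N^{(i)} = \min\{2b_N^{(i)}+1, N\}, \qquad |j-k|_N = \min\{|j-k|, N-|j-k|\},$$ $$\Xi_N^{(i)}(j,k) = \frac{1}{\sqrt{\xi_N^{(i)}}}\, \mathbf{1}\{|j-k|_N \le b_N^{(i)}\}\, X_N^{(i)}(j,k),$$ and $\mathcal{Z}_N = (\Xi_N^{(i)})_{i \in I}$. Assume that $b_N^{(i)} \to \infty$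 as $N \to \infty$ for each $i \in I$. Let $\tau_{\mathcal Z} : \mathbb{C}\langle z_i : i \in I\rangle \to \mathbb{C}$ be the linear functional given on monomials by $$\tau_{\mathcal Z}(z_{i(1)} \cdots z_{i(d)}) = \sum_{\pi \in \mathcal{NC}_2(d)} \prod_{\{j,k\} \in \pi} \sigma_{i(j)} \sigma_{i(k)} \mathbf{1}\{i(j) = i(k)\},$$ where $\mathcal{NC}_2(d)$ is the set of noncrossing pair partitions of $\{1, \dots, d\}$ (so $\tau_{\mathcal Z}(1) = 1$). Let $r \ge 1$ and, for each $N \ge 1$, let $x_N^{(1)},\dots,x_N^{(r)}, y_N^{(1)},\dots,y_N^{(r)}$ be deterministic unit vectors in $\mathbb{C}^N$ such that $\lim_{N\to\infty} \langle x_N^{(s)}, y_N^{(s)} \rangle = c_s \in \mathbb{C}$ for each $s$, where $\langle x, y\rangle = \sum_{j} x(j)\overline{y(j)}$, and set $x_N^{(0)} = x_N^{(r)}$. Let $p_1, \dots, p_r \in \mathbb{C}\langle z_i : i \in I\rangle$. Then, as $N \to \infty$, $$\operatorname{Tr}\left(\prod_{s=1}^r x_N^{(s-1)} {y_N^{(s)}}^*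 p_s(\mathcal{Z}_N)\right) \longrightarrow \prod_{s=1}^r \big[c_s\, \tau_{\mathcal Z}(p_s)\big] \quad \text{in probability,}$$ the factors of the matrix product being in the order $s = 1, \dots, r$ from left to right. If moreover there is an $\varepsilon > 0$ such that $\xi_N^{(i)} / N^{\varepsilon} \to \infty$ for every $i$ such that the variable $z_i$ appears in at least one of $p_1, \dots, p_r$, then the convergence also holds almost surely. -/

import Mathlib

open MeasureTheory ProbabilityTheory Filter Topology
open scoped ENNReal ComplexConjugate

noncomputable section

namespace RandomBand

/-- The index set `{(N, j, k) : 1 ≤ j ≤ k ≤ N}` of the entries of a sequence of Hermitian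
matrices (with `Fin N` in the role of `[N]`; there is no index with `N = 0`). -/
abbrev EntryIndex : Type := Σ N : ℕ, {q : Fin N × Fin N // q.1 ≤ q.2}

/-- The family `(X_N(j, k) : j ≤ k)` of random entries underlying a sequence of Wigner matrices of
variance `σ²`. The finite variance of the diagonal entries is contained in the bound on all
moments. -/
structure IsWignerEntries {Ω : Type*} [MeasurableSpace Ω] (μ : Measure Ω) (σ : ℝ)
    (X : EntryIndex → Ω → ℂ) : Prop where
  measurable : ∀ e, Measurable (X e)
  indep : iIndepFun X μ
  centered : ∀ (N : ℕ) (j k : Fin N) (h : j < k), ∫ ω, X ⟨N, (j, k), h.le⟩ ω ∂μ = 0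
  variance : ∀ (N : ℕ) (j k : Fin N) (h : j < k), ∫ ω, ‖X ⟨N, (j, k), h.le⟩ ω‖ ^ 2 ∂μ = σ ^ 2
  diag_real : ∀ (N : ℕ) (j : Fin N), ∀ᵐ ω ∂μ, (X ⟨N, (j, j), le_rfl⟩ ω).im = 0
  moments : ∀ m : ℕ, (⨆ e : EntryIndex, ∫⁻ ω, ‖X e ω‖ₑ ^ m ∂μ) < ∞

/-- The `N × N` matrix `X_N` with the given entries on and above the diagonal, completed to a
Hermitian matrix. -/
def entryMatrix {Ω : Type*} (X : EntryIndex → Ω → ℂ) (N : ℕ) (ω : Ω) :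
    Matrix (Fin N) (Fin N) ℂ :=
  Matrix.of fun j k =>
    if h : j ≤ k then X ⟨N, (j, k), h⟩ ω else conj (X ⟨N, (k, j), (not_le.mp h).le⟩ ω)

/-- The `N`-periodic distance `min {|j - k|, N - |j - k|}`. -/
def periodicDist (N : ℕ) (j k : Fin N) : ℕ :=
  min ((j : ℤ) - (k : ℤ)).natAbs (N - ((j : ℤ) - (k : ℤ)).natAbs)

/-- The periodic `(0,1)`-band matrix of band width `b`. -/
def bandMatrix (N b : ℕ) : Matrix (Fin N) (Fin N) ℂ :=
  Matrix.of fun j k => if periodicDist N j k ≤ b then 1 else 0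

/-- The number `ξ = min {2 b + 1, N}`. -/
def xi (N b : ℕ) : ℕ := min (2 * b + 1) N

/-- The normalized periodic random band matrix `ξ^{-1/2} B ∘ X`, where `∘` is the entrywise
product. -/
def rbm {Ω : Type*} (X : EntryIndex → Ω → ℂ) (b : ℕ → ℕ) (N : ℕ) (ω : Ω) :
    Matrix (Fin N) (Fin N) ℂ :=
  ((Real.sqrt (xi N (b N)) : ℂ))⁻¹ • (bandMatrix N (b N)).hadamard (entryMatrix X N ω)

/-- Evaluation of a noncommutative polynomial at a family of square matrices. -/
def polyEval {I : Type*} {N : ℕ} (Z : I → Matrix (Fin N) (Fin N) ℂ) (p : FreeAlgebra ℂ I) :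
    Matrix (Fin N) (Fin N) ℂ :=
  FreeAlgebra.lift ℂ Z p

/-- The set of all `i` such that the variable `z_i` appears in `p`. -/
def variablesOf {I : Type*} (p : FreeAlgebra ℂ I) : Set I :=
  {i | ∃ w ∈ ((FreeAlgebra.basisFreeMonoid ℂ I).repr p).support, i ∈ FreeMonoid.toList w}

/-- A partition of `{1, …, d}` (as `Fin d`) all of whose blocks have two elements. -/
def IsPairing {d : ℕ} (π : Finpartition (Finset.univ : Finset (Fin d))) : Prop :=
  ∀ B ∈ π.parts, B.card = 2

/-- There are no `j₁ < k₁ < j₂ < k₂` with `j₁, j₂` in one block and `k₁, k₂` in another one. -/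
def IsNoncrossing {d : ℕ} (π : Finpartition (Finset.univ : Finset (Fin d))) : Prop :=
  ∀ B ∈ π.parts, ∀ C ∈ π.parts, ∀ j₁ ∈ B, ∀ j₂ ∈ B, ∀ k₁ ∈ C, ∀ k₂ ∈ C,
    j₁ < k₁ → k₁ < j₂ → j₂ < k₂ → B = C

open Classical in
/-- The value of the semicircular state on a monomial `z_{i(1)} ⋯ z_{i(d)}`: the sum over the
noncrossing pair partitions `π` of `{1, …, d}` of the product over the blocks `{j, k}` of `π` of
`σ_{i(j)} σ_{i(k)} 1{i(j) = i(k)}`. -/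
def wordMoment {I : Type*} (σ : I → ℝ) (w : List I) : ℝ :=
  ∑ π : Finpartition (Finset.univ : Finset (Fin w.length)) with IsPairing π ∧ IsNoncrossing π,
    ∏ B ∈ π.parts,
      (∏ j ∈ B, σ (w.get j)) * (if ∀ j ∈ B, ∀ k ∈ B, w.get j = w.get k then 1 else 0)

/-- The linear extension of `wordMoment` to all noncommutative polynomials. -/
def semicircularState {I : Type*} (σ : I → ℝ) : FreeAlgebra ℂ I →ₗ[ℂ] ℂ :=
  (FreeAlgebra.basisFreeMonoid ℂ I).constr ℂ fun w => (wordMoment σ (FreeMonoid.toList w) : ℂ)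

/-- The rank one matrix `x y^*`. -/
def outer {N : ℕ} (x y : EuclideanSpace ℂ (Fin N)) : Matrix (Fin N) (Fin N) ℂ :=
  Matrix.vecMulVec x.ofLp (star y.ofLp)

/-- The trace of the ordered product over `s = 1, …, r` of `x^{(s-1)} y^{(s)*} p_s(Z)`. The
index `s` runs over `Fin r`, with subtraction modulo `r`, so that `x^{(0)} = x^{(r)}`. -/
def cyclicTrace {I : Type*} {r N : ℕ} [NeZero r] (x y : Fin r → EuclideanSpace ℂ (Fin N))
    (p : Fin r → FreeAlgebra ℂ I) (Z : I → Matrix (Fin N) (Fin N) ℂ) : ℂ :=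
  (List.ofFn fun s : Fin r => outer (x (s - 1)) (y s) * polyEval Z (p s)).prod.trace

end RandomBand

end

/-! The trace of the interlaced product of rank one matrices factors into scalars `y^* p(Z) x`, one
for each `s` (`cyclicTrace_eq_prod`). By linearity only `y · W x` has to be understood, for `W` a
word in the band matrices. The core is `exists_isotropicBound`: every L^p norm of `y · W x - τ(w) (y
· x)` is at most `C η ‖y‖ ‖x‖`, where `η` bounds the standard deviation profile and `C` does not
depend on `N`. For band matrices `η` is of order `ξ^{-1/2}`.

Fluctuations. An L^p form of the Efron–Stein inequality (`nrm_sub_integral_sq_le`) bounds `‖f - E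
f‖_p²` by a constant times the sum, over the independent entries, of the squared norms of the change
of `f` when that entry is set to zero. It rests on the 2-smoothness of L^p (`nrm_add_sq_le`).
Removing an entry from `y · W x` leaves terms `(y W')_k M_kl (W'' x)_l` with shorter words `W'`,
`W''`, and an entry has norm of order `η`. What is needed beyond this is that the norms of `(y
W')_k` and of `(W'' x)_l` are square summable in `k` and `l`. This is `exists_hasEnvelopes`, an
induction on the length of the word which replaces operator norm bounds.

Mean. For `j ≠ k` the mean of `M_jk (W x)_k` does not change if one subtracts from `(W x)_k` its
value with the entry `{j, k}` set to zero, since this entry is centered and independent of the rest.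
The difference contains a second copy of the entry. The copy `M_kj` yields `M_jk W'_kk M_kj (W''
x)_j`, which is close to `σ² s_jk² τ(w') (W'' x)_j` because the law for the shorter word, applied to
basis vectors, gives `W'_kk ≈ τ(w')`. The copy `M_jk` comes with the entry `W'_kj`, whose square
summability in `k` makes the contribution of order `η`; hence `E X²` plays no role. A row has only
one diagonal entry, so the diagonal also contributes only order `η`. As the `s_jk²` sum to one over
`k`, the means satisfy, up to `O(η)`, the recursion of the noncrossing pairings according to the
partner of the first letter (`ncMoment_eq_sum`).

Conclusion. If a power of the bound is summable, the deviations tend to zero almost surely. A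
sufficiently high moment achieves this when `ξ` grows faster than a power of `N`; otherwise one
passes to sparse subsequences, which gives convergence in probability. -/

noncomputable section

namespace RandomBand

/-! ### Norms along a dyadic scale of exponents -/

/-- The `L^p` norm with exponent `p = 2 ^ (k + 1)`. -/
def nrm {Ω : Type*} [MeasurableSpace Ω] (μ : Measure Ω) (k : ℕ) (f : Ω → ℂ) : ℝ :=
  (eLpNorm f ((2 : ℝ≥0∞) ^ (k + 1)) μ).toReal

/-- Measurable functions with finite moments of all orders. -/
structure AllMoments {Ω : Type*} [MeasurableSpace Ω] (μ : Measure Ω) (f : Ω → ℂ) : Prop where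
  measurable : Measurable f
  memLp : ∀ k : ℕ, MemLp f ((2 : ℝ≥0∞) ^ (k + 1)) μ

/-- Along powers of two, Hölder with equal exponents costs exactly one index: a product in the norm
of index `k` is controlled by its factors in index `k + 1`. All moments being finite, this loss is
harmless. -/
instance holderTriple_two_pow (k : ℕ) :
    ENNReal.HolderTriple ((2 : ℝ≥0∞) ^ (k + 1 + 1)) ((2 : ℝ≥0∞) ^ (k + 1 + 1))
      ((2 : ℝ≥0∞) ^ (k + 1)) := by
  constructor
  rw [pow_succ (2 : ℝ≥0∞) (k + 1), ENNReal.mul_inv (by simp) (by simp), ← mul_add,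
    ENNReal.inv_two_add_inv_two, mul_one]

section Norms

variable {Ω : Type*} [MeasurableSpace Ω] {μ : Measure Ω}

lemma one_le_two_pow_ennreal (k : ℕ) : (1 : ℝ≥0∞) ≤ 2 ^ k := one_le_pow₀ (by norm_num)

lemma nrm_nonneg (k : ℕ) (f : Ω → ℂ) : 0 ≤ nrm μ k f := ENNReal.toReal_nonneg

lemma AllMoments.add {f g : Ω → ℂ} (hf : AllMoments μ f) (hg : AllMoments μ g) :
    AllMoments μ (fun ω => f ω + g ω) :=
  ⟨hf.measurable.add hg.measurable, fun k => (hf.memLp k).add (hg.memLp k)⟩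

lemma AllMoments.sub {f g : Ω → ℂ} (hf : AllMoments μ f) (hg : AllMoments μ g) :
    AllMoments μ (fun ω => f ω - g ω) :=
  ⟨hf.measurable.sub hg.measurable, fun k => (hf.memLp k).sub (hg.memLp k)⟩

lemma AllMoments.mul {f g : Ω → ℂ} (hf : AllMoments μ f) (hg : AllMoments μ g) :
    AllMoments μ (fun ω => f ω * g ω) :=
  ⟨hf.measurable.mul hg.measurable, fun k => (hg.memLp (k + 1)).mul' (hf.memLp (k + 1))⟩

lemma AllMoments.const [IsFiniteMeasure μ] (c : ℂ) : AllMoments μ (fun _ => c) :=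
  ⟨measurable_const, fun _ => memLp_const c⟩

lemma AllMoments.star {f : Ω → ℂ} (hf : AllMoments μ f) : AllMoments μ (fun ω => conj (f ω)) :=
  ⟨Complex.continuous_conj.measurable.comp hf.measurable, fun k =>
    (hf.memLp k).congr_norm (Complex.continuous_conj.measurable.comp
      hf.measurable).aestronglyMeasurable (by simp)⟩

lemma AllMoments.sum [IsFiniteMeasure μ] {α : Type*} (s : Finset α) {f : α → Ω → ℂ}
    (hf : ∀ a ∈ s, AllMoments μ (f a)) : AllMoments μ (fun ω => ∑ a ∈ s, f a ω) := by
  classical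
  induction s using Finset.induction_on with
  | empty => simpa using AllMoments.const (μ := μ) 0
  | insert a s ha ih =>
    simp only [Finset.sum_insert ha]
    exact (hf a (Finset.mem_insert_self a s)).add
      (ih fun b hb => hf b (Finset.mem_insert_of_mem hb))

lemma AllMoments.integrable [IsFiniteMeasure μ] {f : Ω → ℂ} (hf : AllMoments μ f) :
    Integrable f μ := (hf.memLp 0).integrable (one_le_two_pow_ennreal _)

lemma nrm_add_le {f g : Ω → ℂ} (k : ℕ) (hf : AllMoments μ f) (hg : AllMoments μ g) :
    nrm μ k (fun ω => f ω + g ω) ≤ nrm μ k f + nrm μ k g := by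
  rw [nrm, nrm, nrm, ← ENNReal.toReal_add (hf.memLp k).eLpNorm_ne_top (hg.memLp k).eLpNorm_ne_top]
  exact ENNReal.toReal_mono (ENNReal.add_ne_top.2 ⟨(hf.memLp k).eLpNorm_ne_top,
    (hg.memLp k).eLpNorm_ne_top⟩) (eLpNorm_add_le hf.measurable.aestronglyMeasurable
    hg.measurable.aestronglyMeasurable (one_le_two_pow_ennreal _))

lemma nrm_sub_le {f g : Ω → ℂ} (k : ℕ) (hf : AllMoments μ f) (hg : AllMoments μ g) :
    nrm μ k (fun ω => f ω - g ω) ≤ nrm μ k f + nrm μ k g := by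
  rw [nrm, nrm, nrm, ← ENNReal.toReal_add (hf.memLp k).eLpNorm_ne_top (hg.memLp k).eLpNorm_ne_top]
  exact ENNReal.toReal_mono (ENNReal.add_ne_top.2 ⟨(hf.memLp k).eLpNorm_ne_top,
    (hg.memLp k).eLpNorm_ne_top⟩) (eLpNorm_sub_le hf.measurable.aestronglyMeasurable
    hg.measurable.aestronglyMeasurable (one_le_two_pow_ennreal _))

lemma nrm_zero (k : ℕ) : nrm μ k (fun _ => 0) = 0 := by
  rw [nrm]
  have : (fun _ : Ω => (0 : ℂ)) = 0 := rfl
  rw [this, eLpNorm_zero]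
  rfl

lemma nrm_sum_le [IsFiniteMeasure μ] {α : Type*} (s : Finset α) {f : α → Ω → ℂ} (k : ℕ)
    (hf : ∀ a ∈ s, AllMoments μ (f a)) :
    nrm μ k (fun ω => ∑ a ∈ s, f a ω) ≤ ∑ a ∈ s, nrm μ k (f a) := by
  classical
  induction s using Finset.induction_on with
  | empty => simp [nrm_zero]
  | insert a s ha ih =>
    simp only [Finset.sum_insert ha]
    have h : ∀ b ∈ s, AllMoments μ (f b) := fun b hb => hf b (Finset.mem_insert_of_mem hb)
    refine (nrm_add_le k (hf a (Finset.mem_insert_self a s)) (AllMoments.sum s h)).trans ?_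
    gcongr
    exact ih h

lemma nrm_congr {f g : Ω → ℂ} (k : ℕ) (h : f =ᵐ[μ] g) : nrm μ k f = nrm μ k g := by
  rw [nrm, nrm, eLpNorm_congr_ae h]

lemma nrm_mul_le {f g : Ω → ℂ} (k : ℕ) (hf : AllMoments μ f) (hg : AllMoments μ g) :
    nrm μ k (fun ω => f ω * g ω) ≤ nrm μ (k + 1) f * nrm μ (k + 1) g := by
  rw [nrm, nrm, nrm, ← ENNReal.toReal_mul]
  exact ENNReal.toReal_mono (ENNReal.mul_ne_top (hf.memLp _).eLpNorm_ne_top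
    (hg.memLp _).eLpNorm_ne_top) (eLpNorm_smul_le_mul_eLpNorm (φ := f) (f := g)
    hg.measurable.aestronglyMeasurable hf.measurable.aestronglyMeasurable)

lemma nrm_const [IsProbabilityMeasure μ] (k : ℕ) (c : ℂ) : nrm μ k (fun _ => c) = ‖c‖ := by
  rw [nrm, eLpNorm_const _ (by positivity) (IsProbabilityMeasure.ne_zero μ)]
  simp

lemma nrm_const_mul (k : ℕ) (c : ℂ) (f : Ω → ℂ) :
    nrm μ k (fun ω => c * f ω) = ‖c‖ * nrm μ k f := by
  have : (fun ω => c * f ω) = c • f := by ext; simp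
  rw [nrm, this, eLpNorm_const_smul, ENNReal.toReal_mul]
  simp [nrm]

lemma norm_integral_le_nrm [IsProbabilityMeasure μ] {f : Ω → ℂ} (hf : AllMoments μ f) (k : ℕ) :
    ‖∫ ω, f ω ∂μ‖ ≤ nrm μ k f := by
  rw [← toReal_enorm]
  refine ENNReal.toReal_mono (hf.memLp k).eLpNorm_ne_top
    ((enorm_integral_le_lintegral_enorm f).trans ?_)
  rw [← eLpNorm_one_eq_lintegral_enorm]
  exact eLpNorm_le_eLpNorm_of_exponent_le (one_le_two_pow_ennreal _)
      hf.measurable.aestronglyMeasurable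

lemma integrable_norm_pow [IsFiniteMeasure μ] {f : Ω → ℂ} (hf : AllMoments μ f) (n : ℕ) :
    Integrable (fun ω => ‖f ω‖ ^ n) μ := by
  have h : MemLp f (n : ℝ≥0∞) μ := (hf.memLp n).mono_exponent (by
    have : n ≤ 2 ^ (n + 1) := (Nat.lt_two_pow_self.le).trans (Nat.pow_le_pow_right (by norm_num)
      (Nat.le_succ n))
    exact_mod_cast this)
  exact h.integrable_norm_pow'

lemma nrm_pow [IsFiniteMeasure μ] {f : Ω → ℂ} (hf : AllMoments μ f) (k : ℕ) :
    nrm μ k f ^ (2 ^ (k + 1)) = ∫ ω, ‖f ω‖ ^ (2 ^ (k + 1)) ∂μ := by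
  have h2 : ((2 : ℝ≥0∞) ^ (k + 1)).toReal = ((2 ^ (k + 1) : ℕ) : ℝ) := by simp
  rw [nrm, (hf.memLp k).eLpNorm_eq_integral_rpow_norm (by positivity) (by simp), h2]
  simp only [Real.rpow_natCast]
  rw [ENNReal.toReal_ofReal (by positivity), ← Real.rpow_natCast, ← Real.rpow_mul
    (integral_nonneg fun ω => by positivity), inv_mul_cancel₀ (by positivity), Real.rpow_one]

end Norms

/-! ### A smoothness inequality -/

/-- A first order Taylor bound, meant for `s = |a|²`, `q = |d|²` and `s + u = |a + d|²`, so that `u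
= 2 Re(conj a d) + |d|²`; the conditions on `u` are what these values satisfy. The induction
multiplies by `s + u`, and the mixed monomials that arise lie below the extreme ones `s^n q` and
`q^{n+1}`. -/
lemma pow_add_le_taylor (n : ℕ) : ∃ C : ℝ, 1 ≤ C ∧ ∀ s q u : ℝ, 0 ≤ s → 0 ≤ q → 0 ≤ s + u →
    u ^ 2 ≤ 8 * s * q + 2 * q ^ 2 → s + u ≤ 2 * s + 2 * q →
    (s + u) ^ (n + 1) ≤ s ^ (n + 1) + (n + 1) * s ^ n * u + C * (s ^ n * q + q ^ (n + 1)) := by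
  induction n with
  | zero =>
    refine ⟨1, le_rfl, fun s q u hs hq hu h1 h2 => ?_⟩
    simp
    nlinarith
  | succ n ih =>
    obtain ⟨C, hC, h⟩ := ih
    -- The part `10 (n + 1)` absorbs the new second order term `(n + 1) s^n u²` (see `h6`), and `8
    -- C` the old error multiplied by `s + u ≤ 2 s + 2 q` (see `h7`).
    refine ⟨10 * (n + 1) + 8 * C, by nlinarith, fun s q u hs hq hu h1 h2 => ?_⟩
    have h0 := mul_le_mul_of_nonneg_right (h s q u hs hq hu h1 h2) hu
    have hkey : ∀ a b : ℕ, s ^ (a + 1) * q ^ (b + 1) ≤ s ^ (a + b + 1) * q + q ^ (a + b + 2) := by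
      intro a b
      rcases le_total q s with hqs | hqs
      · have : s ^ (a + 1) * q ^ (b + 1) ≤ s ^ (a + 1) * (s ^ b * q) := by
          rw [pow_succ q b]; gcongr
        have h3 : 0 ≤ q ^ (a + b + 2) := by positivity
        calc _ ≤ _ := this
          _ = s ^ (a + b + 1) * q := by ring
          _ ≤ _ := by linarith
      · have : s ^ (a + 1) * q ^ (b + 1) ≤ q ^ (a + 1) * q ^ (b + 1) := by gcongr
        have h3 : 0 ≤ s ^ (a + b + 1) * q := by positivity
        calc _ ≤ _ := this
          _ = q ^ (a + b + 2) := by ring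
          _ ≤ _ := by linarith
    have hk1 := hkey 0 n
    have hk2 : s ^ n * q ^ 2 ≤ s ^ (n + 1) * q + q ^ (n + 2) := by
      rcases n with _ | n
      · have : 0 ≤ s * q := by positivity
        simpa using this
      · exact hkey n 1
    have hsn : 0 ≤ s ^ n := by positivity
    have h4 : s ^ n * u ^ 2 ≤ s ^ n * (8 * s * q + 2 * q ^ 2) := by gcongr
    have h5 : (s ^ n * q + q ^ (n + 1)) * (s + u) ≤
        (s ^ n * q + q ^ (n + 1)) * (2 * s + 2 * q) := by gcongr
    set E := s ^ (n + 1) * q + q ^ (n + 2) with hE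
    have hE0 : 0 ≤ E := by positivity
    have h6 : s ^ n * (8 * s * q + 2 * q ^ 2) ≤ 10 * E := by
      have : 0 ≤ q ^ (n + 2) := by positivity
      have e : s ^ n * (8 * s * q + 2 * q ^ 2) = 8 * (s ^ (n + 1) * q) + 2 * (s ^ n * q ^ 2) := by
        ring
      rw [e]; linarith
    have h7 : (s ^ n * q + q ^ (n + 1)) * (2 * s + 2 * q) ≤ 8 * E := by
      have e : (s ^ n * q + q ^ (n + 1)) * (2 * s + 2 * q) = 2 * (s ^ (n + 1) * q) +
        2 * (s ^ n * q ^ 2) + 2 * (s ^ (0 + 1) * q ^ (n + 1)) + 2 * q ^ (n + 2) := by ring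
      rw [e]
      have hk3 : s ^ (0 + 1) * q ^ (n + 1) ≤ E := by simpa [hE] using hk1
      linarith
    have h8 : ((n : ℝ) + 1) * (s ^ n * u ^ 2) ≤ (n + 1) * (10 * E) := by
      exact mul_le_mul_of_nonneg_left (h4.trans h6) (by positivity)
    have h9 : C * ((s ^ n * q + q ^ (n + 1)) * (s + u)) ≤ C * (8 * E) := by
      exact mul_le_mul_of_nonneg_left (h5.trans h7) (by linarith)
    push_cast
    have e1 : (s + u) ^ (n + 1 + 1) = (s + u) ^ (n + 1) * (s + u) := by ring
    have e2 : (s ^ (n + 1) + (n + 1) * s ^ n * u + C * (s ^ n * q + q ^ (n + 1))) * (s + u) =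
      s ^ (n + 1 + 1) + (n + 1 + 1) * s ^ (n + 1) * u + (n + 1) * (s ^ n * u ^ 2) +
      C * ((s ^ n * q + q ^ (n + 1)) * (s + u)) := by ring
    rw [e1]
    rw [e2] at h0
    linarith

lemma norm_add_pow_le (n : ℕ) : ∃ C : ℝ, 1 ≤ C ∧ ∀ a d : ℂ,
    ‖a + d‖ ^ (2 * (n + 1)) ≤ ‖a‖ ^ (2 * (n + 1)) +
      2 * (n + 1) * (((‖a‖ ^ (2 * n) : ℝ) : ℂ) * (conj a * d)).re +
      C * (‖a‖ ^ (2 * n) * ‖d‖ ^ 2 + ‖d‖ ^ (2 * (n + 1))) := by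
  obtain ⟨C, hC, h⟩ := pow_add_le_taylor n
  -- The linear term `(n + 1) s^n u` contains `(n + 1) |a|^{2n} |d|²` besides the real part, which
  -- is kept separate because it will integrate to zero.
  refine ⟨C + (n + 1), by linarith [(Nat.cast_nonneg n : (0 : ℝ) ≤ n)], fun a d => ?_⟩
  set v := (conj a * d).re with hv
  have hsum : ‖a + d‖ ^ 2 = ‖a‖ ^ 2 + (2 * v + ‖d‖ ^ 2) := by
    rw [hv, ← Complex.normSq_eq_norm_sq, ← Complex.normSq_eq_norm_sq, ← Complex.normSq_eq_norm_sq,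
      Complex.normSq_apply, Complex.normSq_apply, Complex.normSq_apply]
    simp
    ring
  have hvle : v ^ 2 ≤ ‖a‖ ^ 2 * ‖d‖ ^ 2 := by
    have := Complex.abs_re_le_norm (conj a * d)
    rw [norm_mul, Complex.norm_conj, ← hv] at this
    rw [← mul_pow, ← sq_abs v]
    gcongr
  have hv1 : |v| ≤ ‖a‖ * ‖d‖ := by
    have := Complex.abs_re_le_norm (conj a * d)
    rwa [norm_mul, Complex.norm_conj, ← hv] at this
  have := h (‖a‖ ^ 2) (‖d‖ ^ 2) (2 * v + ‖d‖ ^ 2) (by positivity) (by positivity)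
    (by rw [← hsum]; positivity)
    (by nlinarith [sq_nonneg (2 * v - ‖d‖ ^ 2)])
    (by nlinarith [abs_le.1 hv1, sq_nonneg (‖a‖ - ‖d‖)])
  rw [← hsum, ← pow_mul, ← pow_mul, ← pow_mul, ← pow_mul] at this
  rw [Complex.re_ofReal_mul, ← hv]
  have h3 : 0 ≤ ‖d‖ ^ (2 * (n + 1)) := by positivity
  have hn : (0 : ℝ) ≤ n + 1 := by positivity
  nlinarith [mul_nonneg hn h3]

lemma pow_mul_le_pow_add_pow (n : ℕ) {x y : ℝ} (hx : 0 ≤ x) (hy : 0 ≤ y) :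
    x ^ n * y ≤ x ^ (n + 1) + y ^ (n + 1) := by
  rcases le_total x y with h | h
  · have : x ^ n * y ≤ y ^ n * y := by gcongr
    have h2 : 0 ≤ x ^ (n + 1) := by positivity
    calc _ ≤ _ := this
      _ ≤ _ := by rw [← pow_succ]; linarith
  · have : x ^ n * y ≤ x ^ n * x := by gcongr
    have h2 : 0 ≤ y ^ (n + 1) := by positivity
    calc _ ≤ _ := this
      _ ≤ _ := by rw [← pow_succ]; linarith

/-- The 2-smoothness of L^p for `p = 2^{k+1}`: the first order term of `E |a + d|^p` vanishes by the
orthogonality assumption, and the second order is controlled by `‖d‖_p²`. It is essential that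
`‖a‖_p²` has coefficient one, so that the inequality can be iterated over arbitrarily many
variables. -/
lemma nrm_add_sq_le (k : ℕ) : ∃ C : ℝ, 1 ≤ C ∧ ∀ {Ω : Type*} [MeasurableSpace Ω] (μ : Measure Ω)
    [IsProbabilityMeasure μ] (a d : Ω → ℂ), AllMoments μ a → AllMoments μ d →
    (∀ n : ℕ, ∫ ω, ((‖a ω‖ ^ (2 * n) : ℝ) : ℂ) * (conj (a ω) * d ω) ∂μ = 0) →
    nrm μ k (fun ω => a ω + d ω) ^ 2 ≤ nrm μ k a ^ 2 + C * nrm μ k d ^ 2 := by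
  obtain ⟨n, hn⟩ : ∃ n, 2 ^ k = n + 1 := ⟨2 ^ k - 1, by have := Nat.one_le_two_pow (n := k); omega⟩
  obtain ⟨C, hC, h⟩ := norm_add_pow_le n
  -- Integration gives `A^{2n+2} + 2 C A^{2n} D² + C D^{2n+2}`, which is at most `(A² + 4 C
  -- D²)^{n+1}`.
  refine ⟨4 * C, by linarith, fun {Ω} _ μ _ a d ha hd horth => ?_⟩
  have hexp : 2 ^ (k + 1) = 2 * (n + 1) := by rw [pow_succ, hn]; ring
  have hA0 := nrm_nonneg (μ := μ) k a
  have hD0 := nrm_nonneg (μ := μ) k d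
  have hF0 := nrm_nonneg (μ := μ) k (fun ω => a ω + d ω)
  have htri := nrm_add_le k ha hd
  -- The rescaled Young inequality divides by powers of `A` and `D`; if one of them is zero, the
  -- triangle inequality is enough.
  rcases hA0.eq_or_lt with hA | hA
  · rw [← hA] at htri ⊢
    nlinarith
  rcases hD0.eq_or_lt with hD | hD
  · rw [← hD] at htri ⊢
    nlinarith
  set A := nrm μ k a with hAdef
  set D := nrm μ k d with hDdef
  have hAp := nrm_pow ha k
  have hDp := nrm_pow hd k
  have hFp := nrm_pow (ha.add hd) k
  rw [hexp] at hAp hDp hFp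
  have hAi := integrable_norm_pow ha (2 * (n + 1))
  have hDi := integrable_norm_pow hd (2 * (n + 1))
  have hFi := integrable_norm_pow (ha.add hd) (2 * (n + 1))
  -- Young's inequality, rescaled
  have hyoung : ∀ ω, ‖a ω‖ ^ (2 * n) * ‖d ω‖ ^ 2 ≤ (D ^ 2 * (A ^ 2)⁻¹) * ‖a ω‖ ^ (2 * (n + 1)) +
      (A ^ (2 * n) * (D ^ (2 * n))⁻¹) * ‖d ω‖ ^ (2 * (n + 1)) := by
    intro ω
    have := pow_mul_le_pow_add_pow n (x := ‖a ω‖ ^ 2 * (A ^ 2)⁻¹) (y := ‖d ω‖ ^ 2 * (D ^ 2)⁻¹)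
      (by positivity) (by positivity)
    have h2 : 0 ≤ A ^ (2 * n) * D ^ 2 := by positivity
    have h3 := mul_le_mul_of_nonneg_left this h2
    have e1 : A ^ (2 * n) * D ^ 2 * ((‖a ω‖ ^ 2 * (A ^ 2)⁻¹) ^ n * (‖d ω‖ ^ 2 * (D ^ 2)⁻¹)) =
        ‖a ω‖ ^ (2 * n) * ‖d ω‖ ^ 2 := by
      rw [mul_pow, inv_pow, ← pow_mul, ← pow_mul]
      field_simp
    have e2 : A ^ (2 * n) * D ^ 2 * ((‖a ω‖ ^ 2 * (A ^ 2)⁻¹) ^ (n + 1) +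
        (‖d ω‖ ^ 2 * (D ^ 2)⁻¹) ^ (n + 1)) = (D ^ 2 * (A ^ 2)⁻¹) * ‖a ω‖ ^ (2 * (n + 1)) +
      (A ^ (2 * n) * (D ^ (2 * n))⁻¹) * ‖d ω‖ ^ (2 * (n + 1)) := by
      rw [mul_pow, inv_pow, ← pow_mul, ← pow_mul, mul_pow, inv_pow, ← pow_mul, ← pow_mul,
        mul_add 2 n 1, pow_add A, pow_add D]
      field_simp
      ring
    rw [e1, e2] at h3
    exact h3
  have hoi : Integrable (fun ω => ((‖a ω‖ ^ (2 * n) : ℝ) : ℂ) * (conj (a ω) * d ω)) μ := by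
    have hpow : ∀ j : ℕ, AllMoments μ (fun ω => (conj (a ω) * a ω) ^ j) := by
      intro j
      induction j with
      | zero => simpa using AllMoments.const (μ := μ) 1
      | succ j ih => simpa only [pow_succ] using ih.mul (ha.star.mul ha)
    have := ((hpow n).mul (ha.star.mul hd)).integrable
    refine this.congr (Eventually.of_forall fun ω => ?_)
    simp only
    rw [mul_comm (conj (a ω)) (a ω), Complex.mul_conj, Complex.normSq_eq_norm_sq]
    push_cast
    rw [pow_mul]
  have hpt : ∀ ω, ‖a ω + d ω‖ ^ (2 * (n + 1)) ≤ (1 + C * (D ^ 2 * (A ^ 2)⁻¹)) *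
      ‖a ω‖ ^ (2 * (n + 1)) +
      2 * (n + 1) * (((‖a ω‖ ^ (2 * n) : ℝ) : ℂ) * (conj (a ω) * d ω)).re +
      (C * (A ^ (2 * n) * (D ^ (2 * n))⁻¹) + C) * ‖d ω‖ ^ (2 * (n + 1)) := by
    intro ω
    have h1 := h (a ω) (d ω)
    have h2 := mul_le_mul_of_nonneg_left (hyoung ω) (zero_le_one.trans hC)
    linarith
  have hor : Integrable (fun ω => (((‖a ω‖ ^ (2 * n) : ℝ) : ℂ) * (conj (a ω) * d ω)).re) μ :=
    hoi.re
  have hint := integral_mono hFi (((hAi.const_mul _).add (hor.const_mul _)).add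
    (hDi.const_mul _)) hpt
  rw [integral_add' ((hAi.const_mul _).add (hor.const_mul _)) (hDi.const_mul _),
    integral_add' (hAi.const_mul _) (hor.const_mul _), integral_const_mul, integral_const_mul,
    integral_const_mul] at hint
  have hre : ∫ ω, RCLike.re (((‖a ω‖ ^ (2 * n) : ℝ) : ℂ) * (conj (a ω) * d ω)) ∂μ = 0 := by
    rw [integral_re hoi, horth n]; simp
  simp only [RCLike.re_eq_complex_re] at hre
  rw [hre, ← hAp, ← hDp, ← hFp, mul_zero, add_zero] at hint
  have e3 : (1 + C * (D ^ 2 * (A ^ 2)⁻¹)) * A ^ (2 * (n + 1)) +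
      (C * (A ^ (2 * n) * (D ^ (2 * n))⁻¹) + C) * D ^ (2 * (n + 1)) =
      (A ^ 2) ^ (n + 1) + 2 * C * ((A ^ 2) ^ n * D ^ 2) + C * (D ^ 2) ^ (n + 1) := by
    rw [mul_add 2 n 1, pow_add A, pow_add D, pow_succ (A ^ 2), pow_succ (D ^ 2), ← pow_mul,
      ← pow_mul]
    field_simp
    ring
  rw [e3] at hint
  have hfin : (A ^ 2) ^ (n + 1) + 2 * C * ((A ^ 2) ^ n * D ^ 2) + C * (D ^ 2) ^ (n + 1) ≤
      (A ^ 2 + 4 * C * D ^ 2) ^ (n + 1) := by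
    have hb : (A ^ 2) ^ n ≤ (A ^ 2 + 4 * C * D ^ 2) ^ n := by
      gcongr; nlinarith [sq_nonneg D]
    have hb2 : (D ^ 2) ^ n ≤ (A ^ 2 + 4 * C * D ^ 2) ^ n := by
      gcongr; nlinarith [sq_nonneg D, sq_nonneg A]
    have hC0 : 0 ≤ C := by linarith
    have h1 := mul_le_mul_of_nonneg_left hb (sq_nonneg A)
    have h2 := mul_le_mul_of_nonneg_left hb (by positivity : 0 ≤ 2 * C * D ^ 2)
    have h3 := mul_le_mul_of_nonneg_left hb2 (by positivity : 0 ≤ 2 * C * D ^ 2)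
    have h4 : 0 ≤ C * D ^ 2 * (D ^ 2) ^ n := by positivity
    rw [pow_succ (A ^ 2 + 4 * C * D ^ 2), pow_succ (A ^ 2), pow_succ (D ^ 2)]
    linarith
  have := hint.trans hfin
  rw [pow_mul] at this
  exact le_of_pow_le_pow_left₀ (Nat.succ_ne_zero n) (by positivity) this

end RandomBand

end

noncomputable section

namespace RandomBand

/-! ### Resampling one coordinate -/

section Resampling

open Classical in
/-- Replace the coordinate `e` of `z` by `t`. -/
def upd {ι : Type*} (z : ι → ℂ) (e : ι) (t : ℂ) : ι → ℂ := Function.update z e t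

@[simp] lemma upd_self {ι : Type*} (z : ι → ℂ) (e : ι) (t : ℂ) : upd z e t e = t := by
  simp [upd]

lemma upd_of_ne {ι : Type*} {a e : ι} (h : a ≠ e) (z : ι → ℂ) (t : ℂ) : upd z e t a = z a := by
  classical
  simp [upd, h]

/-- The law `P` is unchanged when one coordinate is replaced by an independent copy of it. -/
def Resamples {ι : Type*} (P : Measure (ι → ℂ)) : Prop :=
  ∀ e : ι, MeasurePreserving (fun p : (ι → ℂ) × ℂ => upd p.1 e p.2)
    (P.prod (P.map fun z => z e)) P

/-- Set the coordinate `e` to zero. -/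
def zap {ι : Type*} (e : ι) (z : ι → ℂ) : ι → ℂ := upd z e 0

/-- Integrate out the coordinate `e`. -/
def avg {ι : Type*} (P : Measure (ι → ℂ)) (e : ι) (f : (ι → ℂ) → ℂ) (z : ι → ℂ) : ℂ :=
  ∫ t, f (upd z e t) ∂(P.map fun z => z e)

variable {ι : Type*} {P : Measure (ι → ℂ)}

lemma measurable_update_prod (e : ι) :
    Measurable (fun p : (ι → ℂ) × ℂ => upd p.1 e p.2) := by
  rw [measurable_pi_iff]
  intro a
  by_cases h : a = e
  · subst h; simpa using measurable_snd
  · simp only [upd_of_ne h]; exact (measurable_pi_apply a).comp measurable_fst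

instance isProbabilityMeasure_map_eval [IsProbabilityMeasure P] (e : ι) :
    IsProbabilityMeasure (P.map fun z => z e) :=
  Measure.isProbabilityMeasure_map (measurable_pi_apply e).aemeasurable

lemma zap_update (e : ι) (z : ι → ℂ) (t : ℂ) :
    zap e (upd z e t) = zap e z := by
  ext a
  unfold zap
  by_cases h : a = e
  · subst h; simp
  · simp [upd_of_ne h]

lemma zap_update_comm {e k : ι} (h : k ≠ e) (z : ι → ℂ) (t : ℂ) :
    zap k (upd z e t) = upd (zap k z) e t := by
  ext a
  unfold zap
  by_cases h1 : a = e <;> by_cases h2 : a = k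
  · exact absurd (h2.symm.trans h1) h
  · subst h1; rw [upd_of_ne h2, upd_self, upd_self]
  · subst h2; rw [upd_self, upd_of_ne h1, upd_self]
  · rw [upd_of_ne h2, upd_of_ne h1, upd_of_ne h1, upd_of_ne h2]

lemma avg_update (e : ι) (f : (ι → ℂ) → ℂ) (z : ι → ℂ) (t : ℂ) :
    avg P e f (upd z e t) = avg P e f z := by
  unfold avg
  congr 1
  ext u
  congr 1
  ext a
  by_cases h : a = e
  · subst h; simp
  · simp [upd_of_ne h]

lemma avg_comp_zap_self [IsProbabilityMeasure P] (e : ι) (f : (ι → ℂ) → ℂ) :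
    avg P e (fun z => f (zap e z)) = fun z => f (zap e z) := by
  ext z
  simp [avg, zap_update]

lemma avg_comp_zap {e k : ι} (h : k ≠ e) (f : (ι → ℂ) → ℂ) :
    avg P e (fun z => f (zap k z)) = fun z => avg P e f (zap k z) := by
  ext z
  unfold avg
  simp only [zap_update_comm h]

variable [IsProbabilityMeasure P]

lemma measurable_avg (e : ι) {f : (ι → ℂ) → ℂ} (hf : Measurable f) : Measurable (avg P e f) := by
  classical
  have : StronglyMeasurable (fun p : (ι → ℂ) × ℂ => f (upd p.1 e p.2)) :=
    (hf.comp (measurable_update_prod e)).stronglyMeasurable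
  have h2 := (this.integral_prod_right' (ν := P.map fun z => z e)).measurable
  exact h2

lemma Resamples.lintegral (hP : Resamples P) (e : ι) {f : (ι → ℂ) → ℝ≥0∞}
    (hf : Measurable f) :
    ∫⁻ z, ∫⁻ t, f (upd z e t) ∂(P.map fun z => z e) ∂P = ∫⁻ z, f z ∂P := by
  have h := (hP e).lintegral_comp hf
  rw [← h, lintegral_prod]
  · exact (hf.comp (hP e).measurable).aemeasurable

lemma Resamples.integrable (hP : Resamples P) (e : ι) {f : (ι → ℂ) → ℂ}
    (hf : Integrable f P) :
    Integrable (fun p : (ι → ℂ) × ℂ => f (upd p.1 e p.2))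
      (P.prod (P.map fun z => z e)) := by
  exact (hP e).integrable_comp_of_integrable hf

lemma Resamples.integral (hP : Resamples P) (e : ι) {f : (ι → ℂ) → ℂ}
    (hf : Integrable f P) (hm : Measurable f) :
    ∫ z, ∫ t, f (upd z e t) ∂(P.map fun z => z e) ∂P = ∫ z, f z ∂P := by
  rw [← integral_prod (fun p : (ι → ℂ) × ℂ => f (upd p.1 e p.2))
    (hP.integrable e hf)]
  have h := (hP e).map_eq
  conv_rhs => rw [← h, integral_map (hP e).measurable.aemeasurable
    hm.aestronglyMeasurable]

lemma Resamples.ae_integrable (hP : Resamples P) (e : ι) {f : (ι → ℂ) → ℂ}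
    (hf : Integrable f P) :
    ∀ᵐ z ∂P, Integrable (fun t => f (upd z e t)) (P.map fun z => z e) :=
  (hP.integrable e hf).prod_right_ae

lemma Resamples.avg_sub_ae (hP : Resamples P) (e : ι) {f g : (ι → ℂ) → ℂ}
    (hf : Integrable f P) (hg : Integrable g P) :
    avg P e (fun z => f z - g z) =ᵐ[P] fun z => avg P e f z - avg P e g z := by
  classical
  filter_upwards [hP.ae_integrable e hf, hP.ae_integrable e hg] with z h1 h2
  unfold avg
  exact integral_sub h1 h2

/-- In each fibre the L^1 norm is at most the L^p norm, and by resampling the p-th powers of the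
fibre norms integrate to the p-th power of the norm of `f`. -/
lemma Resamples.eLpNorm_avg_le (hP : Resamples P) (e : ι) {f : (ι → ℂ) → ℂ}
    (hf : Measurable f) (k : ℕ) :
    eLpNorm (avg P e f) ((2 : ℝ≥0∞) ^ (k + 1)) P ≤ eLpNorm f ((2 : ℝ≥0∞) ^ (k + 1)) P := by
  classical
  set p : ℝ≥0∞ := (2 : ℝ≥0∞) ^ (k + 1)
  have hp0 : p ≠ 0 := by positivity
  have hpt : p ≠ ∞ := by simp [p]
  have hpr : 0 < p.toReal := ENNReal.toReal_pos hp0 hpt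
  rw [eLpNorm_eq_lintegral_rpow_enorm_toReal hp0 hpt, eLpNorm_eq_lintegral_rpow_enorm_toReal hp0 hpt]
  refine ENNReal.rpow_le_rpow ?_ (by positivity)
  rw [← hP.lintegral e (f := fun z => ‖f z‖ₑ ^ p.toReal) (by fun_prop)]
  refine lintegral_mono fun z => ?_
  have hm : Measurable (fun t => f (upd z e t)) :=
    hf.comp ((measurable_update_prod e).comp (measurable_const.prodMk measurable_id))
  have h1 : ‖avg P e f z‖ₑ ≤
      eLpNorm (fun t => f (upd z e t)) p (P.map fun z => z e) := by
    have h2 : ‖avg P e f z‖ₑ ≤ ∫⁻ t, ‖f (upd z e t)‖ₑ ∂(P.map fun z => z e) := by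
      exact enorm_integral_le_lintegral_enorm _
    refine h2.trans ?_
    rw [← eLpNorm_one_eq_lintegral_enorm]
    exact eLpNorm_le_eLpNorm_of_exponent_le (one_le_two_pow_ennreal _) hm.aestronglyMeasurable
  calc ‖avg P e f z‖ₑ ^ p.toReal ≤
      (eLpNorm (fun t => f (upd z e t)) p (P.map fun z => z e)) ^ p.toReal :=
        ENNReal.rpow_le_rpow h1 hpr.le
    _ = _ := by
      rw [eLpNorm_eq_lintegral_rpow_enorm_toReal hp0 hpt, ← ENNReal.rpow_mul, one_div,
        inv_mul_cancel₀ hpr.ne', ENNReal.rpow_one]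

lemma AllMoments.avg (hP : Resamples P) (e : ι) {f : (ι → ℂ) → ℂ} (hf : AllMoments P f) :
    AllMoments P (avg P e f) :=
  ⟨measurable_avg e hf.measurable, fun k => ⟨(measurable_avg e hf.measurable).aestronglyMeasurable,
    (hP.eLpNorm_avg_le e hf.measurable k).trans_lt (hf.memLp k).2⟩⟩

lemma nrm_avg_le (hP : Resamples P) (e : ι) {f : (ι → ℂ) → ℂ} (hf : AllMoments P f) (k : ℕ) :
    nrm P k (avg P e f) ≤ nrm P k f :=
  ENNReal.toReal_mono (hf.memLp k).eLpNorm_ne_top (hP.eLpNorm_avg_le e hf.measurable k)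

lemma Resamples.integral_avg (hP : Resamples P) (e : ι) {f : (ι → ℂ) → ℂ} (hf : AllMoments P f) :
    ∫ z, avg P e f z ∂P = ∫ z, f z ∂P :=
  hP.integral e hf.integrable hf.measurable

lemma AllMoments.normSq_pow {Ω : Type*} [MeasurableSpace Ω] {μ : Measure Ω} [IsFiniteMeasure μ]
    {a : Ω → ℂ} (ha : AllMoments μ a) (n : ℕ) :
    AllMoments μ (fun ω => ((‖a ω‖ ^ (2 * n) : ℝ) : ℂ)) := by
  have h : (fun ω => ((‖a ω‖ ^ (2 * n) : ℝ) : ℂ)) = fun ω => (a ω * conj (a ω)) ^ n := by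
    ext ω
    rw [Complex.mul_conj, Complex.normSq_eq_norm_sq, pow_mul]
    push_cast
    rfl
  rw [h]
  induction n with
  | zero => simpa using AllMoments.const (μ := μ) 1
  | succ j ih =>
    simp only [pow_succ]
    refine AllMoments.mul (ih ?_) (ha.mul ha.star)
    ext ω
    rw [Complex.mul_conj, Complex.normSq_eq_norm_sq, pow_mul]
    push_cast
    rfl

/-- Resampling the coordinate `e` first leaves `h` fixed and integrates the second factor to zero:
`f` minus its average is orthogonal to everything that does not depend on `e`. -/
lemma Resamples.integral_mul_sub_avg (hP : Resamples P) (e : ι)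
    {f h : (ι → ℂ) → ℂ} (hf : AllMoments P f) (hh : AllMoments P h)
    (hinv : ∀ z t, h (upd z e t) = h z) :
    ∫ z, h z * (f z - RandomBand.avg P e f z) ∂P = 0 := by
  have hmom := hh.mul (hf.sub (hf.avg hP e))
  rw [← hP.integral e hmom.integrable hmom.measurable]
  rw [← integral_zero (ι → ℂ) ℂ (μ := P)]
  refine integral_congr_ae ?_
  filter_upwards [hP.ae_integrable e hf.integrable] with z hz
  simp only [hinv, avg_update]
  rw [integral_const_mul, integral_sub hz (integrable_const _)]
  have : ∫ t, f (upd z e t) ∂(P.map fun z => z e) = RandomBand.avg P e f z := by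
    rfl
  rw [this]
  simp

/-- Mean values of products of independent factors: a function of the coordinate `e` and a
function which does not depend on it. -/
lemma Resamples.integral_mul_zap (hP : Resamples P) (e : ι) {φ : ℂ → ℂ} {g : (ι → ℂ) → ℂ}
    (hφ : AllMoments P (fun z => φ (z e))) (hg : AllMoments P fun z => g (zap e z)) :
    ∫ z, φ (z e) * g (zap e z) ∂P = (∫ z, φ (z e) ∂P) * ∫ z, g (zap e z) ∂P := by
  classical
  have hmom := hφ.mul hg
  rw [← hP.integral e hmom.integrable hmom.measurable,
    ← hP.integral e hφ.integrable hφ.measurable]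
  simp only [zap_update, upd_self]
  simp_rw [integral_mul_const]
  rw [integral_const_mul]
  simp

end Resampling

/-! ### Moments of fluctuations -/

/-- One step of the Efron–Stein argument: 2-smoothness is applied to `f = avg f + (f - avg f)`.
Since `f ∘ zap e` does not depend on `e`, subtracting it from `f` does not affect `f - avg f`, and
averaging is a contraction; this costs a factor two, hence four after squaring. -/
lemma nrm_sq_le_avg (k : ℕ) : ∃ C : ℝ, 1 ≤ C ∧ ∀ {ι : Type*} (P : Measure (ι → ℂ))
    [IsProbabilityMeasure P], Resamples P → ∀ (e : ι) (f : (ι → ℂ) → ℂ), AllMoments P f →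
    AllMoments P (fun z => f (zap e z)) →
    nrm P k f ^ 2 ≤ nrm P k (avg P e f) ^ 2 + C * nrm P k (fun z => f z - f (zap e z)) ^ 2 := by
  obtain ⟨C, hC, h⟩ := nrm_add_sq_le k
  refine ⟨C * 4, by linarith, fun {ι} P _ hP e f hf hf0 => ?_⟩
  classical
  have ha := hf.avg hP e
  have h1 := h P (avg P e f) (fun z => f z - avg P e f z) ha (hf.sub ha) (fun n => by
    have := hP.integral_mul_sub_avg e hf ((ha.normSq_pow n).mul ha.star)
      (fun z t => by simp only [avg_update])
    simpa only [mul_assoc] using this)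
  have h2 : nrm P k (fun z => f z - avg P e f z) ≤ 2 * nrm P k (fun z => f z - f (zap e z)) := by
    have hd := hf.sub hf0
    have e1 : (fun z => f z - avg P e f z) =ᵐ[P]
        fun z => (f z - f (zap e z)) - avg P e (fun z => f z - f (zap e z)) z := by
      filter_upwards [hP.avg_sub_ae e hf.integrable hf0.integrable] with z hz
      rw [hz, avg_comp_zap_self]
      ring
    rw [nrm_congr k e1]
    have := nrm_sub_le k hd (hd.avg hP e)
    have h3 := nrm_avg_le hP e hd k
    linarith
  simp only [add_sub_cancel] at h1
  have h3 : nrm P k (fun z => f z - avg P e f z) ^ 2 ≤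
      (2 * nrm P k (fun z => f z - f (zap e z))) ^ 2 :=
    pow_le_pow_left₀ (nrm_nonneg _ _) h2 2
  nlinarith

/-- The coordinates are integrated out one at a time until only the mean is left. Averaging over `e`
commutes with setting another coordinate to zero and contracts norms, so the remaining variations do
not increase. The constant is the one of a single step, however many coordinates there are. -/
lemma nrm_sq_le_sum (k : ℕ) : ∃ C : ℝ, 1 ≤ C ∧ ∀ {ι : Type*} (P : Measure (ι → ℂ))
    [IsProbabilityMeasure P], Resamples P → ∀ (s : Finset ι) (f : (ι → ℂ) → ℂ), AllMoments P f →
    (∀ e, AllMoments P (fun z => f (zap e z))) →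
    (∀ z z', (∀ e ∈ s, z e = z' e) → f z = f z') →
    nrm P k f ^ 2 ≤ ‖∫ z, f z ∂P‖ ^ 2 + C * ∑ e ∈ s, nrm P k (fun z => f z - f (zap e z)) ^ 2 := by
  obtain ⟨C, hC, h⟩ := nrm_sq_le_avg k
  refine ⟨C, hC, fun {ι} P _ hP s => ?_⟩
  classical
  induction s using Finset.induction_on with
  | empty =>
    intro f hf _ hdep
    have : f = fun _ => f 0 := by ext z; exact hdep z 0 (by simp)
    rw [this, nrm_const]
    simp
  | insert e s he ih =>
    intro f hf hfz hdep
    have hstep := h P hP e f hf (hfz e)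
    have hz : ∀ k, AllMoments P (fun z => avg P e f (zap k z)) := by
      intro k
      by_cases hk : k = e
      · subst hk
        have : (fun z => avg P k f (zap k z)) = avg P k f := by
          ext z
          exact avg_update (P := P) k f z 0
        rw [this]
        exact hf.avg hP k
      · rw [← avg_comp_zap hk]
        exact (hfz k).avg hP e
    have hg := ih (avg P e f) (hf.avg hP e) hz (by
      intro z z' hzz
      unfold avg
      congr 1
      ext t
      apply hdep
      intro e' he'
      by_cases h1 : e' = e
      · subst h1; simp
      · simp only [upd_of_ne h1]
        exact hzz e' ((Finset.mem_insert.1 he').resolve_left h1))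
    rw [hP.integral_avg e hf] at hg
    rw [Finset.sum_insert he]
    have hle : ∑ k' ∈ s, nrm P k (fun z => avg P e f z - avg P e f (zap k' z)) ^ 2 ≤
        ∑ k' ∈ s, nrm P k (fun z => f z - f (zap k' z)) ^ 2 := by
      refine Finset.sum_le_sum fun k' hk' => pow_le_pow_left₀ (nrm_nonneg _ _) ?_ 2
      have hne : k' ≠ e := fun h' => he (h' ▸ hk')
      rw [← nrm_congr k ((hP.avg_sub_ae e hf.integrable (hfz k').integrable).trans ?_)]
      · exact nrm_avg_le hP e (hf.sub (hfz k')) k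
      · rw [avg_comp_zap hne]
    have hC0 : 0 ≤ C := by linarith
    have := mul_le_mul_of_nonneg_left hle hC0
    linarith

/-- The fluctuation of a function of finitely many independent variables around its mean is
controlled by the effect of setting single variables to zero. -/
lemma nrm_sub_integral_sq_le (k : ℕ) : ∃ C : ℝ, 1 ≤ C ∧ ∀ {ι : Type*} (P : Measure (ι → ℂ))
    [IsProbabilityMeasure P], Resamples P → ∀ (s : Finset ι) (f : (ι → ℂ) → ℂ), AllMoments P f →
    (∀ e, AllMoments P (fun z => f (zap e z))) →
    (∀ z z', (∀ e ∈ s, z e = z' e) → f z = f z') →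
    nrm P k (fun z => f z - ∫ z', f z' ∂P) ^ 2 ≤
      C * ∑ e ∈ s, nrm P k (fun z => f z - f (zap e z)) ^ 2 := by
  obtain ⟨C, hC, h⟩ := nrm_sq_le_sum k
  refine ⟨C, hC, fun {ι} P _ hP s f hf hfz hdep => ?_⟩
  have hc := AllMoments.const (μ := P) (∫ z', f z' ∂P)
  have := h P hP s (fun z => f z - ∫ z', f z' ∂P) (hf.sub hc) (fun e => (hfz e).sub hc)
    (fun z z' hzz => by simp only [hdep z z' hzz])
  simp only [sub_sub_sub_cancel_right] at this
  rw [integral_sub hf.integrable hc.integrable] at this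
  simpa using this

end RandomBand

end

noncomputable section

namespace RandomBand

/-! ### Words in random matrices -/

/-- Telescoping with `F` to the left of the changed letter and `G` to its right. Used with `G` the
matrices after an entry has been set to zero, so only the right factors are modified. -/
lemma list_prod_sub_list_prod {I R : Type*} [Ring R] (F G : I → R) (w : List I) :
    (w.map F).prod - (w.map G).prod = ∑ a : Fin w.length,
      ((w.take a).map F).prod * ((F (w.get a) - G (w.get a)) * ((w.drop (a + 1)).map G).prod) := by
  induction w with
  | nil => simp
  | cons i w ih =>
    have h : ((i :: w).map F).prod - ((i :: w).map G).prod =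
        (F i - G i) * (w.map G).prod + F i * ((w.map F).prod - (w.map G).prod) := by
      simp only [List.map_cons, List.prod_cons]; noncomm_ring
    rw [h, ih]
    erw [Fin.sum_univ_succ]
    simp [Finset.mul_sum, mul_assoc]

/-- The matrices with entries `φ i j k (z (i, {j, k}))`. -/
def mat {I : Type*} {N : ℕ} (φ : I → Fin N → Fin N → ℂ → ℂ) (z : I × Sym2 (Fin N) → ℂ) (i : I) :
    Matrix (Fin N) (Fin N) ℂ :=
  Matrix.of fun j k => φ i j k (z (i, s(j, k)))

/-- The product of the matrices `mat φ z i` over the letters of a word. -/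
def wordMat {I : Type*} {N : ℕ} (φ : I → Fin N → Fin N → ℂ → ℂ) (w : List I)
    (z : I × Sym2 (Fin N) → ℂ) : Matrix (Fin N) (Fin N) ℂ :=
  (w.map (mat φ z)).prod

/-- Families of random matrices with independent entries (up to symmetry), a variance profile `s`
with row sums at most one, and centered entries off the diagonal. -/
structure IsBandModel {I : Type*} {N : ℕ} (K : ℕ → ℝ) (P : Measure (I × Sym2 (Fin N) → ℂ))
    (φ : I → Fin N → Fin N → ℂ → ℂ) (s : I → Fin N → Fin N → ℝ) : Prop where
  prob : IsProbabilityMeasure P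
  resamples : Resamples P
  entry_zero : ∀ i j k, φ i j k 0 = 0
  moments : ∀ i j k, AllMoments P (fun z => φ i j k (z (i, s(j, k))))
  nrm_le : ∀ i j k l, nrm P l (fun z => φ i j k (z (i, s(j, k)))) ≤ K l * s i j k
  nonneg : ∀ i j k, 0 ≤ s i j k
  symm : ∀ i j k, s i j k = s i k j
  sum_le : ∀ i j, ∑ k, s i j k ^ 2 ≤ 1
  centered : ∀ i j k, j ≠ k → ∫ z, φ i j k (z (i, s(j, k))) ∂P = 0

lemma zap_of_ne {ι : Type*} {c e : ι} (h : e ≠ c) (z : ι → ℂ) : zap c z e = z e :=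
  upd_of_ne h z 0

lemma zap_self {ι : Type*} (c : ι) (z : ι → ℂ) : zap c z c = 0 := upd_self z c 0

open Matrix

section

variable {I : Type*} {N : ℕ} {K : ℕ → ℝ} {P : Measure (I × Sym2 (Fin N) → ℂ)}
  {φ : I → Fin N → Fin N → ℂ → ℂ} {s : I → Fin N → Fin N → ℝ}

open Classical in
lemma mat_sub_mat_zap (h : IsBandModel K P φ s) (c : I × Sym2 (Fin N))
    (z : I × Sym2 (Fin N) → ℂ) (i : I) (j k : Fin N) :
    (mat φ z i - mat φ (zap c z) i) j k = if (i, s(j, k)) = c then mat φ z i j k else 0 := by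
  simp only [mat, Matrix.sub_apply, of_apply]
  split_ifs with hc
  · rw [← hc, zap_self, h.entry_zero, sub_zero]
  · rw [zap_of_ne hc, sub_self]

lemma IsBandModel.moments_zap (h : IsBandModel K P φ s) (c : I × Sym2 (Fin N)) (i : I)
    (j k : Fin N) : AllMoments P (fun z => mat φ (zap c z) i j k) := by
  have := h.prob
  simp only [mat, of_apply]
  by_cases hc : (i, s(j, k)) = c
  · subst hc
    simpa only [zap_self, h.entry_zero] using AllMoments.const (μ := P) 0
  · simpa only [zap_of_ne hc] using h.moments i j k

lemma moments_wordMat_comp [IsProbabilityMeasure P]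
    {g : (I × Sym2 (Fin N) → ℂ) → (I × Sym2 (Fin N) → ℂ)}
    (h : ∀ i j k, AllMoments P (fun z => mat φ (g z) i j k)) (w : List I) (j k : Fin N) :
    AllMoments P (fun z => wordMat φ w (g z) j k) := by
  induction w generalizing j with
  | nil => exact AllMoments.const _
  | cons i w ih =>
    simp only [wordMat, List.map_cons, List.prod_cons, mul_apply]
    exact AllMoments.sum _ fun l _ => (h i j l).mul (ih l)

lemma IsBandModel.moments_word (h : IsBandModel K P φ s) (w : List I) (j k : Fin N) :
    AllMoments P (fun z => wordMat φ w z j k) :=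
  haveI := h.prob
  moments_wordMat_comp (g := id) h.moments w j k

lemma IsBandModel.moments_word_zap (h : IsBandModel K P φ s) (c : I × Sym2 (Fin N)) (w : List I)
    (j k : Fin N) : AllMoments P (fun z => wordMat φ w (zap c z) j k) :=
  haveI := h.prob
  moments_wordMat_comp (h.moments_zap c) w j k

lemma IsBandModel.moments_mulVec (h : IsBandModel K P φ s) (w : List I) (x : Fin N → ℂ)
    (j : Fin N) : AllMoments P (fun z => (wordMat φ w z *ᵥ x) j) :=
  haveI := h.prob
  AllMoments.sum Finset.univ (f := fun k z => wordMat φ w z j k * x k)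
    fun k _ => (h.moments_word w j k).mul (AllMoments.const (x k))

lemma IsBandModel.moments_mulVec_zap (h : IsBandModel K P φ s) (c : I × Sym2 (Fin N))
    (w : List I) (x : Fin N → ℂ) (j : Fin N) :
    AllMoments P (fun z => (wordMat φ w (zap c z) *ᵥ x) j) :=
  haveI := h.prob
  AllMoments.sum Finset.univ (f := fun k z => wordMat φ w (zap c z) j k * x k)
    fun k _ => (h.moments_word_zap c w j k).mul (AllMoments.const (x k))

lemma IsBandModel.moments_vecMul (h : IsBandModel K P φ s) (w : List I) (y : Fin N → ℂ)
    (j : Fin N) : AllMoments P (fun z => (y ᵥ* wordMat φ w z) j) :=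
  haveI := h.prob
  AllMoments.sum Finset.univ (f := fun k z => y k * wordMat φ w z k j)
    fun k _ => (AllMoments.const (y k)).mul (h.moments_word w k j)

lemma IsBandModel.moments_form (h : IsBandModel K P φ s) (w : List I) (y x : Fin N → ℂ) :
    AllMoments P (fun z => y ⬝ᵥ wordMat φ w z *ᵥ x) :=
  haveI := h.prob
  AllMoments.sum _ fun k _ => (AllMoments.const (y k)).mul (h.moments_mulVec w x k)

lemma IsBandModel.moments_form_zap (h : IsBandModel K P φ s) (c : I × Sym2 (Fin N)) (w : List I)
    (y x : Fin N → ℂ) : AllMoments P (fun z => y ⬝ᵥ wordMat φ w (zap c z) *ᵥ x) :=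
  haveI := h.prob
  AllMoments.sum _ fun k _ => (AllMoments.const (y k)).mul (h.moments_mulVec_zap c w x k)

open Classical in
/-- The effect of setting one entry to zero. -/
lemma form_sub_form_zap (h : IsBandModel K P φ s) (w : List I) (y x : Fin N → ℂ)
    (c : I × Sym2 (Fin N)) (z : I × Sym2 (Fin N) → ℂ) :
    y ⬝ᵥ wordMat φ w z *ᵥ x - y ⬝ᵥ wordMat φ w (zap c z) *ᵥ x =
      ∑ t : Fin w.length × Fin N × Fin N with (w.get t.1, s(t.2.1, t.2.2)) = c,
        (y ᵥ* wordMat φ (w.take t.1) z) t.2.1 * (mat φ z (w.get t.1) t.2.1 t.2.2 *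
          (wordMat φ (w.drop (t.1 + 1)) (zap c z) *ᵥ x) t.2.2) := by
  rw [← dotProduct_sub, ← sub_mulVec]
  unfold wordMat
  rw [list_prod_sub_list_prod, sum_mulVec, dotProduct_sum, Finset.sum_filter,
    Fintype.sum_prod_type]
  refine Finset.sum_congr rfl fun a _ => ?_
  rw [Fintype.sum_prod_type, ← mulVec_mulVec, ← mulVec_mulVec, dotProduct_mulVec, dotProduct]
  refine Finset.sum_congr rfl fun k _ => ?_
  rw [mulVec, dotProduct, Finset.mul_sum]
  refine Finset.sum_congr rfl fun l _ => ?_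
  rw [mat_sub_mat_zap h]
  split_ifs <;> simp

-- The label of an entry is an unordered pair, so each letter of the word meets it in at most two
-- ordered ways.
open Classical in
lemma card_fiber_le (w : List I) (c : I × Sym2 (Fin N)) :
    (Finset.univ.filter fun t : Fin w.length × Fin N × Fin N =>
      (w.get t.1, s(t.2.1, t.2.2)) = c).card ≤ 2 * w.length := by
  obtain ⟨i, q⟩ := c
  induction q using Sym2.ind with
  | _ u v =>
    calc _ ≤ ((Finset.univ : Finset (Fin w.length)) ×ˢ
          ({(u, v), (v, u)} : Finset (Fin N × Fin N))).card := by
          refine Finset.card_le_card fun t ht => ?_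
          simp only [Finset.mem_filter, Finset.mem_univ, true_and, Prod.mk.injEq, Sym2.eq_iff] at ht
          simp only [Finset.mem_product, Finset.mem_univ, true_and, Finset.mem_insert,
            Finset.mem_singleton, Prod.ext_iff]
          exact ht.2
      _ ≤ _ := by
          rw [Finset.card_product, Finset.card_univ, Fintype.card_fin, mul_comm]
          gcongr
          exact Finset.card_le_two

/-- The bound for the fluctuations of `y · W x` resulting from bounds for the factors. -/
def fluctSum (s : I → Fin N → Fin N → ℝ) (w : List I) (L h : Fin w.length → Fin N → ℝ) : ℝ :=
  ∑ t : Fin w.length × Fin N × Fin N, (L t.1 t.2.1 * (s (w.get t.1) t.2.1 t.2.2 * h t.1 t.2.2)) ^ 2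

lemma fluctSum_nonneg (w : List I) (L h : Fin w.length → Fin N → ℝ) : 0 ≤ fluctSum s w L h :=
  Finset.sum_nonneg fun _ _ => sq_nonneg _

/-- Hölder twice: the left factor is measured in index `m + 1`, the entry and the right factor in `m
+ 2`. Cauchy–Schwarz over a fibre costs `2 |w|`, and each triple (position, row, column) belongs to
a single label, so the sum over labels is at most the full sum over triples. The right factor is
evaluated after the entry `c` was removed, which is why its bound has to be uniform in `c`. -/
lemma sum_nrm_sub_zap_sq_le (hK : ∀ l, 0 ≤ K l) (hM : IsBandModel K P φ s) (m : ℕ) (w : List I)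
    (y x : Fin N → ℂ) (L h : Fin w.length → Fin N → ℝ)
    (hL : ∀ (a : Fin w.length) k, nrm P (m + 1) (fun z => (y ᵥ* wordMat φ (w.take a) z) k) ≤ L a k)
    (hh : ∀ (a : Fin w.length) l c, nrm P (m + 2)
      (fun z => (wordMat φ (w.drop (a + 1)) (zap c z) *ᵥ x) l) ≤ h a l)
    (A : Finset (I × Sym2 (Fin N))) :
    ∑ c ∈ A, nrm P m (fun z => y ⬝ᵥ wordMat φ w z *ᵥ x - y ⬝ᵥ wordMat φ w (zap c z) *ᵥ x) ^ 2 ≤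
      2 * w.length * K (m + 2) ^ 2 * fluctSum s w L h := by
  classical
  have := hM.prob
  have hL0 : ∀ a k, 0 ≤ L a k := fun a k => (nrm_nonneg _ _).trans (hL a k)
  have key : ∀ c, nrm P m
      (fun z => y ⬝ᵥ wordMat φ w z *ᵥ x - y ⬝ᵥ wordMat φ w (zap c z) *ᵥ x) ^ 2 ≤
      2 * w.length * ∑ t : Fin w.length × Fin N × Fin N with (w.get t.1, s(t.2.1, t.2.2)) = c,
        (L t.1 t.2.1 * (K (m + 2) * s (w.get t.1) t.2.1 t.2.2 * h t.1 t.2.2)) ^ 2 := by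
    intro c
    have h1 : nrm P m (fun z => y ⬝ᵥ wordMat φ w z *ᵥ x - y ⬝ᵥ wordMat φ w (zap c z) *ᵥ x) ≤
        ∑ t : Fin w.length × Fin N × Fin N with (w.get t.1, s(t.2.1, t.2.2)) = c,
          L t.1 t.2.1 * (K (m + 2) * s (w.get t.1) t.2.1 t.2.2 * h t.1 t.2.2) := by
      simp only [form_sub_form_zap hM]
      have hmom : ∀ t : Fin w.length × Fin N × Fin N,
          AllMoments P (fun z => mat φ z (w.get t.1) t.2.1 t.2.2 *
            (wordMat φ (w.drop (t.1 + 1)) (zap c z) *ᵥ x) t.2.2) := fun t =>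
        (hM.moments (w.get t.1) t.2.1 t.2.2).mul (hM.moments_mulVec_zap c _ x _)
      refine (nrm_sum_le _ m fun t _ => (hM.moments_vecMul (w.take t.1) y t.2.1).mul
        (hmom t)).trans (Finset.sum_le_sum fun t _ => ?_)
      refine (nrm_mul_le m (hM.moments_vecMul (w.take t.1) y t.2.1) (hmom t)).trans ?_
      refine mul_le_mul (hL _ _) ?_ (nrm_nonneg _ _) (hL0 _ _)
      refine (nrm_mul_le (m + 1) (hM.moments (w.get t.1) t.2.1 t.2.2)
        (hM.moments_mulVec_zap c _ x _)).trans ?_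
      exact mul_le_mul (hM.nrm_le _ _ _ _) (hh _ _ _) (nrm_nonneg _ _)
        (mul_nonneg (hK _) (hM.nonneg _ _ _))
    refine (pow_le_pow_left₀ (nrm_nonneg _ _) h1 2).trans ?_
    refine sq_sum_le_card_mul_sum_sq.trans ?_
    refine mul_le_mul_of_nonneg_right ?_ (Finset.sum_nonneg fun _ _ => sq_nonneg _)
    exact_mod_cast card_fiber_le w c
  refine (Finset.sum_le_sum fun c _ => key c).trans ?_
  rw [← Finset.mul_sum, mul_assoc (2 * (w.length : ℝ))]
  refine mul_le_mul_of_nonneg_left ?_ (by positivity : (0 : ℝ) ≤ 2 * w.length)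
  simp only [Finset.sum_filter]
  rw [Finset.sum_comm, fluctSum, Finset.mul_sum]
  refine Finset.sum_le_sum fun t _ => ?_
  rw [Finset.sum_ite_eq]
  have e : K (m + 2) ^ 2 * (L t.1 t.2.1 * (s (w.get t.1) t.2.1 t.2.2 * h t.1 t.2.2)) ^ 2 =
    (L t.1 t.2.1 * (K (m + 2) * s (w.get t.1) t.2.1 t.2.2 * h t.1 t.2.2)) ^ 2 := by ring
  rw [e]
  split_ifs
  · exact le_rfl
  · positivity

lemma form_congr (w : List I) (y x : Fin N → ℂ) {z z' : I × Sym2 (Fin N) → ℂ}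
    (h : ∀ i ∈ w, ∀ q, z (i, q) = z' (i, q)) :
    y ⬝ᵥ wordMat φ w z *ᵥ x = y ⬝ᵥ wordMat φ w z' *ᵥ x := by
  have : w.map (mat φ z) = w.map (mat φ z') := by
    refine List.map_congr_left fun i hi => ?_
    ext j k
    simp [mat, h i hi]
  rw [wordMat, wordMat, this]

end

lemma nrm_form_sub_integral_sq_le (m : ℕ) : ∃ C : ℝ, 1 ≤ C ∧ ∀ {I : Type*} {N : ℕ} {K : ℕ → ℝ}
    {P : Measure (I × Sym2 (Fin N) → ℂ)} {φ : I → Fin N → Fin N → ℂ → ℂ}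
    {s : I → Fin N → Fin N → ℝ}, (∀ l, 0 ≤ K l) → IsBandModel K P φ s → ∀ (w : List I)
    (y x : Fin N → ℂ) (L h : Fin w.length → Fin N → ℝ),
    (∀ (a : Fin w.length) k, nrm P (m + 1) (fun z => (y ᵥ* wordMat φ (w.take a) z) k) ≤ L a k) →
    (∀ (a : Fin w.length) l c, nrm P (m + 2)
      (fun z => (wordMat φ (w.drop (a + 1)) (zap c z) *ᵥ x) l) ≤ h a l) →
    nrm P m (fun z => y ⬝ᵥ wordMat φ w z *ᵥ x - ∫ z', y ⬝ᵥ wordMat φ w z' *ᵥ x ∂P) ^ 2 ≤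
      C * (2 * w.length * K (m + 2) ^ 2 * fluctSum s w L h) := by
  obtain ⟨C, hC, hmain⟩ := nrm_sub_integral_sq_le m
  refine ⟨C, hC, fun {I N K P φ s} hK hM w y x L h hL hh => ?_⟩
  classical
  have := hM.prob
  -- Only the finitely many entries of the letters of `w` influence the form, even if `I` is
  -- infinite.
  refine (hmain P hM.resamples (w.toFinset ×ˢ Finset.univ) (fun z => y ⬝ᵥ wordMat φ w z *ᵥ x)
    (hM.moments_form w y x) (fun c => hM.moments_form_zap c w y x) ?_).trans ?_
  · intro z z' hzz
    refine form_congr w y x fun i hi q => hzz _ ?_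
    simpa using hi
  · exact mul_le_mul_of_nonneg_left (sum_nrm_sub_zap_sq_le hK hM m w y x L h hL hh _)
      (by linarith)

/-! ### Removing one off-diagonal entry. -/

section

variable {I : Type*} {N : ℕ} {K : ℕ → ℝ} {P : Measure (I × Sym2 (Fin N) → ℂ)}
  {φ : I → Fin N → Fin N → ℂ → ℂ} {s : I → Fin N → Fin N → ℝ}

open Classical in
lemma mulVec_sub_mulVec_zap (h : IsBandModel K P φ s) (w : List I) (x : Fin N → ℂ) (i : I)
    {j k : Fin N} (hjk : j ≠ k) (z : I × Sym2 (Fin N) → ℂ) (r : Fin N) :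
    (wordMat φ w z *ᵥ x) r - (wordMat φ w (zap (i, s(j, k)) z) *ᵥ x) r =
      ∑ a : Fin w.length, if w.get a = i then
        wordMat φ (w.take a) z r j * (mat φ z i j k *
          (wordMat φ (w.drop (a + 1)) (zap (i, s(j, k)) z) *ᵥ x) k) +
        wordMat φ (w.take a) z r k * (mat φ z i k j *
          (wordMat φ (w.drop (a + 1)) (zap (i, s(j, k)) z) *ᵥ x) j) else 0 := by
  have := form_sub_form_zap h w (Pi.single r 1) x (i, s(j, k)) z
  rw [single_one_dotProduct, single_one_dotProduct] at this
  rw [this, Finset.sum_filter, Fintype.sum_prod_type]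
  refine Finset.sum_congr rfl fun a _ => ?_
  split_ifs with ha
  · subst ha
    simp only [Prod.mk.injEq, true_and, single_one_vecMul]
    rw [← Finset.sum_filter]
    have hf : (Finset.univ.filter fun t : Fin N × Fin N => s(t.1, t.2) = s(j, k)) =
        {(j, k), (k, j)} := by
      ext t
      simp [Prod.ext_iff]
    rw [hf, Finset.sum_pair (by simp [Prod.ext_iff, hjk])]
    rfl
  · refine Finset.sum_eq_zero fun t _ => ?_
    rw [if_neg]
    intro hc
    exact ha (Prod.ext_iff.1 hc).1

/-- The contribution of an off-diagonal entry to the mean. -/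
lemma integral_mul_mulVec (h : IsBandModel K P φ s) (w : List I) (x : Fin N → ℂ) (i : I)
    {j k : Fin N} (hjk : j ≠ k) :
    ∫ z, mat φ z i j k * (wordMat φ w z *ᵥ x) k ∂P =
      ∫ z, mat φ z i j k * ((wordMat φ w z *ᵥ x) k -
        (wordMat φ w (zap (i, s(j, k)) z) *ᵥ x) k) ∂P := by
  have h1 := (h.moments i j k).mul (h.moments_mulVec w x k)
  have h2 := (h.moments i j k).mul (h.moments_mulVec_zap (i, s(j, k)) w x k)
  have hprob := h.prob
  -- After the entry has been removed, the vector is independent of the centered factor `mat φ z i j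
  -- k`, so the subtracted term has mean zero. This takes the place of an integration by parts.
  have h3 := h.resamples.integral_mul_zap (i, s(j, k)) (φ := φ i j k)
    (g := fun z => (wordMat φ w z *ᵥ x) k) (h.moments i j k) (h.moments_mulVec_zap _ w x k)
  rw [h.centered i j k hjk, zero_mul] at h3
  simp only [mul_sub]
  refine Eq.trans ?_ (integral_sub h1.integrable h2.integrable).symm
  rw [h3, sub_zero]
  rfl

end

end RandomBand

end

noncomputable section

namespace RandomBand

open Matrix

/-! ### Square-summable bounds for the entries of `W x` -/

/-- Bounds `g j` for the norm of `(W x) j` which are stable under setting entries to zero. -/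
structure IsEnvelope {I : Type*} {N : ℕ} (P : Measure (I × Sym2 (Fin N) → ℂ))
    (φ : I → Fin N → Fin N → ℂ → ℂ) (w : List I) (m : ℕ) (x : Fin N → ℂ) (g : Fin N → ℝ) :
    Prop where
  nonneg : ∀ j, 0 ≤ g j
  base : ∀ j, nrm P m (fun z => (wordMat φ w z *ᵥ x) j) ≤ g j
  zap : ∀ c j, nrm P m (fun z => (wordMat φ w (zap c z) *ᵥ x) j) ≤ g j
  variation : ∀ (A : Finset (I × Sym2 (Fin N))) (j : Fin N), ∑ c ∈ A, nrm P m (fun z =>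
    (wordMat φ w z *ᵥ x) j - (wordMat φ w (RandomBand.zap c z) *ᵥ x) j) ^ 2 ≤ g j ^ 2

/-- The words `w` admit envelopes of square sum at most `C ‖x‖²`, uniformly in the model. -/
def HasEnvelopes {I : Type*} (K : ℕ → ℝ) (w : List I) (m : ℕ) (C : ℝ) : Prop :=
  ∀ {N : ℕ} {P : Measure (I × Sym2 (Fin N) → ℂ)} {φ : I → Fin N → Fin N → ℂ → ℂ}
    {s : I → Fin N → Fin N → ℝ}, IsBandModel K P φ s → ∀ x : Fin N → ℂ,
    ∃ g : Fin N → ℝ, IsEnvelope P φ w m x g ∧ ∑ j, g j ^ 2 ≤ C * ∑ j, ‖x j‖ ^ 2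

section

variable {I : Type*} {N : ℕ} {K : ℕ → ℝ} {P : Measure (I × Sym2 (Fin N) → ℂ)}
  {φ : I → Fin N → Fin N → ℂ → ℂ} {s : I → Fin N → Fin N → ℝ}

lemma IsBandModel.sq_le_one (h : IsBandModel K P φ s) (i : I) (j k : Fin N) : s i j k ^ 2 ≤ 1 :=
  (Finset.single_le_sum (f := fun k => s i j k ^ 2) (fun _ _ => sq_nonneg _)
    (Finset.mem_univ k)).trans (h.sum_le i j)

lemma IsBandModel.le_one (h : IsBandModel K P φ s) (i : I) (j k : Fin N) : s i j k ≤ 1 := by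
  have := h.sq_le_one i j k
  nlinarith [h.nonneg i j k]

lemma IsBandModel.sum_le' (h : IsBandModel K P φ s) (i : I) (k : Fin N) :
    ∑ j, s i j k ^ 2 ≤ 1 := by
  simp only [h.symm i _ k]
  exact h.sum_le i k

/-- Doubly substochastic weights do not increase sums. -/
lemma IsBandModel.sum_sum_le (h : IsBandModel K P φ s) (i : I) {f : Fin N → ℝ} (hf : ∀ k, 0 ≤ f k) :
    ∑ j, ∑ k, s i j k ^ 2 * f k ≤ ∑ k, f k := by
  rw [Finset.sum_comm]
  refine Finset.sum_le_sum fun k _ => ?_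
  rw [← Finset.sum_mul]
  exact mul_le_of_le_one_left (hf k) (h.sum_le' i k)

/-- The removed entry reappears in the difference, so two factors `s i j k` are gained, and `s²` has
row sums at most one. The indices follow from successive Hölder inequalities: 1 for the outer entry,
2 for the left word, 3 for the inner entry and the right word; hence `K 1 * K 3`. -/
lemma norm_integral_mul_mulVec_le (hK : ∀ l, 0 ≤ K l) (hM : IsBandModel K P φ s) (w : List I)
    (x : Fin N → ℂ) (i : I) {j k : Fin N} (hjk : j ≠ k) (G : Fin w.length → Fin N → Fin N → ℝ)
    (h : Fin w.length → Fin N → ℝ)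
    (hG : ∀ (a : Fin w.length) r l, nrm P 2 (fun z => wordMat φ (w.take a) z r l) ≤ G a r l)
    (hh : ∀ (a : Fin w.length) l c, nrm P 3
      (fun z => (wordMat φ (w.drop (a + 1)) (zap c z) *ᵥ x) l) ≤ h a l) :
    ‖∫ z, mat φ z i j k * (wordMat φ w z *ᵥ x) k ∂P‖ ≤
      ∑ a, K 1 * K 3 * (s i j k ^ 2 * (G a k j * h a k + G a k k * h a j)) := by
  classical
  have hprob := hM.prob
  have hG0 : ∀ a r l, 0 ≤ G a r l := fun a r l => (nrm_nonneg _ _).trans (hG a r l)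
  have hh0 : ∀ a l, 0 ≤ h a l := fun a l => (nrm_nonneg _ _).trans (hh a l (i, s(j, k)))
  have hMm := hM.moments i j k
  rw [integral_mul_mulVec hM w x i hjk]
  have hd := (hM.moments_mulVec w x k).sub (hM.moments_mulVec_zap (i, s(j, k)) w x k)
  refine (norm_integral_le_nrm (hMm.mul hd) 0).trans ((nrm_mul_le 0 hMm hd).trans ?_)
  have hterm : ∀ (a : Fin w.length) (p q : Fin N), AllMoments P (fun z =>
      wordMat φ (w.take a) z k p * (mat φ z i p q *
          (wordMat φ (w.drop (a + 1)) (zap (i, s(j, k)) z) *ᵥ x) q)) := fun a p q =>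
    (hM.moments_word _ k p).mul ((hM.moments i p q).mul (hM.moments_mulVec_zap _ _ x q))
  have hbd : ∀ (a : Fin w.length) (p q : Fin N), nrm P 1 (fun z =>
      wordMat φ (w.take a) z k p * (mat φ z i p q *
          (wordMat φ (w.drop (a + 1)) (zap (i, s(j, k)) z) *ᵥ x) q)) ≤
        G a k p * (K 3 * s i p q * h a q) := by
    intro a p q
    have h1 := (hM.moments i p q).mul (hM.moments_mulVec_zap (i, s(j, k)) (w.drop (a + 1)) x q)
    refine (nrm_mul_le 1 (hM.moments_word _ k p) h1).trans ?_
    refine mul_le_mul (hG _ _ _) ?_ (nrm_nonneg _ _) (hG0 _ _ _)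
    refine (nrm_mul_le 2 (hM.moments i p q) (hM.moments_mulVec_zap _ _ x q)).trans ?_
    exact mul_le_mul (hM.nrm_le _ _ _ _) (hh _ _ _) (nrm_nonneg _ _)
      (mul_nonneg (hK _) (hM.nonneg _ _ _))
  have hsum : nrm P 1 (fun z => (wordMat φ w z *ᵥ x) k -
      (wordMat φ w (zap (i, s(j, k)) z) *ᵥ x) k) ≤
      ∑ a, K 3 * (s i j k * (G a k j * h a k + G a k k * h a j)) := by
    simp only [mulVec_sub_mulVec_zap hM w x i hjk]
    refine (nrm_sum_le _ 1 fun a _ => ?_).trans (Finset.sum_le_sum fun a _ => ?_)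
    · split_ifs
      · exact (hterm a j k).add (hterm a k j)
      · exact AllMoments.const 0
    · split_ifs
      · refine (nrm_add_le 1 (hterm a j k) (hterm a k j)).trans
          ((add_le_add (hbd a j k) (hbd a k j)).trans (le_of_eq ?_))
        rw [hM.symm i k j]
        ring
      · rw [nrm_zero]
        exact mul_nonneg (hK 3) (mul_nonneg (hM.nonneg _ _ _)
          (add_nonneg (mul_nonneg (hG0 _ _ _) (hh0 _ _)) (mul_nonneg (hG0 _ _ _) (hh0 _ _))))
  calc _ ≤ (K 1 * s i j k) * ∑ a, K 3 * (s i j k * (G a k j * h a k + G a k k * h a j)) :=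
        mul_le_mul (hM.nrm_le _ _ _ _) hsum (nrm_nonneg _ _)
          (mul_nonneg (hK _) (hM.nonneg _ _ _))
    _ = _ := by
        rw [Finset.mul_sum]
        exact Finset.sum_congr rfl fun a _ => by ring

lemma norm_integral_diag_le (hM : IsBandModel K P φ s) (w : List I)
    (x : Fin N → ℂ) (i : I) (j : Fin N) (u : Fin N → ℝ) (hK : ∀ l, 0 ≤ K l)
    (hu : nrm P 1 (fun z => (wordMat φ w z *ᵥ x) j) ≤ u j) :
    ‖∫ z, mat φ z i j j * (wordMat φ w z *ᵥ x) j ∂P‖ ≤ K 1 * s i j j * u j := by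
  have hprob := hM.prob
  refine (norm_integral_le_nrm ((hM.moments i j j).mul (hM.moments_mulVec w x j)) 0).trans ?_
  refine (nrm_mul_le 0 (hM.moments i j j) (hM.moments_mulVec w x j)).trans ?_
  exact mul_le_mul (hM.nrm_le _ _ _ _) hu (nrm_nonneg _ _) (mul_nonneg (hK _) (hM.nonneg _ _ _))

lemma wordMat_cons_mulVec (w : List I) (i : I) (x : Fin N → ℂ) (z : I × Sym2 (Fin N) → ℂ)
    (j : Fin N) : (wordMat φ (i :: w) z *ᵥ x) j =
      ∑ k, mat φ z i j k * (wordMat φ w z *ᵥ x) k := by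
  rw [wordMat, List.map_cons, List.prod_cons, ← mulVec_mulVec]
  rfl

lemma integral_mulVec_cons (hM : IsBandModel K P φ s) (w : List I) (i : I) (x : Fin N → ℂ)
    (j : Fin N) : ∫ z, (wordMat φ (i :: w) z *ᵥ x) j ∂P =
      ∫ z, mat φ z i j j * (wordMat φ w z *ᵥ x) j ∂P +
      ∑ k with k ≠ j, ∫ z, mat φ z i j k * (wordMat φ w z *ᵥ x) k ∂P := by
  have hprob := hM.prob
  simp only [wordMat_cons_mulVec]
  have hint : ∀ k ∈ Finset.univ,
      Integrable (fun z => mat φ z i j k * (wordMat φ w z *ᵥ x) k) P := fun k _ =>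
    ((hM.moments i j k).mul (hM.moments_mulVec w x k)).integrable
  rw [integral_finsetSum _ hint, ← Finset.add_sum_erase _ _ (Finset.mem_univ j)]
  congr 2
  ext k
  simp

lemma norm_integral_mulVec_cons_le (hK : ∀ l, 0 ≤ K l) (hM : IsBandModel K P φ s) (w : List I)
    (x : Fin N → ℂ) (i : I) (j : Fin N) (G : Fin w.length → Fin N → Fin N → ℝ)
    (h : Fin w.length → Fin N → ℝ) (u : Fin N → ℝ)
    (hG : ∀ (a : Fin w.length) r l, nrm P 2 (fun z => wordMat φ (w.take a) z r l) ≤ G a r l)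
    (hh : ∀ (a : Fin w.length) l c, nrm P 3
      (fun z => (wordMat φ (w.drop (a + 1)) (zap c z) *ᵥ x) l) ≤ h a l)
    (hu : nrm P 1 (fun z => (wordMat φ w z *ᵥ x) j) ≤ u j) :
    ‖∫ z, (wordMat φ (i :: w) z *ᵥ x) j ∂P‖ ≤ K 1 * u j +
      ∑ a, K 1 * K 3 * (∑ k, s i j k ^ 2 * (G a k j * h a k) +
        ∑ k, s i j k ^ 2 * (G a k k * h a j)) := by
  have hG0 : ∀ a r l, 0 ≤ G a r l := fun a r l => (nrm_nonneg _ _).trans (hG a r l)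
  have hh0 : ∀ a l, 0 ≤ h a l := fun a l => (nrm_nonneg _ _).trans (hh a l (i, s(j, j)))
  have hu0 : 0 ≤ u j := (nrm_nonneg _ _).trans hu
  rw [integral_mulVec_cons hM]
  refine (norm_add_le _ _).trans (add_le_add ?_ ?_)
  · refine (norm_integral_diag_le hM w x i j u hK hu).trans ?_
    exact mul_le_mul_of_nonneg_right (mul_le_of_le_one_right (hK 1) (hM.le_one i j j)) hu0
  · refine (norm_sum_le _ _).trans ?_
    refine (Finset.sum_le_sum fun k hk => norm_integral_mul_mulVec_le hK hM w x i
      (Finset.mem_filter.1 hk).2.symm G h hG hh).trans ?_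
    refine (Finset.sum_le_sum_of_subset_of_nonneg (Finset.filter_subset _ _)
      fun k _ _ => Finset.sum_nonneg fun a _ => ?_).trans (le_of_eq ?_)
    · exact mul_nonneg (mul_nonneg (hK 1) (hK 3)) (mul_nonneg (sq_nonneg _)
          (add_nonneg (mul_nonneg (hG0 _ _ _) (hh0 _ _)) (mul_nonneg (hG0 _ _ _) (hh0 _ _))))
    · rw [Finset.sum_comm]
      refine Finset.sum_congr rfl fun a _ => ?_
      rw [← Finset.mul_sum, ← Finset.sum_add_distrib]
      simp only [mul_add]

/-- Cauchy–Schwarz against the column `j` of `G`; of the remaining weight `s⁴` one factor `s²` is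
bounded by one and the other is summed over `j`. -/
lemma sum_sq_sum_mul_le (hM : IsBandModel K P φ s) (i : I) (G : Fin N → Fin N → ℝ)
    (h : Fin N → ℝ) {C : ℝ} (hC : 0 ≤ C) (hG : ∀ j, ∑ k, G k j ^ 2 ≤ C) :
    ∑ j, (∑ k, s i j k ^ 2 * (G k j * h k)) ^ 2 ≤ C * ∑ k, h k ^ 2 := by
  have h1 : ∀ j, (∑ k, s i j k ^ 2 * (G k j * h k)) ^ 2 ≤ C * ∑ k, s i j k ^ 2 * h k ^ 2 := by
    intro j
    have h2 : ∑ k, s i j k ^ 2 * (G k j * h k) = ∑ k, G k j * (s i j k ^ 2 * h k) :=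
      Finset.sum_congr rfl fun k _ => by ring
    rw [h2]
    refine (Finset.sum_mul_sq_le_sq_mul_sq _ _ _).trans ?_
    refine mul_le_mul (hG j) (Finset.sum_le_sum fun k _ => ?_)
      (Finset.sum_nonneg fun _ _ => sq_nonneg _) hC
    have h3 := hM.sq_le_one i j k
    have h4 : 0 ≤ s i j k ^ 2 * h k ^ 2 := by positivity
    calc (s i j k ^ 2 * h k) ^ 2 = s i j k ^ 2 * (s i j k ^ 2 * h k ^ 2) := by ring
      _ ≤ _ := mul_le_of_le_one_left h4 h3
  refine (Finset.sum_le_sum fun j _ => h1 j).trans ?_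
  rw [← Finset.mul_sum]
  exact mul_le_mul_of_nonneg_left (hM.sum_sum_le i fun k => sq_nonneg (h k)) hC

/-- Here only diagonal values of `G` occur, each at most `√C` as part of a column, and their
`s²`-weighted row sum is at most `√C`. -/
lemma sum_sq_sum_mul_le' (hM : IsBandModel K P φ s) (i : I) (G : Fin N → Fin N → ℝ)
    (h : Fin N → ℝ) {C : ℝ} (hG : ∀ j, ∑ k, G k j ^ 2 ≤ C) :
    ∑ j, (∑ k, s i j k ^ 2 * (G k k * h j)) ^ 2 ≤ C * ∑ k, h k ^ 2 := by
  rw [Finset.mul_sum]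
  refine Finset.sum_le_sum fun j _ => ?_
  have h2 : ∑ k, s i j k ^ 2 * (G k k * h j) = (∑ k, s i j k * (s i j k * G k k)) * h j := by
    rw [Finset.sum_mul]
    exact Finset.sum_congr rfl fun k _ => by ring
  rw [h2, mul_pow]
  refine mul_le_mul_of_nonneg_right ?_ (sq_nonneg _)
  have hC : 0 ≤ C := (Finset.sum_nonneg fun _ _ => sq_nonneg _).trans (hG j)
  refine (Finset.sum_mul_sq_le_sq_mul_sq _ _ _).trans ?_
  have hGk : ∀ k, G k k ^ 2 ≤ C := fun k =>
    (Finset.single_le_sum (f := fun l => G l k ^ 2) (fun _ _ => sq_nonneg _)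
      (Finset.mem_univ k)).trans (hG k)
  have h5 : ∑ k, (s i j k * G k k) ^ 2 ≤ C := by
    calc _ ≤ ∑ k, s i j k ^ 2 * C := Finset.sum_le_sum fun k _ => by
            rw [mul_pow]; exact mul_le_mul_of_nonneg_left (hGk k) (sq_nonneg _)
      _ = (∑ k, s i j k ^ 2) * C := by rw [Finset.sum_mul]
      _ ≤ C := mul_le_of_le_one_left hC (hM.sum_le i j)
  calc _ ≤ 1 * C := mul_le_mul (hM.sum_le i j) h5 (Finset.sum_nonneg fun _ _ => sq_nonneg _)
          zero_le_one
    _ = C := one_mul C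

/-- Summing first over the starting row `j` uses up the column bounds of `G`; the weights `s²` then
disappear in the sum over `k`, and only the square sum of `h` remains. -/
lemma sum_fluctSum_le (hM : IsBandModel K P φ s) (w : List I)
    (G : Fin w.length → Fin N → Fin N → ℝ) (h : Fin w.length → Fin N → ℝ) (C : Fin w.length → ℝ)
    (hC : ∀ a, 0 ≤ C a) (hG : ∀ a k, ∑ j, G a j k ^ 2 ≤ C a) :
    ∑ j, fluctSum s w (fun a k => G a j k) h ≤ ∑ a, C a * ∑ l, h a l ^ 2 := by
  simp only [fluctSum, Fintype.sum_prod_type]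
  rw [Finset.sum_comm]
  refine Finset.sum_le_sum fun a _ => ?_
  rw [Finset.sum_comm]
  calc _ = ∑ k, ∑ l, s (w.get a) k l ^ 2 * h a l ^ 2 * ∑ j, G a j k ^ 2 := by
        refine Finset.sum_congr rfl fun k _ => ?_
        rw [Finset.sum_comm]
        refine Finset.sum_congr rfl fun l _ => ?_
        rw [Finset.mul_sum]
        exact Finset.sum_congr rfl fun j _ => by ring
    _ ≤ ∑ k, ∑ l, s (w.get a) k l ^ 2 * h a l ^ 2 * C a := by
        refine Finset.sum_le_sum fun k _ => Finset.sum_le_sum fun l _ => ?_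
        exact mul_le_mul_of_nonneg_left (hG a k) (by positivity)
    _ = C a * ∑ k, ∑ l, s (w.get a) k l ^ 2 * h a l ^ 2 := by
        simp only [Finset.mul_sum]
        exact Finset.sum_congr rfl fun k _ => Finset.sum_congr rfl fun l _ => by ring
    _ ≤ _ := mul_le_mul_of_nonneg_left (hM.sum_sum_le _ fun l => sq_nonneg _) (hC a)

end

lemma hasEnvelopes_nil {I : Type*} (K : ℕ → ℝ) (m : ℕ) :
    HasEnvelopes (I := I) K [] m 1 := by
  intro N P φ s hM x
  have := hM.prob
  refine ⟨fun j => ‖x j‖, ⟨fun j => norm_nonneg _, fun j => ?_, fun c j => ?_, fun A j => ?_⟩,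
    by simp⟩
  · simp [wordMat, nrm_const]
  · simp [wordMat, nrm_const]
  · simp [wordMat, nrm_const]

lemma add_sum_sq_le {n : ℕ} (t κ : ℝ) (p q : Fin n → ℝ) :
    (t + ∑ a, κ * (p a + q a)) ^ 2 ≤
      2 * t ^ 2 + 4 * κ ^ 2 * n * ∑ a, (p a ^ 2 + q a ^ 2) := by
  have h1 : (∑ a, κ * (p a + q a)) ^ 2 ≤ n * ∑ a, (κ * (p a + q a)) ^ 2 := by
    simpa using sq_sum_le_card_mul_sum_sq (s := Finset.univ) (f := fun a => κ * (p a + q a))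
  have h2 : ∑ a, (κ * (p a + q a)) ^ 2 ≤ 2 * κ ^ 2 * ∑ a, (p a ^ 2 + q a ^ 2) := by
    rw [Finset.mul_sum]
    refine Finset.sum_le_sum fun a _ => ?_
    nlinarith [mul_nonneg (sq_nonneg κ) (sq_nonneg (p a - q a))]
  have h3 := mul_le_mul_of_nonneg_left h2 (Nat.cast_nonneg (α := ℝ) n)
  nlinarith [sq_nonneg (t - ∑ a, κ * (p a + q a))]

/-- Each coordinate of `M W x` is its mean plus a fluctuation, and both are estimated by envelopes
of strictly shorter words: the mean through the reappearance of the removed entry, the fluctuation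
through the Efron–Stein bound. The latter raises the index of the norm, so the induction must run
over all `m` at once. -/
theorem exists_hasEnvelopes {I : Type*} (K : ℕ → ℝ) (hK : ∀ l, 0 ≤ K l) (w : List I) (m : ℕ) :
    ∃ C : ℝ, 0 ≤ C ∧ HasEnvelopes K w m C := by
  induction hn : w.length using Nat.strong_induction_on generalizing w m with
  | _ n ih =>
  subst hn
  rcases w with _ | ⟨i, w⟩
  · exact ⟨1, zero_le_one, hasEnvelopes_nil K m⟩
  have hw' : w.length < (i :: w).length := by simp
  obtain ⟨Cu, hCu, hu⟩ := ih w.length hw' w 1 rfl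
  have htake : ∀ (a : Fin w.length) (m : ℕ), ∃ C : ℝ, 0 ≤ C ∧ HasEnvelopes K (w.take a) m C :=
    fun a m => ih _ (by simp only [List.length_take, List.length_cons]; omega) (w.take a) m rfl
  have hdrop : ∀ (a : Fin w.length) (m : ℕ),
      ∃ C : ℝ, 0 ≤ C ∧ HasEnvelopes K (w.drop (a + 1)) m C :=
    fun a m => ih _ (by simp only [List.length_drop, List.length_cons]; omega) (w.drop (a + 1)) m rfl
  have htake' : ∀ (a : Fin (i :: w).length) (m : ℕ),
      ∃ C : ℝ, 0 ≤ C ∧ HasEnvelopes K ((i :: w).take a) m C :=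
    fun a m => ih _ (by have := a.2; rw [List.length_take]; omega) ((i :: w).take a) m rfl
  have hdrop' : ∀ (a : Fin (i :: w).length) (m : ℕ),
      ∃ C : ℝ, 0 ≤ C ∧ HasEnvelopes K ((i :: w).drop (a + 1)) m C :=
    fun a m => ih _ (by have := a.2; rw [List.length_drop]; omega) ((i :: w).drop (a + 1)) m rfl
  choose CT hCT hT using htake
  choose CD hCD hD using hdrop
  choose CT' hCT' hT' using htake'
  choose CD' hCD' hD' using hdrop'
  obtain ⟨Cf, hCf, hfluct⟩ := nrm_form_sub_integral_sq_le m
  set κ := K 1 * K 3 with hκ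
  set B : ℝ := 2 * (i :: w).length * K (m + 2) ^ 2 with hB
  have hB0 : 0 ≤ B := by positivity
  set C1 : ℝ := 2 * (K 1 ^ 2 * Cu) +
    4 * κ ^ 2 * w.length * ∑ a, (CT a 2 * CD a 3 + CT a 2 * CD a 3) with hC1
  set C2 : ℝ := ∑ a, CT' a (m + 1) * CD' a (m + 2) with hC2
  have hC20 : 0 ≤ C2 := Finset.sum_nonneg fun a _ => mul_nonneg (hCT' _ _) (hCD' _ _)
  have hC10 : 0 ≤ C1 := by
    have : 0 ≤ ∑ a, (CT a 2 * CD a 3 + CT a 2 * CD a 3) := Finset.sum_nonneg fun a _ =>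
      add_nonneg (mul_nonneg (hCT _ _) (hCD _ _)) (mul_nonneg (hCT _ _) (hCD _ _))
    positivity
  -- The three summands bound the square sums of the means, the fluctuations and the variations; the
  -- factor 3 comes from the square of a sum of three terms.
  refine ⟨3 * (C1 + Cf * (B * C2) + B * C2), by positivity, ?_⟩
  intro N P φ s hM x
  have hprob := hM.prob
  set X := ∑ j, ‖x j‖ ^ 2 with hX
  have hX0 : 0 ≤ X := by positivity
  obtain ⟨u, hu, huX⟩ := hu hM x
  -- Envelopes for basis vectors bound single entries of the left words, with square summable
  -- columns.
  choose G hG hGC using fun (a : Fin w.length) (j : Fin N) => hT a 2 hM (Pi.single j 1)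
  choose h hh hhC using fun a : Fin w.length => hD a 3 hM x
  choose G' hG' hGC' using fun (a : Fin (i :: w).length) (j : Fin N) =>
    hT' a (m + 1) hM (Pi.single j 1)
  choose h' hh' hhC' using fun a : Fin (i :: w).length => hD' a (m + 2) hM x
  have hsingle : ∀ j : Fin N, ∑ k, ‖(Pi.single j (1 : ℂ) : Fin N → ℂ) k‖ ^ 2 = 1 := by
    intro j
    rw [Finset.sum_eq_single j]
    · simp
    · intro k _ hk; simp [Pi.single_eq_of_ne hk]
    · simp
  simp only [hsingle, mul_one] at hGC hGC'
  have hGbase : ∀ (a : Fin w.length) r l,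
      nrm P 2 (fun z => wordMat φ (w.take a) z r l) ≤ G a l r := fun a r l => by
    simpa only [mulVec_single_one, col_apply] using (hG a l).base r
  have hGbase' : ∀ (a : Fin (i :: w).length) r l,
      nrm P (m + 1) (fun z => wordMat φ ((i :: w).take a) z r l) ≤ G' a l r := fun a r l => by
    simpa only [mulVec_single_one, col_apply] using (hG' a l).base r
  set f : Fin N → (I × Sym2 (Fin N) → ℂ) → ℂ := fun j z => (wordMat φ (i :: w) z *ᵥ x) j with hf
  set μ : Fin N → ℝ := fun j => ‖∫ z, f j z ∂P‖ with hμ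
  set S : Fin N → ℝ := fun j => fluctSum s (i :: w) (fun a k => G' a k j) h' with hS
  have hS0 : ∀ j, 0 ≤ S j := fun j => fluctSum_nonneg _ _ _
  -- the means
  have hmean : ∑ j, μ j ^ 2 ≤ C1 * X := by
    have hle : ∀ j, μ j ^ 2 ≤ 2 * (K 1 * u j) ^ 2 + 4 * κ ^ 2 * w.length *
        ∑ a, ((∑ k, s i j k ^ 2 * (G a j k * h a k)) ^ 2 +
          (∑ k, s i j k ^ 2 * (G a k k * h a j)) ^ 2) := by
      intro j
      refine le_trans (pow_le_pow_left₀ (norm_nonneg _) (norm_integral_mulVec_cons_le hK hM w x i j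
        (fun a r l => G a l r) h u hGbase (fun a l c => (hh a).zap c l) (hu.base j)) 2) ?_
      exact add_sum_sq_le _ _ _ _
    refine (Finset.sum_le_sum fun j _ => hle j).trans ?_
    rw [Finset.sum_add_distrib, ← Finset.mul_sum, ← Finset.mul_sum, Finset.sum_comm, hC1, add_mul]
    refine add_le_add ?_ ?_
    · simp only [mul_pow]
      rw [← Finset.mul_sum, mul_assoc, mul_assoc]
      gcongr
    · rw [mul_assoc _ (∑ a, _) X, Finset.sum_mul]
      refine mul_le_mul_of_nonneg_left (Finset.sum_le_sum fun a _ => ?_) (by positivity)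
      rw [Finset.sum_add_distrib, add_mul]
      have e1 := sum_sq_sum_mul_le hM i (fun k j => G a j k) (h a) (hCT a 2) (hGC a)
      have e2 := sum_sq_sum_mul_le' hM i (fun k j => G a j k) (h a) (hGC a)
      have e3 := mul_le_mul_of_nonneg_left (hhC a) (hCT a 2)
      rw [← mul_assoc] at e3
      exact add_le_add (e1.trans e3) (e2.trans e3)
  -- the fluctuations
  have hSsum : ∑ j, S j ≤ C2 * X := by
    refine (sum_fluctSum_le hM (i :: w) (fun a j k => G' a k j) h' (fun a => CT' a (m + 1))
      (fun a => hCT' a _) hGC').trans ?_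
    rw [hC2, Finset.sum_mul]
    refine Finset.sum_le_sum fun a _ => ?_
    rw [mul_assoc]
    exact mul_le_mul_of_nonneg_left (hhC' a) (hCT' a _)
  have hvar : ∀ (A : Finset (I × Sym2 (Fin N))) j,
      ∑ c ∈ A, nrm P m (fun z => f j z - f j (zap c z)) ^ 2 ≤ B * S j := by
    intro A j
    have := sum_nrm_sub_zap_sq_le hK hM m (i :: w) (Pi.single j 1) x (fun a k => G' a k j) h'
      (fun a k => by simpa only [single_one_vecMul, row] using hGbase' a j k)
      (fun a l c => (hh' a).zap c l) A
    simpa only [single_one_dotProduct] using this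
  have hfl : ∀ j, nrm P m (fun z => f j z - ∫ z', f j z' ∂P) ≤ √(Cf * (B * S j)) := by
    intro j
    have := hfluct hK hM (i :: w) (Pi.single j 1) x (fun a k => G' a k j) h'
      (fun a k => by simpa only [single_one_vecMul, row] using hGbase' a j k)
      (fun a l c => (hh' a).zap c l)
    simp only [single_one_dotProduct] at this
    exact Real.le_sqrt_of_sq_le this
  have hbase : ∀ j, nrm P m (f j) ≤ μ j + √(Cf * (B * S j)) := by
    intro j
    have hc := AllMoments.const (μ := P) (∫ z, f j z ∂P)
    have hfm : AllMoments P (f j) := hM.moments_mulVec (i :: w) x j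
    have := nrm_add_le m (hfm.sub hc) hc
    simp only [sub_add_cancel, nrm_const] at this
    have h2 := hfl j
    calc nrm P m (f j) ≤ _ := this
      _ ≤ _ := by rw [add_comm]; exact add_le_add le_rfl h2
  -- Mean, fluctuation and variation. The last summand covers both the effect of removing a single
  -- entry and the total variation over any set of entries.
  refine ⟨fun j => μ j + √(Cf * (B * S j)) + √(B * S j), ⟨?_, ?_, ?_, ?_⟩, ?_⟩
  · intro j; positivity
  · intro j
    exact (hbase j).trans (le_add_of_nonneg_right (Real.sqrt_nonneg _))
  · intro c j
    have hfm : AllMoments P (f j) := hM.moments_mulVec (i :: w) x j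
    have hfz : AllMoments P (fun z => f j (zap c z)) := hM.moments_mulVec_zap c (i :: w) x j
    have h1 : nrm P m (fun z => f j z - f j (zap c z)) ≤ √(B * S j) := by
      refine Real.le_sqrt_of_sq_le ?_
      simpa using hvar {c} j
    have h2 := nrm_sub_le m hfm (hfm.sub hfz)
    simp only [sub_sub_cancel] at h2
    exact h2.trans (add_le_add (hbase j) h1)
  · intro A j
    refine (hvar A j).trans ?_
    have h1 : 0 ≤ μ j + √(Cf * (B * S j)) := by positivity
    have h2 := Real.sq_sqrt (mul_nonneg hB0 (hS0 j))
    nlinarith [Real.sqrt_nonneg (B * S j)]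
  · have hsq : ∀ j, (μ j + √(Cf * (B * S j)) + √(B * S j)) ^ 2 ≤
        3 * (μ j ^ 2 + Cf * (B * S j) + B * S j) := by
      intro j
      have h2 := Real.sq_sqrt (mul_nonneg hB0 (hS0 j))
      have h3 := Real.sq_sqrt (mul_nonneg (zero_le_one.trans hCf) (mul_nonneg hB0 (hS0 j)))
      nlinarith [sq_nonneg (μ j - √(Cf * (B * S j))), sq_nonneg (μ j - √(B * S j)),
        sq_nonneg (√(Cf * (B * S j)) - √(B * S j))]
    refine (Finset.sum_le_sum fun j _ => hsq j).trans ?_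
    rw [← Finset.mul_sum, Finset.sum_add_distrib, Finset.sum_add_distrib, ← Finset.mul_sum,
      ← Finset.mul_sum]
    have e1 := mul_le_mul_of_nonneg_left hSsum hB0
    have e2 := mul_le_mul_of_nonneg_left e1 (zero_le_one.trans hCf)
    nlinarith

end RandomBand

end

noncomputable section

namespace RandomBand

open Matrix

/-! ### The isotropic law for words, with a rate -/

/-- Band models with exact variances: the squares of the profile `s` have row sums one and are, up
to the factor `σ²`, the second moments of the entries off the diagonal. -/
structure IsVarianceModel {I : Type*} {N : ℕ} (K : ℕ → ℝ) (σ : I → ℝ)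
    (P : Measure (I × Sym2 (Fin N) → ℂ)) (φ : I → Fin N → Fin N → ℂ → ℂ)
    (s : I → Fin N → Fin N → ℝ) : Prop extends IsBandModel K P φ s where
  sum_eq : ∀ i j, ∑ k, s i j k ^ 2 = 1
  variance : ∀ i j k, j ≠ k → ∫ z, φ i j k (z (i, s(j, k))) * φ i k j (z (i, s(j, k))) ∂P =
    ((σ i ^ 2 * s i j k ^ 2 : ℝ) : ℂ)

/-- The recursion satisfied by the moments of a free semicircular family. -/
structure IsSemicircular {I : Type*} (σ : I → ℝ) (τ : List I → ℝ) : Prop where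
  nil : τ [] = 1
  cons : ∀ i w, τ (i :: w) = ∑ a : Fin w.length, Set.indicator {i} (fun i => σ i ^ 2) (w.get a) *
    τ (w.take a) * τ (w.drop (a + 1))

/-- The Euclidean norm. -/
def l2 {N : ℕ} (x : Fin N → ℂ) : ℝ := √(∑ j, ‖x j‖ ^ 2)

lemma l2_nonneg {N : ℕ} (x : Fin N → ℂ) : 0 ≤ l2 x := Real.sqrt_nonneg _

lemma sum_norm_mul_le {N : ℕ} (x y : Fin N → ℂ) (g : Fin N → ℝ) {C : ℝ} (hC : 0 ≤ C)
    (hg : ∑ j, g j ^ 2 ≤ C * ∑ j, ‖x j‖ ^ 2) : ∑ j, ‖y j‖ * g j ≤ √C * (l2 y * l2 x) := by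
  refine (Real.sum_mul_le_sqrt_mul_sqrt _ _ _).trans ?_
  calc _ ≤ l2 y * √(C * ∑ j, ‖x j‖ ^ 2) :=
        mul_le_mul_of_nonneg_left (Real.sqrt_le_sqrt hg) (l2_nonneg y)
    _ = _ := by rw [Real.sqrt_mul hC, l2, l2]; ring

lemma sum_norm_single_sq {N : ℕ} (j : Fin N) :
    ∑ k, ‖(Pi.single j (1 : ℂ) : Fin N → ℂ) k‖ ^ 2 = 1 := by
  rw [Finset.sum_eq_single j]
  · simp
  · intro k _ hk; simp [Pi.single_eq_of_ne hk]
  · simp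

lemma l2_single {N : ℕ} (j : Fin N) : l2 (Pi.single j (1 : ℂ) : Fin N → ℂ) = 1 := by
  rw [l2, sum_norm_single_sq, Real.sqrt_one]

section

variable {I : Type*} {N : ℕ} {K : ℕ → ℝ} {P : Measure (I × Sym2 (Fin N) → ℂ)}
  {φ : I → Fin N → Fin N → ℂ → ℂ} {s : I → Fin N → Fin N → ℝ} {σ : I → ℝ}

/-- Labels are unordered, so transposition keeps the randomness. Row vectors `y W` become column
vectors of the reversed word in the transposed model, and envelopes for the left factors follow from
those already constructed. -/
lemma IsBandModel.transpose (h : IsBandModel K P φ s) :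
    IsBandModel K P (fun i j k => φ i k j) s where
  prob := h.prob
  resamples := h.resamples
  entry_zero i j k := h.entry_zero i k j
  moments i j k := by rw [Sym2.eq_swap]; exact h.moments i k j
  nrm_le i j k l := by rw [Sym2.eq_swap, h.symm i j k]; exact h.nrm_le i k j l
  nonneg := h.nonneg
  symm := h.symm
  sum_le := h.sum_le
  centered i j k hjk := by rw [Sym2.eq_swap]; exact h.centered i k j hjk.symm

lemma wordMat_transpose (w : List I) (z : I × Sym2 (Fin N) → ℂ) :
    (wordMat φ w z)ᵀ = wordMat (fun i j k => φ i k j) w.reverse z := by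
  rw [wordMat, transpose_list_prod, wordMat, List.map_map, List.map_reverse]
  congr 3
  ext i j k
  simp [mat, Sym2.eq_swap]

lemma vecMul_wordMat (w : List I) (y : Fin N → ℂ) (z : I × Sym2 (Fin N) → ℂ) :
    y ᵥ* wordMat φ w z = wordMat (fun i j k => φ i k j) w.reverse z *ᵥ y := by
  rw [← wordMat_transpose, mulVec_transpose]

/-- The source of the rate for fluctuations: once `s` is replaced by its bound `η`, the double sum
over the entry factors into the square sums of the left and right envelopes, without any use of row
sums. -/
lemma fluctSum_le (hM : IsBandModel K P φ s) (w : List I) (x y : Fin N → ℂ)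
    (L h : Fin w.length → Fin N → ℝ) {η : ℝ} (hη : ∀ i ∈ w, ∀ j k, s i j k ≤ η)
    (CL CD : Fin w.length → ℝ) (hCL : ∀ a, 0 ≤ CL a)
    (hL : ∀ a, ∑ k, L a k ^ 2 ≤ CL a * ∑ j, ‖y j‖ ^ 2)
    (hh : ∀ a, ∑ k, h a k ^ 2 ≤ CD a * ∑ j, ‖x j‖ ^ 2) :
    fluctSum s w L h ≤ (∑ a, CL a * CD a) * (η * (l2 y * l2 x)) ^ 2 := by
  simp only [fluctSum, Fintype.sum_prod_type]
  rw [Finset.sum_mul]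
  refine Finset.sum_le_sum fun a _ => ?_
  have h1 : ∑ k, ∑ l, (L a k * (s (w.get a) k l * h a l)) ^ 2 ≤
      η ^ 2 * ((∑ k, L a k ^ 2) * ∑ l, h a l ^ 2) := by
    rw [Finset.sum_mul_sum, Finset.mul_sum]
    refine Finset.sum_le_sum fun k _ => ?_
    rw [Finset.mul_sum]
    refine Finset.sum_le_sum fun l _ => ?_
    have h2 := pow_le_pow_left₀ (hM.nonneg (w.get a) k l) (hη _ (w.get_mem a) k l) 2
    calc _ = s (w.get a) k l ^ 2 * (L a k ^ 2 * h a l ^ 2) := by ring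
      _ ≤ _ := mul_le_mul_of_nonneg_right h2 (by positivity)
  refine h1.trans ?_
  calc _ ≤ η ^ 2 * ((CL a * ∑ j, ‖y j‖ ^ 2) * (CD a * ∑ j, ‖x j‖ ^ 2)) := by
        refine mul_le_mul_of_nonneg_left ?_ (sq_nonneg _)
        exact mul_le_mul (hL a) (hh a) (Finset.sum_nonneg fun _ _ => sq_nonneg _)
          (mul_nonneg (hCL a) (Finset.sum_nonneg fun _ _ => sq_nonneg _))
    _ = _ := by
        rw [mul_pow, mul_pow, l2, l2, Real.sq_sqrt (by positivity), Real.sq_sqrt (by positivity)]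
        ring

/-- Off the diagonal, the mean of `M j k (W x) k` up to errors. -/
lemma norm_integral_mul_mulVec_sub_le (hK : ∀ l, 0 ≤ K l) (hM : IsVarianceModel K σ P φ s)
    (w : List I) (x : Fin N → ℂ) (i : I) {j k : Fin N} (hjk : j ≠ k) (τ : List I → ℝ)
    (G : Fin w.length → Fin N → Fin N → ℝ) (h : Fin w.length → Fin N → ℝ)
    (ρ : Fin w.length → ℝ)
    (hG : ∀ (a : Fin w.length) r l, nrm P 2 (fun z => wordMat φ (w.take a) z r l) ≤ G a r l)
    (hρ : ∀ (a : Fin w.length) r,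
      nrm P 2 (fun z => wordMat φ (w.take a) z r r - (τ (w.take a) : ℂ)) ≤ ρ a)
    (hh : ∀ (a : Fin w.length) l c, nrm P 3
      (fun z => (wordMat φ (w.drop (a + 1)) (zap c z) *ᵥ x) l) ≤ h a l) :
    ‖∫ z, mat φ z i j k * (wordMat φ w z *ᵥ x) k ∂P -
      ∑ a : Fin w.length, ((Set.indicator {i} (fun i => σ i ^ 2) (w.get a) * τ (w.take a) : ℝ) : ℂ)
        * ((s i j k ^ 2 : ℝ) : ℂ) * ∫ z, (wordMat φ (w.drop (a + 1)) z *ᵥ x) j ∂P‖ ≤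
      ∑ a : Fin w.length, s i j k ^ 2 * (K 1 * K 3 * (G a k j * h a k) + K 1 * K 3 * (ρ a * h a j) +
        |Set.indicator {i} (fun i => σ i ^ 2) (w.get a) * τ (w.take a)| *
          nrm P 3 (fun z => (wordMat φ (w.drop (a + 1)) z *ᵥ x) j -
            (wordMat φ (w.drop (a + 1)) (zap (i, s(j, k)) z) *ᵥ x) j)) := by
  classical
  have hB := hM.toIsBandModel
  have hprob := hM.prob
  have hG0 : ∀ a r l, 0 ≤ G a r l := fun a r l => (nrm_nonneg _ _).trans (hG a r l)
  have hρ0 : ∀ a, 0 ≤ ρ a := fun a => (nrm_nonneg _ _).trans (hρ a j)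
  have hh0 : ∀ a l, 0 ≤ h a l := fun a l => (nrm_nonneg _ _).trans (hh a l (i, s(j, k)))
  set V : Fin w.length → Fin N → (I × Sym2 (Fin N) → ℂ) → ℂ := fun a l z =>
    (wordMat φ (w.drop (a + 1)) (zap (i, s(j, k)) z) *ᵥ x) l with hV
  have hVm : ∀ a l, AllMoments P (V a l) := fun a l => hB.moments_mulVec_zap _ _ x l
  have hm : ∀ p q, AllMoments P (fun z => mat φ z i p q) := fun p q => hB.moments i p q
  have hWm : ∀ (a : Fin w.length) r l, AllMoments P (fun z => wordMat φ (w.take a) z r l) :=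
    fun a r l => hB.moments_word _ r l
  have hnm : ∀ l p q, nrm P l (fun z => mat φ z i p q) ≤ K l * s i p q :=
    fun l p q => hB.nrm_le i p q l
  -- the triple product bounds
  have htriple : ∀ (a : Fin w.length) (A : (I × Sym2 (Fin N) → ℂ) → ℂ) (p q : Fin N) (B : ℝ),
      AllMoments P A → nrm P 2 A ≤ B →
      ‖∫ z, mat φ z i j k * (A z * (mat φ z i p q * V a q z)) ∂P‖ ≤
        K 1 * s i j k * (B * (K 3 * s i p q * h a q)) := by
    intro a A p q B hA hAB
    have h1 := (hm p q).mul (hVm a q)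
    refine (norm_integral_le_nrm ((hm j k).mul (hA.mul h1)) 0).trans
      ((nrm_mul_le 0 (hm j k) (hA.mul h1)).trans ?_)
    refine mul_le_mul (hnm 1 j k) ?_ (nrm_nonneg _ _) (mul_nonneg (hK _) (hM.nonneg _ _ _))
    refine (nrm_mul_le 1 hA h1).trans ?_
    refine mul_le_mul hAB ?_ (nrm_nonneg _ _) ((nrm_nonneg _ _).trans hAB)
    refine (nrm_mul_le 2 (hm p q) (hVm a q)).trans ?_
    exact mul_le_mul (hnm _ _ _) (hh _ _ _) (nrm_nonneg _ _)
      (mul_nonneg (hK _) (hM.nonneg _ _ _))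
  rw [integral_mul_mulVec hB w x i hjk]
  simp only [mulVec_sub_mulVec_zap hB w x i hjk, Finset.mul_sum]
  have hterm : ∀ a : Fin w.length, AllMoments P (fun z => mat φ z i j k *
      if w.get a = i then wordMat φ (w.take a) z k j * (mat φ z i j k * V a k z) +
        wordMat φ (w.take a) z k k * (mat φ z i k j * V a j z) else 0) := by
    intro a
    split_ifs
    · exact (hm j k).mul (((hWm a k j).mul ((hm j k).mul (hVm a k))).add
        ((hWm a k k).mul ((hm k j).mul (hVm a j))))
    · exact (hm j k).mul (AllMoments.const 0)
  have hint : ∀ a ∈ (Finset.univ : Finset (Fin w.length)), Integrable (fun z => mat φ z i j k *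
      if w.get a = i then wordMat φ (w.take a) z k j * (mat φ z i j k * V a k z) +
        wordMat φ (w.take a) z k k * (mat φ z i k j * V a j z) else 0) P :=
    fun a _ => (hterm a).integrable
  rw [integral_finsetSum _ hint, ← Finset.sum_sub_distrib]
  refine (norm_sum_le _ _).trans (Finset.sum_le_sum fun a _ => ?_)
  set T : ℂ := (τ (w.take a) : ℂ) with hT
  set D := nrm P 3 (fun z => (wordMat φ (w.drop (a + 1)) z *ᵥ x) j - V a j z) with hD
  have hD0 : 0 ≤ D := nrm_nonneg _ _
  by_cases ha : w.get a = i
  swap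
  · simp only [ha, if_false, mul_zero, integral_zero]
    rw [Set.indicator_of_notMem (by simpa using ha)]
    simp only [zero_mul, Complex.ofReal_zero, sub_zero, norm_zero, abs_zero, add_zero]
    have := hK 1
    have := hK 3
    have := hG0 a k j
    have := hρ0 a
    have := hh0 a k
    have := hh0 a j
    positivity
  simp only [ha, if_true, Set.mem_singleton_iff, Set.indicator_of_mem]
  -- Three parts: the entry repeated in the same orientation, small because of the factor `W'_kj`;
  -- the error of replacing `W'_kk` by `T = τ(w')`; and the main term, in which `M_jk M_kj` is
  -- independent of `V`, as the entry has been removed from `V`.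
  have hsplit : ∀ z, mat φ z i j k * (wordMat φ (w.take a) z k j * (mat φ z i j k * V a k z) +
        wordMat φ (w.take a) z k k * (mat φ z i k j * V a j z)) =
      mat φ z i j k * (wordMat φ (w.take a) z k j * (mat φ z i j k * V a k z)) +
      mat φ z i j k * ((wordMat φ (w.take a) z k k - T) * (mat φ z i k j * V a j z)) +
      T * ((mat φ z i j k * mat φ z i k j) * V a j z) := fun z => by ring
  have hW' := (hWm a k k).sub (AllMoments.const (μ := P) T)
  have m1 := (hm j k).mul ((hWm a k j).mul ((hm j k).mul (hVm a k)))
  have m2 := (hm j k).mul (hW'.mul ((hm k j).mul (hVm a j)))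
  have m3 := (AllMoments.const (μ := P) T).mul (((hm j k).mul (hm k j)).mul (hVm a j))
  have hsum : ∫ z, mat φ z i j k * (wordMat φ (w.take a) z k j * (mat φ z i j k * V a k z) +
        wordMat φ (w.take a) z k k * (mat φ z i k j * V a j z)) ∂P =
      ∫ z, mat φ z i j k * (wordMat φ (w.take a) z k j * (mat φ z i j k * V a k z)) ∂P +
      ∫ z, mat φ z i j k * ((wordMat φ (w.take a) z k k - T) * (mat φ z i k j * V a j z)) ∂P +
      T * ∫ z, (mat φ z i j k * mat φ z i k j) * V a j z ∂P := by
    simp only [hsplit]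
    rw [integral_add (m1.add m2).integrable m3.integrable, integral_add m1.integrable m2.integrable,
      integral_const_mul]
  have hmom2 : AllMoments P (fun z => φ i j k (z (i, s(j, k))) * φ i k j (z (i, s(j, k)))) := by
    have := (hm j k).mul (hm k j)
    simpa only [mat, of_apply, Sym2.eq_swap (a := k) (b := j)] using this
  have hfac : ∫ z, (mat φ z i j k * mat φ z i k j) * V a j z ∂P =
      ((σ i ^ 2 * s i j k ^ 2 : ℝ) : ℂ) * ∫ z, V a j z ∂P := by
    rw [← hM.variance i j k hjk]
    have := hM.resamples.integral_mul_zap (i, s(j, k)) (φ := fun t => φ i j k t * φ i k j t)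
      (g := fun z => (wordMat φ (w.drop (a + 1)) z *ᵥ x) j) hmom2 (hVm a j)
    rw [← this]
    simp only [mat, of_apply, Sym2.eq_swap (a := k) (b := j)]
    rfl
  have hVd : ‖∫ z, (wordMat φ (w.drop (a + 1)) z *ᵥ x) j ∂P - ∫ z, V a j z ∂P‖ ≤ D := by
    have hmV := hB.moments_mulVec (w.drop (a + 1)) x j
    rw [← integral_sub hmV.integrable (hVm a j).integrable]
    exact norm_integral_le_nrm (hmV.sub (hVm a j)) 3
  rw [hsum, hfac]
  have b1 := htriple a _ j k _ (hWm a k j) (hG a k j)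
  have b2 := htriple a _ k j _ hW' (hρ a k)
  rw [hM.symm i k j] at b2
  have hrew : ∫ z, mat φ z i j k * (wordMat φ (w.take a) z k j * (mat φ z i j k * V a k z)) ∂P +
      ∫ z, mat φ z i j k * ((wordMat φ (w.take a) z k k - T) * (mat φ z i k j * V a j z)) ∂P +
      T * (((σ i ^ 2 * s i j k ^ 2 : ℝ) : ℂ) * ∫ z, V a j z ∂P) -
      ((σ i ^ 2 * τ (w.take a) : ℝ) : ℂ) * ((s i j k ^ 2 : ℝ) : ℂ) *
        ∫ z, (wordMat φ (w.drop (a + 1)) z *ᵥ x) j ∂P =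
      ∫ z, mat φ z i j k * (wordMat φ (w.take a) z k j * (mat φ z i j k * V a k z)) ∂P +
      ∫ z, mat φ z i j k * ((wordMat φ (w.take a) z k k - T) * (mat φ z i k j * V a j z)) ∂P -
      ((s i j k ^ 2 * (σ i ^ 2 * τ (w.take a)) : ℝ) : ℂ) *
        (∫ z, (wordMat φ (w.drop (a + 1)) z *ᵥ x) j ∂P - ∫ z, V a j z ∂P) := by
    rw [hT]; push_cast; ring
  rw [hrew]
  refine (norm_sub_le _ _).trans ((add_le_add (norm_add_le _ _) le_rfl).trans ?_)
  rw [norm_mul, Complex.norm_real, Real.norm_eq_abs, abs_mul, abs_of_nonneg (sq_nonneg (s i j k))]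
  have b3 := mul_le_mul_of_nonneg_left hVd
    (mul_nonneg (sq_nonneg (s i j k)) (abs_nonneg (σ i ^ 2 * τ (w.take a))))
  refine (add_le_add (add_le_add b1 b2) b3).trans (le_of_eq ?_)
  ring

end

end RandomBand

end

noncomputable section

namespace RandomBand

open Matrix

/-! ### The mean of a coordinate, summed along a row. -/

section

variable {I : Type*} {N : ℕ} {K : ℕ → ℝ} {P : Measure (I × Sym2 (Fin N) → ℂ)}
  {φ : I → Fin N → Fin N → ℂ → ℂ} {s : I → Fin N → Fin N → ℝ} {σ : I → ℝ}

/-- The entries of one row have distinct labels, so this is a partial sum of the total variation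
controlled by the envelope. -/
lemma sum_variation_row_le {w : List I} {x : Fin N → ℂ} {g : Fin N → ℝ} {m : ℕ}
    (hg : IsEnvelope P φ w m x g) (i : I) (j : Fin N) :
    ∑ k, nrm P m (fun z => (wordMat φ w z *ᵥ x) j -
      (wordMat φ w (zap (i, s(j, k)) z) *ᵥ x) j) ^ 2 ≤ g j ^ 2 := by
  classical
  have hinj : Function.Injective fun k : Fin N => ((i, s(j, k)) : I × Sym2 (Fin N)) := by
    intro k l hkl
    rcases (by simpa using hkl : k = l ∨ j = l ∧ k = j) with h | h
    · exact h
    · exact h.2.trans h.1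
  have := hg.variation (Finset.univ.map ⟨_, hinj⟩) j
  rwa [Finset.sum_map] at this

/-- Each error carries a factor `η`: the diagonal entry through `s_jj ≤ η`, the replacement of
`W'_kk` by assumption, and the other two through `s² ≤ η s`, which leaves one factor `s`; for the
variations this factor is used in Cauchy–Schwarz along the row. The coefficient 2 of `|σ² τ|`
collects the effect of restoring the removed entry and the term `k = j` of the main sum. -/
lemma norm_integral_mulVec_cons_sub_le (hK : ∀ l, 0 ≤ K l) (hM : IsVarianceModel K σ P φ s)
    (w : List I) (x : Fin N → ℂ) (i : I) (j : Fin N) (τ : List I → ℝ) {η : ℝ} (hη0 : 0 ≤ η)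
    (hη : ∀ j k, s i j k ≤ η)
    (G : Fin w.length → Fin N → Fin N → ℝ) (h : Fin w.length → Fin N → ℝ)
    (R : Fin w.length → ℝ) (u : Fin N → ℝ)
    (hG : ∀ (a : Fin w.length) r l, nrm P 2 (fun z => wordMat φ (w.take a) z r l) ≤ G a r l)
    (hR : ∀ (a : Fin w.length) r,
      nrm P 2 (fun z => wordMat φ (w.take a) z r r - (τ (w.take a) : ℂ)) ≤ R a * η)
    (hh : ∀ a : Fin w.length, IsEnvelope P φ (w.drop (a + 1)) 3 x (h a))
    (hu : nrm P 1 (fun z => (wordMat φ w z *ᵥ x) j) ≤ u j) :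
    ‖∫ z, (wordMat φ (i :: w) z *ᵥ x) j ∂P -
      ∑ a : Fin w.length, ((Set.indicator {i} (fun i => σ i ^ 2) (w.get a) * τ (w.take a) : ℝ) : ℂ)
        * ∫ z, (wordMat φ (w.drop (a + 1)) z *ᵥ x) j ∂P‖ ≤
      η * (K 1 * u j + ∑ a : Fin w.length, (K 1 * K 3 * (∑ k, s i j k * (G a k j * h a k)) +
        K 1 * K 3 * (R a * h a j) +
        2 * |Set.indicator {i} (fun i => σ i ^ 2) (w.get a) * τ (w.take a)| * h a j)) := by
  classical
  have hB := hM.toIsBandModel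
  have hprob := hM.prob
  have hG0 : ∀ a r l, 0 ≤ G a r l := fun a r l => (nrm_nonneg _ _).trans (hG a r l)
  have hh0 : ∀ a l, 0 ≤ h a l := fun a l => (hh a).nonneg l
  have hu0 : 0 ≤ u j := (nrm_nonneg _ _).trans hu
  set β : Fin w.length → ℝ :=
    fun a => Set.indicator {i} (fun i => σ i ^ 2) (w.get a) * τ (w.take a) with hβ
  set EV : Fin w.length → ℂ := fun a => ∫ z, (wordMat φ (w.drop (a + 1)) z *ᵥ x) j ∂P with hEV
  have hEVle : ∀ a, ‖EV a‖ ≤ h a j := fun a =>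
    (norm_integral_le_nrm (hB.moments_mulVec _ x j) 3).trans ((hh a).base j)
  set δ : Fin w.length → Fin N → ℝ := fun a k => nrm P 3 (fun z =>
    (wordMat φ (w.drop (a + 1)) z *ᵥ x) j -
      (wordMat φ (w.drop (a + 1)) (zap (i, s(j, k)) z) *ᵥ x) j) with hδ
  have hδ0 : ∀ a k, 0 ≤ δ a k := fun a k => nrm_nonneg _ _
  have hsη : ∀ k, s i j k ^ 2 ≤ η * s i j k := fun k => by
    rw [sq]; exact mul_le_mul_of_nonneg_right (hη j k) (hB.nonneg i j k)
  -- The main terms are available only for `k ≠ j`. Since the weights `s²` sum to exactly one,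
  -- adding the term `k = j` completes them at a cost of `s_jj² ≤ η`.
  have hdecomp : ∑ a, (β a : ℂ) * EV a = ∑ k with k ≠ j, (∑ a, (β a : ℂ) *
      ((s i j k ^ 2 : ℝ) : ℂ) * EV a) + ((s i j j ^ 2 : ℝ) : ℂ) * ∑ a, (β a : ℂ) * EV a := by
    have h1 : ∀ k, ∑ a, (β a : ℂ) * ((s i j k ^ 2 : ℝ) : ℂ) * EV a =
        ((s i j k ^ 2 : ℝ) : ℂ) * ∑ a, (β a : ℂ) * EV a := fun k => by
      rw [Finset.mul_sum]; exact Finset.sum_congr rfl fun a _ => by ring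
    simp only [h1]
    rw [← Finset.sum_mul, ← add_mul]
    have h2 : (∑ k with k ≠ j, ((s i j k ^ 2 : ℝ) : ℂ)) + ((s i j j ^ 2 : ℝ) : ℂ) = 1 := by
      have h3 : ((∑ k, s i j k ^ 2 : ℝ) : ℂ) = 1 := by rw [hM.sum_eq]; simp
      rw [← h3]
      push_cast
      rw [← Finset.add_sum_erase _ _ (Finset.mem_univ j), add_comm]
      congr 2
      ext k
      simp
    rw [h2, one_mul]
  rw [integral_mulVec_cons hB, hdecomp]
  have hre : ∀ A B C D : ℂ, A + B - (C + D) = A + (B - C) - D := fun A B C D => by ring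
  rw [hre, ← Finset.sum_sub_distrib]
  have b1 : ‖∫ z, mat φ z i j j * (wordMat φ w z *ᵥ x) j ∂P‖ ≤ η * (K 1 * u j) := by
    refine (norm_integral_diag_le hB w x i j u hK hu).trans ?_
    have := mul_le_mul_of_nonneg_right (hη j j) (mul_nonneg (hK 1) hu0)
    linarith
  have b3 : ‖((s i j j ^ 2 : ℝ) : ℂ) * ∑ a, (β a : ℂ) * EV a‖ ≤ ∑ a, η * (|β a| * h a j) := by
    rw [norm_mul, Complex.norm_real, Real.norm_of_nonneg (sq_nonneg _), ← Finset.mul_sum]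
    have hs : s i j j ^ 2 ≤ η := (hsη j).trans (mul_le_of_le_one_right hη0 (hB.le_one i j j))
    refine mul_le_mul hs ((norm_sum_le _ _).trans (Finset.sum_le_sum fun a _ => ?_))
      (norm_nonneg _) hη0
    rw [norm_mul, Complex.norm_real, Real.norm_eq_abs]
    exact mul_le_mul_of_nonneg_left (hEVle a) (abs_nonneg _)
  have b2 : ‖∑ k with k ≠ j, (∫ z, mat φ z i j k * (wordMat φ w z *ᵥ x) k ∂P -
      ∑ a, (β a : ℂ) * ((s i j k ^ 2 : ℝ) : ℂ) * EV a)‖ ≤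
      ∑ a, η * (K 1 * K 3 * (∑ k, s i j k * (G a k j * h a k)) +
        K 1 * K 3 * (R a * h a j) + |β a| * h a j) := by
    refine (norm_sum_le _ _).trans ((Finset.sum_le_sum fun k hk =>
      norm_integral_mul_mulVec_sub_le hK hM w x i (Finset.mem_filter.1 hk).2.symm τ G h
        (fun a => R a * η) hG hR (fun a l c => (hh a).zap c l)).trans ?_)
    have hρ0 : ∀ a, 0 ≤ R a * η := fun a => (nrm_nonneg _ _).trans (hR a j)
    refine (Finset.sum_le_sum_of_subset_of_nonneg (Finset.filter_subset _ _)
      fun k _ _ => Finset.sum_nonneg fun a _ => ?_).trans ?_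
    · have := hK 1
      have := hK 3
      have := hG0 a k j
      have := hρ0 a
      have := hh0 a k
      have := hh0 a j
      have := hδ0 a k
      positivity
    rw [Finset.sum_comm]
    refine Finset.sum_le_sum fun a _ => ?_
    have c1 : ∑ k, s i j k ^ 2 * (K 1 * K 3 * (G a k j * h a k)) ≤
        η * (K 1 * K 3 * (∑ k, s i j k * (G a k j * h a k))) := by
      rw [Finset.mul_sum, Finset.mul_sum]
      refine Finset.sum_le_sum fun k _ => ?_
      have := mul_le_mul_of_nonneg_right (hsη k) (mul_nonneg (mul_nonneg (hK 1) (hK 3))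
        (mul_nonneg (hG0 a k j) (hh0 a k)))
      linarith
    have c2 : ∑ k, s i j k ^ 2 * (K 1 * K 3 * (R a * η * h a j)) =
        η * (K 1 * K 3 * (R a * h a j)) := by
      rw [← Finset.sum_mul, hM.sum_eq]; ring
    have c3 : ∑ k, s i j k ^ 2 * (|β a| * δ a k) ≤ η * (|β a| * h a j) := by
      have d1 : ∑ k, s i j k * δ a k ≤ h a j := by
        refine (Real.sum_mul_le_sqrt_mul_sqrt _ _ _).trans ?_
        rw [hM.sum_eq, Real.sqrt_one, one_mul]
        exact (Real.sqrt_le_left (hh0 a j)).2 (sum_variation_row_le (hh a) i j)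
      have d2 : ∑ k, s i j k ^ 2 * (|β a| * δ a k) ≤ η * (|β a| * ∑ k, s i j k * δ a k) := by
        rw [Finset.mul_sum, Finset.mul_sum]
        refine Finset.sum_le_sum fun k _ => ?_
        have := mul_le_mul_of_nonneg_right (hsη k) (mul_nonneg (abs_nonneg (β a)) (hδ0 a k))
        linarith
      exact d2.trans (mul_le_mul_of_nonneg_left
        (mul_le_mul_of_nonneg_left d1 (abs_nonneg _)) hη0)
    simp only [mul_add, Finset.sum_add_distrib]
    rw [c2]
    exact add_le_add (add_le_add c1 le_rfl) c3
  refine (norm_sub_le _ _).trans ((add_le_add ((norm_add_le _ _).trans (add_le_add b1 b2)) b3).trans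
    (le_of_eq ?_))
  rw [add_assoc, ← Finset.sum_add_distrib, mul_add, Finset.mul_sum]
  congr 1
  exact Finset.sum_congr rfl fun a _ => by ring

/-- The variant with a single power of `s`, the other one having been spent on `η`. -/
lemma sum_sq_sum_mul_le_of_col (hM : IsBandModel K P φ s) (i : I) (G : Fin N → Fin N → ℝ)
    (h : Fin N → ℝ) {C : ℝ} (hC : 0 ≤ C) (hG : ∀ j, ∑ k, G k j ^ 2 ≤ C) :
    ∑ j, (∑ k, s i j k * (G k j * h k)) ^ 2 ≤ C * ∑ k, h k ^ 2 := by
  have h1 : ∀ j, (∑ k, s i j k * (G k j * h k)) ^ 2 ≤ C * ∑ k, s i j k ^ 2 * h k ^ 2 := by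
    intro j
    have h2 : ∑ k, s i j k * (G k j * h k) = ∑ k, G k j * (s i j k * h k) :=
      Finset.sum_congr rfl fun k _ => by ring
    rw [h2]
    refine (Finset.sum_mul_sq_le_sq_mul_sq _ _ _).trans ?_
    simp only [mul_pow]
    exact mul_le_mul_of_nonneg_right (hG j)
      (Finset.sum_nonneg fun _ _ => mul_nonneg (sq_nonneg _) (sq_nonneg _))
  refine (Finset.sum_le_sum fun j _ => h1 j).trans ?_
  rw [← Finset.mul_sum]
  exact mul_le_mul_of_nonneg_left (hM.sum_sum_le i fun k => sq_nonneg (h k)) hC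

end

/-- The isotropic law for the word `w`, with an error bounded by `C η ‖y‖ ‖x‖` in terms of the
largest entry `η` of the standard deviation profile. -/
def IsotropicBound {I : Type*} (K : ℕ → ℝ) (σ : I → ℝ) (w : List I) (t : ℝ) (m : ℕ) (C : ℝ) :
    Prop :=
  ∀ {N : ℕ} {P : Measure (I × Sym2 (Fin N) → ℂ)} {φ : I → Fin N → Fin N → ℂ → ℂ}
    {s : I → Fin N → Fin N → ℝ}, IsVarianceModel K σ P φ s → ∀ η : ℝ, 0 ≤ η →
    (∀ i ∈ w, ∀ j k, s i j k ≤ η) → ∀ x y : Fin N → ℂ,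
    nrm P m (fun z => y ⬝ᵥ wordMat φ w z *ᵥ x - (t : ℂ) * (y ⬝ᵥ x)) ≤ C * (η * (l2 y * l2 x))

/-- The fluctuation needs only envelopes, which are already available. The mean reduces to the law
for the two words on either side of the partner of the first letter: the prefix is needed in index 2
for diagonal entries, the remainder only in mean, for which index 0 suffices. -/
theorem exists_isotropicBound {I : Type*} (K : ℕ → ℝ) (hK : ∀ l, 0 ≤ K l) (σ : I → ℝ)
    (τ : List I → ℝ) (hτ : IsSemicircular σ τ) (w : List I) (m : ℕ) :
    ∃ C : ℝ, 0 ≤ C ∧ IsotropicBound K σ w (τ w) m C := by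
  induction hn : w.length using Nat.strong_induction_on generalizing w m with
  | _ n ih =>
  subst hn
  rcases w with _ | ⟨i, w⟩
  · refine ⟨0, le_rfl, fun {N P φ s} hM η _ _ x y => ?_⟩
    have := hM.prob
    simp [wordMat, hτ.nil, nrm_const]
  have htake : ∀ a : Fin w.length, ∃ C : ℝ, 0 ≤ C ∧
      IsotropicBound K σ (w.take a) (τ (w.take a)) 2 C :=
    fun a => ih _ (by simp only [List.length_take, List.length_cons]; omega) (w.take a) 2 rfl
  have hdrop : ∀ a : Fin w.length, ∃ C : ℝ, 0 ≤ C ∧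
      IsotropicBound K σ (w.drop (a + 1)) (τ (w.drop (a + 1))) 0 C :=
    fun a => ih _ (by simp only [List.length_drop, List.length_cons]; omega) (w.drop (a + 1)) 0 rfl
  choose R hR0 hR using htake
  choose Q hQ0 hQ using hdrop
  choose CT hCT hT using fun a : Fin w.length => exists_hasEnvelopes K hK (w.take a) 2
  choose CD hCD hD using fun a : Fin w.length => exists_hasEnvelopes K hK (w.drop (a + 1)) 3
  -- Reversed prefixes, because the row vectors `y W'` are treated in the transposed model.
  choose CL hCL hL using fun a : Fin (i :: w).length =>
    exists_hasEnvelopes K hK ((i :: w).take a).reverse (m + 1)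
  choose CD' hCD' hD' using fun a : Fin (i :: w).length =>
    exists_hasEnvelopes K hK ((i :: w).drop (a + 1)) (m + 2)
  obtain ⟨Cu, hCu, hu⟩ := exists_hasEnvelopes K hK w 1
  obtain ⟨Cf, hCf, hfluct⟩ := nrm_form_sub_integral_sq_le m
  set B : ℝ := 2 * (i :: w).length * K (m + 2) ^ 2 with hB
  set β : Fin w.length → ℝ :=
    fun a => Set.indicator {i} (fun i => σ i ^ 2) (w.get a) * τ (w.take a) with hβ
  set C1 : ℝ := Cf * (B * ∑ a, CL a * CD' a) with hC1
  set C2 : ℝ := K 1 * √Cu + ∑ a, (K 1 * K 3 * √(CT a * CD a) + K 1 * K 3 * (R a * √(CD a)) +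
    2 * |β a| * √(CD a)) with hC2
  have hK1 := hK 1
  have hK3 := hK 3
  have hC20 : 0 ≤ C2 := by
    refine add_nonneg (by positivity) (Finset.sum_nonneg fun a _ => ?_)
    have := hR0 a
    positivity
  refine ⟨√C1 + (C2 + ∑ a, |β a| * Q a), add_nonneg (Real.sqrt_nonneg _) (add_nonneg hC20
    (Finset.sum_nonneg fun a _ => mul_nonneg (abs_nonneg _) (hQ0 a))), ?_⟩
  intro N P φ s hM η hη0 hη x y
  have hBM := hM.toIsBandModel
  have hprob := hM.prob
  have hηw : ∀ i' ∈ w, ∀ j k, s i' j k ≤ η := fun i' hi' => hη i' (List.mem_cons_of_mem _ hi')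
  obtain ⟨u, hu, huX⟩ := hu hBM x
  choose G hG hGC using fun (a : Fin w.length) (j : Fin N) => hT a hBM (Pi.single j 1)
  choose h hh hhC using fun a : Fin w.length => hD a hBM x
  choose L hL hLC using fun a : Fin (i :: w).length => hL a hBM.transpose y
  choose h' hh' hhC' using fun a : Fin (i :: w).length => hD' a hBM x
  simp only [sum_norm_single_sq, mul_one] at hGC
  set E := ∫ z, y ⬝ᵥ wordMat φ (i :: w) z *ᵥ x ∂P with hE
  -- fluctuations
  have hfl : nrm P m (fun z => y ⬝ᵥ wordMat φ (i :: w) z *ᵥ x - E) ≤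
      √C1 * (η * (l2 y * l2 x)) := by
    have h1 := hfluct hK hBM (i :: w) y x L h' (fun a k => by
      simpa only [vecMul_wordMat] using (hL a).base k) (fun a l c => (hh' a).zap c l)
    have h2 := fluctSum_le hBM (i :: w) x y L h' hη CL CD' hCL hLC hhC'
    have hB0 : 0 ≤ B := by positivity
    have h3 := h1.trans (mul_le_mul_of_nonneg_left (mul_le_mul_of_nonneg_left h2 hB0)
      (zero_le_one.trans hCf))
    have h4 : Cf * (B * ((∑ a, CL a * CD' a) * (η * (l2 y * l2 x)) ^ 2)) =
        C1 * (η * (l2 y * l2 x)) ^ 2 := by rw [hC1]; ring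
    rw [h4] at h3
    have h5 := Real.le_sqrt_of_sq_le h3
    have hl : 0 ≤ η * (l2 y * l2 x) := mul_nonneg hη0 (mul_nonneg (l2_nonneg _) (l2_nonneg _))
    rwa [Real.sqrt_mul' _ (sq_nonneg _), Real.sqrt_sq hl] at h5
  -- the mean
  have hEsum : ∀ v : List I, ∫ z, y ⬝ᵥ wordMat φ v z *ᵥ x ∂P =
      ∑ j, y j * ∫ z, (wordMat φ v z *ᵥ x) j ∂P := by
    intro v
    simp only [dotProduct]
    have hint : ∀ j ∈ Finset.univ, Integrable (fun z => y j * (wordMat φ v z *ᵥ x) j) P :=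
      fun j _ => (hBM.moments_mulVec v x j).integrable.const_mul _
    rw [integral_finsetSum _ hint]
    simp only [integral_const_mul]
  set EV : Fin w.length → ℂ := fun a => ∫ z, y ⬝ᵥ wordMat φ (w.drop (a + 1)) z *ᵥ x ∂P with hEV
  have hm1 : ‖E - ∑ a, (β a : ℂ) * EV a‖ ≤ C2 * (η * (l2 y * l2 x)) := by
    have hre : E - ∑ a, (β a : ℂ) * EV a = ∑ j, y j * (∫ z, (wordMat φ (i :: w) z *ᵥ x) j ∂P -
        ∑ a, (β a : ℂ) * ∫ z, (wordMat φ (w.drop (a + 1)) z *ᵥ x) j ∂P) := by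
      simp only [mul_sub, Finset.sum_sub_distrib, hE, hEV, hEsum, Finset.mul_sum]
      congr 1
      rw [Finset.sum_comm]
      exact Finset.sum_congr rfl fun j _ => Finset.sum_congr rfl fun a _ => by ring
    rw [hre]
    have hj := fun j => norm_integral_mulVec_cons_sub_le hK hM w x i j τ hη0
      (hη i List.mem_cons_self) (fun a r l => G a l r) h R u
      (fun a r l => by simpa only [mulVec_single_one, col_apply] using (hG a l).base r)
      (fun a r => by
        -- The isotropic law for `x = y` a basis vector is the entrywise law for the diagonal of the
        -- prefix.
        have := hR a hM η hη0 (fun i' hi' => hηw i' (List.mem_of_mem_take hi'))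
          (Pi.single r 1) (Pi.single r 1)
        simpa only [single_one_dotProduct, mulVec_single_one, col_apply, Pi.single_eq_same, mul_one,
          l2_single] using this) hh (hu.base j)
    refine (norm_sum_le _ _).trans ((Finset.sum_le_sum fun j _ => (norm_mul_le _ _).trans
      (mul_le_mul_of_nonneg_left (hj j) (norm_nonneg _))).trans ?_)
    have hY := l2_nonneg y
    have hX := l2_nonneg x
    have t1 := sum_norm_mul_le x y u hCu huX
    have t2 : ∀ a, ∑ j, ‖y j‖ * (∑ k, s i j k * (G a j k * h a k)) ≤
        √(CT a * CD a) * (l2 y * l2 x) := by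
      intro a
      refine sum_norm_mul_le x y _ (mul_nonneg (hCT a) (hCD a)) ?_
      refine (sum_sq_sum_mul_le_of_col hBM i (fun k j => G a j k) (h a) (hCT a) (hGC a)).trans ?_
      rw [mul_assoc]
      exact mul_le_mul_of_nonneg_left (hhC a) (hCT a)
    have t3 : ∀ a, ∑ j, ‖y j‖ * h a j ≤ √(CD a) * (l2 y * l2 x) := fun a =>
      sum_norm_mul_le x y (h a) (hCD a) (hhC a)
    have hexp : ∑ j, ‖y j‖ * (η * (K 1 * u j + ∑ a : Fin w.length,
        (K 1 * K 3 * (∑ k, s i j k * (G a j k * h a k)) +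
        K 1 * K 3 * (R a * h a j) + 2 * |β a| * h a j))) =
        η * (K 1 * (∑ j, ‖y j‖ * u j) + ∑ a : Fin w.length,
        (K 1 * K 3 * (∑ j, ‖y j‖ * (∑ k, s i j k * (G a j k * h a k))) +
        (K 1 * K 3 * R a + 2 * |β a|) * (∑ j, ‖y j‖ * h a j))) := by
      have e1 : ∀ j, ‖y j‖ * (η * (K 1 * u j + ∑ a : Fin w.length,
        (K 1 * K 3 * (∑ k, s i j k * (G a j k * h a k)) +
        K 1 * K 3 * (R a * h a j) + 2 * |β a| * h a j))) = η * (K 1 * (‖y j‖ * u j) +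
        ∑ a : Fin w.length, (K 1 * K 3 * (‖y j‖ * (∑ k, s i j k * (G a j k * h a k))) +
        (K 1 * K 3 * R a + 2 * |β a|) * (‖y j‖ * h a j))) := by
        intro j
        rw [← mul_assoc, mul_comm ‖y j‖ η, mul_assoc, mul_add ‖y j‖, Finset.mul_sum]
        congr 1
        congr 1
        · ring
        · exact Finset.sum_congr rfl fun a _ => by ring
      simp only [e1]
      rw [← Finset.mul_sum, Finset.sum_add_distrib, ← Finset.mul_sum, Finset.sum_comm]
      congr 2
      refine Finset.sum_congr rfl fun a _ => ?_
      rw [Finset.sum_add_distrib, ← Finset.mul_sum, ← Finset.mul_sum]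
    rw [hexp]
    have hfin : K 1 * (∑ j, ‖y j‖ * u j) + ∑ a : Fin w.length,
        (K 1 * K 3 * (∑ j, ‖y j‖ * (∑ k, s i j k * (G a j k * h a k))) +
        (K 1 * K 3 * R a + 2 * |β a|) * (∑ j, ‖y j‖ * h a j)) ≤ C2 * (l2 y * l2 x) := by
      rw [hC2, add_mul, Finset.sum_mul]
      refine add_le_add ?_ (Finset.sum_le_sum fun a _ => ?_)
      · rw [mul_assoc]; exact mul_le_mul_of_nonneg_left t1 hK1
      · have q1 := mul_le_mul_of_nonneg_left (t2 a) (mul_nonneg hK1 hK3)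
        have q2 := mul_le_mul_of_nonneg_left (t3 a)
          (add_nonneg (mul_nonneg (mul_nonneg hK1 hK3) (hR0 a))
            (mul_nonneg zero_le_two (abs_nonneg (β a))))
        refine (add_le_add q1 q2).trans (le_of_eq ?_)
        ring
    refine (mul_le_mul_of_nonneg_left hfin hη0).trans (le_of_eq ?_)
    ring
  -- The recursion for `τ` identifies the limit, after the mean of each remaining word has been
  -- replaced using the induction hypothesis.
  have hm2 : ‖∑ a, (β a : ℂ) * EV a - (τ (i :: w) : ℂ) * (y ⬝ᵥ x)‖ ≤
      (∑ a, |β a| * Q a) * (η * (l2 y * l2 x)) := by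
    have e : (τ (i :: w) : ℂ) * (y ⬝ᵥ x) =
        ∑ a, (β a : ℂ) * ((τ (w.drop (a + 1)) : ℂ) * (y ⬝ᵥ x)) := by
      rw [hτ.cons, Complex.ofReal_sum, Finset.sum_mul]
      refine Finset.sum_congr rfl fun a _ => ?_
      rw [Complex.ofReal_mul, mul_assoc]
    rw [e, ← Finset.sum_sub_distrib, Finset.sum_mul]
    refine (norm_sum_le _ _).trans (Finset.sum_le_sum fun a _ => ?_)
    rw [← mul_sub, norm_mul, Complex.norm_real, Real.norm_eq_abs, mul_assoc]
    refine mul_le_mul_of_nonneg_left ?_ (abs_nonneg _)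
    have hf := hBM.moments_form (w.drop (a + 1)) y x
    have hc := AllMoments.const (μ := P) ((τ (w.drop (a + 1)) : ℂ) * (y ⬝ᵥ x))
    have h1 := norm_integral_le_nrm (hf.sub hc) 0
    rw [integral_sub hf.integrable hc.integrable] at h1
    simp only [integral_const, probReal_univ, one_smul] at h1
    exact h1.trans (hQ a hM η hη0 (fun i' hi' => hηw i' (List.mem_of_mem_drop hi')) x y)
  have hc1 := AllMoments.const (μ := P) (E - (τ (i :: w) : ℂ) * (y ⬝ᵥ x))
  have hf := (hBM.moments_form (i :: w) y x).sub (AllMoments.const (μ := P) E)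
  have h1 := nrm_add_le m hf hc1
  simp only [sub_add_sub_cancel, nrm_const] at h1
  have h2 : ‖E - (τ (i :: w) : ℂ) * (y ⬝ᵥ x)‖ ≤ (C2 + ∑ a, |β a| * Q a) * (η * (l2 y * l2 x)) := by
    rw [← sub_add_sub_cancel E (∑ a, (β a : ℂ) * EV a), add_mul]
    exact (norm_add_le _ _).trans (add_le_add hm1 hm2)
  rw [add_mul (√C1)]
  exact h1.trans (add_le_add hfl h2)

end RandomBand

end

noncomputable section

namespace RandomBand

/-! ### The recursion for noncrossing pairings -/

section Pairings

variable {α β I : Type*} [LinearOrder α] [LinearOrder β]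

/-- `P` is the set of blocks of a noncrossing pairing of `A`. -/
structure IsNCPairing (A : Finset α) (P : Finset (Finset α)) : Prop where
  card : ∀ B ∈ P, B.card = 2
  subset : ∀ B ∈ P, B ⊆ A
  exists_mem : ∀ x ∈ A, ∃ B ∈ P, x ∈ B
  unique : ∀ B ∈ P, ∀ C ∈ P, ∀ x ∈ B, x ∈ C → B = C
  noncrossing : ∀ B ∈ P, ∀ C ∈ P, ∀ j₁ ∈ B, ∀ j₂ ∈ B, ∀ k₁ ∈ C, ∀ k₂ ∈ C,
    j₁ < k₁ → k₁ < j₂ → j₂ < k₂ → B = C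

open Classical in
/-- The weight of a block. -/
def blockWeight (σ : I → ℝ) (l : α → I) (B : Finset α) : ℝ :=
  (∏ j ∈ B, σ (l j)) * (if ∀ j ∈ B, ∀ k ∈ B, l j = l k then 1 else 0)

open Classical in
/-- The noncrossing pairings of `A`. -/
def ncPairings (A : Finset α) : Finset (Finset (Finset α)) :=
  A.powerset.powerset.filter (IsNCPairing A)

/-- The sum of the weights of the noncrossing pairings of `A`. -/
def ncMoment (σ : I → ℝ) (l : α → I) (A : Finset α) : ℝ :=
  ∑ P ∈ ncPairings A, ∏ B ∈ P, blockWeight σ l B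

lemma mem_ncPairings {A : Finset α} {P : Finset (Finset α)} :
    P ∈ ncPairings A ↔ IsNCPairing A P := by
  classical
  simp only [ncPairings, Finset.mem_filter, Finset.mem_powerset, and_iff_right_iff_imp]
  intro h B hB
  exact Finset.mem_powerset.2 (h.subset B hB)

lemma blockWeight_pair (σ : I → ℝ) (l : α → I) {a b : α} (h : a ≠ b) :
    blockWeight σ l {a, b} = Set.indicator {l a} (fun i => σ i ^ 2) (l b) := by
  classical
  rw [blockWeight, Finset.prod_pair h]
  by_cases hab : l b = l a
  · rw [if_pos, Set.indicator_of_mem (by simpa using hab), hab]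
    · ring
    · intro j hj k hk
      simp only [Finset.mem_insert, Finset.mem_singleton] at hj hk
      rcases hj with rfl | rfl <;> rcases hk with rfl | rfl <;> simp [hab]
  · rw [if_neg, Set.indicator_of_notMem (by simpa using hab), mul_zero]
    intro hall
    exact hab (hall b (by simp) a (by simp))

lemma ncMoment_empty (σ : I → ℝ) (l : α → I) : ncMoment σ l ∅ = 1 := by
  have : ncPairings (∅ : Finset α) = {∅} := by
    ext P
    rw [mem_ncPairings, Finset.mem_singleton]
    constructor
    · intro h
      rw [Finset.eq_empty_iff_forall_notMem]
      intro B hB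
      have h1 := h.card B hB
      rw [Finset.subset_empty.1 (h.subset B hB)] at h1
      simp at h1
    · rintro rfl
      constructor <;> simp
  simp [ncMoment, this]

section Split

variable {A : Finset α} {a₀ a : α}

/-- As `a₀` is the least element, a block with one point below `a` and one above it would cross
`{a₀, a}`. -/
lemma IsNCPairing.block_cases {P : Finset (Finset α)} (h : IsNCPairing A P) (h₀ : ∀ x ∈ A, a₀ ≤ x)
    (hB₀ : ({a₀, a} : Finset α) ∈ P) {B : Finset α} (hB : B ∈ P) :
    B = {a₀, a} ∨ B ⊆ A.filter (fun x => a₀ < x ∧ x < a) ∨ B ⊆ A.filter (fun x => a < x) := by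
  by_cases hBB : B = {a₀, a}
  · exact Or.inl hBB
  right
  have hne₀ : ∀ x ∈ B, x ≠ a₀ := fun x hx hxa => hBB (h.unique B hB _ hB₀ x hx (by simp [hxa]))
  have hne : ∀ x ∈ B, x ≠ a := fun x hx hxa => hBB (h.unique B hB _ hB₀ x hx (by simp [hxa]))
  have hlt₀ : ∀ x ∈ B, a₀ < x := fun x hx =>
    lt_of_le_of_ne (h₀ x (h.subset B hB hx)) (hne₀ x hx).symm
  by_cases hex : ∃ x ∈ B, a < x
  · right
    obtain ⟨x, hx, hax⟩ := hex
    intro y hy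
    refine Finset.mem_filter.2 ⟨h.subset B hB hy, ?_⟩
    by_contra hya
    have hya' : y < a := lt_of_le_of_ne (not_lt.1 hya) (hne y hy)
    exact hBB (h.noncrossing _ hB₀ B hB a₀ (by simp) a (by simp) y hy x hx (hlt₀ y hy) hya'
      hax).symm
  · left
    push Not at hex
    intro y hy
    exact Finset.mem_filter.2 ⟨h.subset B hB hy, hlt₀ y hy, lt_of_le_of_ne (hex y hy) (hne y hy)⟩

lemma IsNCPairing.filter_subset [DecidableEq (Finset α)] {P : Finset (Finset α)}
    (h : IsNCPairing A P) {A' : Finset α} (hA' : A' ⊆ A)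
    (hP : ∀ B ∈ P, ∀ x ∈ B, x ∈ A' → B ⊆ A') : IsNCPairing A' (P.filter (· ⊆ A')) where
  card B hB := h.card B (Finset.mem_filter.1 hB).1
  subset B hB := (Finset.mem_filter.1 hB).2
  exists_mem x hx := by
    obtain ⟨B, hB, hxB⟩ := h.exists_mem x (hA' hx)
    exact ⟨B, Finset.mem_filter.2 ⟨hB, hP B hB x hxB hx⟩, hxB⟩
  unique B hB C hC := h.unique B (Finset.mem_filter.1 hB).1 C (Finset.mem_filter.1 hC).1
  noncrossing B hB C hC :=
    h.noncrossing B (Finset.mem_filter.1 hB).1 C (Finset.mem_filter.1 hC).1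

lemma isNCPairing_insert (h₀ : ∀ x ∈ A, a₀ ≤ x) (ha₀ : a₀ ∈ A) (ha : a ∈ A) (hlt : a₀ < a)
    {P₁ P₂ : Finset (Finset α)} (h₁ : IsNCPairing (A.filter fun x => a₀ < x ∧ x < a) P₁)
    (h₂ : IsNCPairing (A.filter fun x => a < x) P₂) :
    IsNCPairing A (insert {a₀, a} (P₁ ∪ P₂)) := by
  have m₁ : ∀ B ∈ P₁, ∀ x ∈ B, x ∈ A ∧ a₀ < x ∧ x < a := fun B hB x hx =>
    Finset.mem_filter.1 (h₁.subset B hB hx)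
  have m₂ : ∀ B ∈ P₂, ∀ x ∈ B, x ∈ A ∧ a < x := fun B hB x hx =>
    Finset.mem_filter.1 (h₂.subset B hB hx)
  have m₀ : ∀ x ∈ ({a₀, a} : Finset α), x = a₀ ∨ x = a := fun x hx => by simpa using hx
  have hmem : ∀ B, B ∈ insert ({a₀, a} : Finset α) (P₁ ∪ P₂) → B = {a₀, a} ∨ B ∈ P₁ ∨ B ∈ P₂ :=
    fun B hB => by simpa using hB
  refine ⟨?_, ?_, ?_, ?_, ?_⟩
  · intro B hB
    rcases hmem B hB with rfl | hB | hB
    · exact Finset.card_pair hlt.ne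
    · exact h₁.card B hB
    · exact h₂.card B hB
  · intro B hB x hx
    rcases hmem B hB with rfl | hB | hB
    · rcases m₀ x hx with rfl | rfl <;> assumption
    · exact (m₁ B hB x hx).1
    · exact (m₂ B hB x hx).1
  · intro x hx
    rcases (h₀ x hx).eq_or_lt with rfl | hx₀
    · exact ⟨{a₀, a}, by simp, by simp⟩
    rcases lt_trichotomy x a with hxa | rfl | hxa
    · obtain ⟨B, hB, hxB⟩ := h₁.exists_mem x (Finset.mem_filter.2 ⟨hx, hx₀, hxa⟩)
      exact ⟨B, by simp [hB], hxB⟩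
    · exact ⟨{a₀, x}, by simp, by simp⟩
    · obtain ⟨B, hB, hxB⟩ := h₂.exists_mem x (Finset.mem_filter.2 ⟨hx, hxa⟩)
      exact ⟨B, by simp [hB], hxB⟩
  · intro B hB C hC x hxB hxC
    rcases hmem B hB with rfl | hB | hB <;> rcases hmem C hC with rfl | hC | hC
    · rfl
    · have := m₁ C hC x hxC
      rcases m₀ x hxB with rfl | rfl
      · exact absurd this.2.1 (lt_irrefl _)
      · exact absurd this.2.2 (lt_irrefl _)
    · have := m₂ C hC x hxC
      rcases m₀ x hxB with rfl | rfl
      · exact absurd this.2 hlt.not_gt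
      · exact absurd this.2 (lt_irrefl _)
    · have := m₁ B hB x hxB
      rcases m₀ x hxC with rfl | rfl
      · exact absurd this.2.1 (lt_irrefl _)
      · exact absurd this.2.2 (lt_irrefl _)
    · exact h₁.unique B hB C hC x hxB hxC
    · exact absurd (m₁ B hB x hxB).2.2 (m₂ C hC x hxC).2.not_gt
    · have := m₂ B hB x hxB
      rcases m₀ x hxC with rfl | rfl
      · exact absurd this.2 hlt.not_gt
      · exact absurd this.2 (lt_irrefl _)
    · exact absurd (m₁ C hC x hxC).2.2 (m₂ B hB x hxB).2.not_gt
    · exact h₂.unique B hB C hC x hxB hxC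
  · intro B hB C hC j₁ hj₁ j₂ hj₂ k₁ hk₁ k₂ hk₂ h12 h23 h34
    rcases hmem B hB with rfl | hB | hB <;> rcases hmem C hC with rfl | hC | hC
    · rfl
    · have e1 := m₁ C hC k₁ hk₁
      have e2 := m₁ C hC k₂ hk₂
      rcases m₀ j₂ hj₂ with rfl | rfl
      · exact absurd e1.2.1 h23.not_gt
      · exact absurd e2.2.2 h34.not_gt
    · have e1 := m₂ C hC k₁ hk₁
      rcases m₀ j₂ hj₂ with rfl | rfl
      · exact absurd (e1.2.trans h23) hlt.not_gt
      · exact absurd e1.2 h23.not_gt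
    · have e1 := m₁ B hB j₁ hj₁
      have e2 := m₁ B hB j₂ hj₂
      rcases m₀ k₁ hk₁ with rfl | rfl
      · exact absurd e1.2.1 h12.not_gt
      · exact absurd e2.2.2 h23.not_gt
    · exact h₁.noncrossing B hB C hC j₁ hj₁ j₂ hj₂ k₁ hk₁ k₂ hk₂ h12 h23 h34
    · exact absurd (h23.trans (m₁ B hB j₂ hj₂).2.2) (m₂ C hC k₁ hk₁).2.not_gt
    · have e1 := m₂ B hB j₁ hj₁
      rcases m₀ k₁ hk₁ with rfl | rfl
      · exact absurd (e1.2.trans h12) hlt.not_gt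
      · exact absurd e1.2 h12.not_gt
    · exact absurd (h12.trans (m₁ C hC k₁ hk₁).2.2) (m₂ B hB j₁ hj₁).2.not_gt
    · exact h₂.noncrossing B hB C hC j₁ hj₁ j₂ hj₂ k₁ hk₁ k₂ hk₂ h12 h23 h34

/-- Once the partner `a` of `a₀` is fixed, the other blocks form independent noncrossing pairings of
the points inside and beyond the pair. Restriction to the two pieces is inverse to taking their
union and inserting `{a₀, a}`. -/
lemma sum_ncPairings_pair_mem (σ : I → ℝ) (l : α → I) (h₀ : ∀ x ∈ A, a₀ ≤ x) (ha₀ : a₀ ∈ A)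
    (ha : a ∈ A) (hlt : a₀ < a) :
    ∑ P ∈ ncPairings A with ({a₀, a} : Finset α) ∈ P, ∏ B ∈ P, blockWeight σ l B =
      Set.indicator {l a₀} (fun i => σ i ^ 2) (l a) *
        ncMoment σ l (A.filter fun x => a₀ < x ∧ x < a) * ncMoment σ l (A.filter fun x => a < x) := by
  set A₁ := A.filter fun x => a₀ < x ∧ x < a with hA₁
  set A₂ := A.filter fun x => a < x with hA₂
  have hdisj : ∀ x ∈ A₁, x ∉ A₂ := fun x h1 h2 =>
    absurd (Finset.mem_filter.1 h1).2.2 (Finset.mem_filter.1 h2).2.not_gt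
  have hn₁ : a₀ ∉ A₁ := fun h => lt_irrefl _ (Finset.mem_filter.1 h).2.1
  have hn₂ : a₀ ∉ A₂ := fun h => absurd (Finset.mem_filter.1 h).2 hlt.not_gt
  have hB₁ : ¬ ({a₀, a} : Finset α) ⊆ A₁ := fun h => hn₁ (h (by simp))
  have hB₂ : ¬ ({a₀, a} : Finset α) ⊆ A₂ := fun h => hn₂ (h (by simp))
  have hnot : ∀ {B : Finset α}, B.card = 2 → B ⊆ A₁ → ¬ B ⊆ A₂ := by
    intro B hB h1 h2
    obtain ⟨x, hx⟩ := Finset.card_pos.1 (by omega : 0 < B.card)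
    exact hdisj x (h1 hx) (h2 hx)
  rw [mul_assoc, ncMoment, ncMoment, Finset.sum_mul_sum, ← Finset.sum_product', Finset.mul_sum]
  refine Finset.sum_bij' (fun P _ => (P.filter (· ⊆ A₁), P.filter (· ⊆ A₂)))
    (fun Q _ => insert {a₀, a} (Q.1 ∪ Q.2)) ?_ ?_ ?_ ?_ ?_
  · intro P hP
    obtain ⟨hP, hB⟩ := Finset.mem_filter.1 hP
    have h := mem_ncPairings.1 hP
    refine Finset.mem_product.2 ⟨mem_ncPairings.2 (h.filter_subset (Finset.filter_subset _ _) ?_),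
      mem_ncPairings.2 (h.filter_subset (Finset.filter_subset _ _) ?_)⟩
    · intro B' hB' x hx hxA
      rcases h.block_cases h₀ hB hB' with rfl | h1 | h2
      · have := (Finset.mem_filter.1 hxA).2
        rcases (by simpa using hx : x = a₀ ∨ x = a) with rfl | rfl
        · exact absurd this.1 (lt_irrefl _)
        · exact absurd this.2 (lt_irrefl _)
      · exact h1
      · exact absurd (h2 hx) (hdisj x hxA)
    · intro B' hB' x hx hxA
      rcases h.block_cases h₀ hB hB' with rfl | h1 | h2
      · have := (Finset.mem_filter.1 hxA).2
        rcases (by simpa using hx : x = a₀ ∨ x = a) with rfl | rfl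
        · exact absurd this hlt.not_gt
        · exact absurd this (lt_irrefl _)
      · exact absurd hxA (hdisj x (h1 hx))
      · exact h2
  · intro Q hQ
    obtain ⟨h1, h2⟩ := Finset.mem_product.1 hQ
    exact Finset.mem_filter.2 ⟨mem_ncPairings.2 (isNCPairing_insert h₀ ha₀ ha hlt
      (mem_ncPairings.1 h1) (mem_ncPairings.1 h2)), by simp⟩
  · intro P hP
    obtain ⟨hP, hB⟩ := Finset.mem_filter.1 hP
    have h := mem_ncPairings.1 hP
    ext B
    simp only [Finset.mem_insert, Finset.mem_union, Finset.mem_filter]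
    constructor
    · rintro (rfl | h1 | h2)
      · exact hB
      · exact h1.1
      · exact h2.1
    · intro hBP
      rcases h.block_cases h₀ hB hBP with h1 | h1 | h1
      · exact Or.inl h1
      · exact Or.inr (Or.inl ⟨hBP, h1⟩)
      · exact Or.inr (Or.inr ⟨hBP, h1⟩)
  · intro Q hQ
    obtain ⟨h1, h2⟩ := Finset.mem_product.1 hQ
    have h1 := mem_ncPairings.1 h1
    have h2 := mem_ncPairings.1 h2
    refine Prod.ext ?_ ?_
    · ext B
      simp only [Finset.mem_insert, Finset.mem_union, Finset.mem_filter]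
      constructor
      · rintro ⟨rfl | h | h, hs⟩
        · exact absurd hs hB₁
        · exact h
        · exact absurd (h2.subset B h) (hnot (h2.card B h) hs)
      · exact fun h => ⟨Or.inr (Or.inl h), h1.subset B h⟩
    · ext B
      simp only [Finset.mem_insert, Finset.mem_union, Finset.mem_filter]
      constructor
      · rintro ⟨rfl | h | h, hs⟩
        · exact absurd hs hB₂
        · exact absurd hs (hnot (h1.card B h) (h1.subset B h))
        · exact h
      · exact fun h => ⟨Or.inr (Or.inr h), h2.subset B h⟩
  · intro P hP
    obtain ⟨hP, hB⟩ := Finset.mem_filter.1 hP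
    have h := mem_ncPairings.1 hP
    have hPeq : P = insert {a₀, a} (P.filter (· ⊆ A₁) ∪ P.filter (· ⊆ A₂)) := by
      ext B
      simp only [Finset.mem_insert, Finset.mem_union, Finset.mem_filter]
      constructor
      · intro hBP
        rcases h.block_cases h₀ hB hBP with h1 | h1 | h1
        · exact Or.inl h1
        · exact Or.inr (Or.inl ⟨hBP, h1⟩)
        · exact Or.inr (Or.inr ⟨hBP, h1⟩)
      · rintro (rfl | h1 | h2)
        · exact hB
        · exact h1.1
        · exact h2.1
    conv_lhs => rw [hPeq]
    rw [Finset.prod_insert, Finset.prod_union, blockWeight_pair σ l hlt.ne]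
    · rw [Finset.disjoint_left]
      intro B hB1 hB2
      exact hnot (h.card B (Finset.mem_filter.1 hB1).1) (Finset.mem_filter.1 hB1).2
        (Finset.mem_filter.1 hB2).2
    · simp only [Finset.mem_union, Finset.mem_filter, not_or, not_and]
      exact ⟨fun _ => hB₁, fun _ => hB₂⟩

/-- The recursion according to the partner of the first element. -/
lemma ncMoment_eq_sum (σ : I → ℝ) (l : α → I) (h₀ : ∀ x ∈ A, a₀ ≤ x) (ha₀ : a₀ ∈ A) :
    ncMoment σ l A = ∑ a ∈ A.erase a₀, Set.indicator {l a₀} (fun i => σ i ^ 2) (l a) *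
        ncMoment σ l (A.filter fun x => a₀ < x ∧ x < a) *
        ncMoment σ l (A.filter fun x => a < x) := by
  have h1 : ∀ P ∈ ncPairings A, ∏ B ∈ P, blockWeight σ l B =
      ∑ a ∈ A.erase a₀, if ({a₀, a} : Finset α) ∈ P then ∏ B ∈ P, blockWeight σ l B else 0 := by
    intro P hP
    have h := mem_ncPairings.1 hP
    obtain ⟨B, hB, haB⟩ := h.exists_mem a₀ ha₀
    obtain ⟨a, ha, hBa⟩ : ∃ a, a ≠ a₀ ∧ B = {a₀, a} := by
      obtain ⟨x, y, hxy, rfl⟩ := Finset.card_eq_two.1 (h.card B hB)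
      rcases (by simpa using haB : a₀ = x ∨ a₀ = y) with rfl | rfl
      · exact ⟨y, hxy.symm, rfl⟩
      · exact ⟨x, hxy, Finset.pair_comm _ _⟩
    rw [Finset.sum_eq_single a]
    · rw [if_pos (hBa ▸ hB)]
    · intro b hb hba
      rw [if_neg]
      intro hbP
      have := h.unique _ hbP B hB a₀ (by simp) haB
      rw [hBa] at this
      have hbm : b ∈ ({a₀, a} : Finset α) := this ▸ (by simp)
      rcases (by simpa using hbm : b = a₀ ∨ b = a) with h1 | h1
      · exact (Finset.mem_erase.1 hb).1 h1
      · exact hba h1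
    · intro hna
      exact absurd (Finset.mem_erase.2 ⟨ha, h.subset B hB (by simp [hBa])⟩) hna
  rw [ncMoment, Finset.sum_congr rfl h1, Finset.sum_comm]
  refine Finset.sum_congr rfl fun a ha => ?_
  obtain ⟨hne, haA⟩ := Finset.mem_erase.1 ha
  rw [← sum_ncPairings_pair_mem σ l h₀ ha₀ haA (lt_of_le_of_ne (h₀ a haA) hne.symm),
    Finset.sum_filter]

end Split

/-- Both sides obey the recursion for the partner of the least element, so no pairing has to be
transported along `f`. -/
lemma ncMoment_map (σ : I → ℝ) (l : β → I) (f : α ↪o β) (A : Finset α) :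
    ncMoment σ l (A.map f.toEmbedding) = ncMoment σ (fun x => l (f x)) A := by
  induction hn : A.card using Nat.strong_induction_on generalizing A with
  | _ n ih =>
  subst hn
  rcases A.eq_empty_or_nonempty with rfl | hA
  · simp [ncMoment_empty]
  have hmin := A.min'_mem hA
  have hle : ∀ x ∈ A, A.min' hA ≤ x := fun x hx => A.min'_le x hx
  set a₀ := A.min' hA with ha₀
  rw [ncMoment_eq_sum σ _ hle hmin, ncMoment_eq_sum σ l (A := A.map f.toEmbedding) (a₀ := f a₀)
    (by simpa using hle) (by simpa using hmin)]
  have herase : (A.map f.toEmbedding).erase (f a₀) = (A.erase a₀).map f.toEmbedding := by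
    rw [Finset.map_erase]; rfl
  rw [herase, Finset.sum_map]
  refine Finset.sum_congr rfl fun a ha => ?_
  have e1 : (A.map f.toEmbedding).filter (fun x => f a₀ < x ∧ x < f a) =
      (A.filter fun x => a₀ < x ∧ x < a).map f.toEmbedding := by
    rw [Finset.filter_map]; congr 1; ext x; simp
  have e2 : (A.map f.toEmbedding).filter (fun x => f a < x) =
      (A.filter fun x => a < x).map f.toEmbedding := by
    rw [Finset.filter_map]; congr 1; ext x; simp
  have c1 : (A.filter fun x => a₀ < x ∧ x < a).card < A.card :=
    Finset.card_lt_card (Finset.filter_ssubset.2 ⟨a₀, hmin, by simp⟩)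
  have c2 : (A.filter fun x => a < x).card < A.card :=
    Finset.card_lt_card (Finset.filter_ssubset.2 ⟨a₀, hmin, by
      simpa using hle a (Finset.mem_of_mem_erase ha)⟩)
  simp only [RelEmbedding.coe_toEmbedding]
  rw [e1, e2, ih _ c1 _ rfl, ih _ c2 _ rfl]

end Pairings

/-! ### The recursion for the moments of words. -/

section Words

variable {I : Type*}

lemma wordMoment_eq_ncMoment (σ : I → ℝ) (w : List I) :
    wordMoment σ w = ncMoment σ w.get Finset.univ := by
  classical
  rw [wordMoment, ncMoment]
  refine Finset.sum_bij (fun π _ => π.parts) ?_ ?_ ?_ ?_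
  · intro π hπ
    obtain ⟨-, h1, h2⟩ := Finset.mem_filter.1 hπ
    refine mem_ncPairings.2 ⟨h1, fun B _ => Finset.subset_univ _, fun x _ => ?_, ?_, h2⟩
    · exact π.exists_mem (Finset.mem_univ x)
    · intro B hB C hC x hxB hxC
      exact π.eq_of_mem_parts hB hC hxB hxC
  · intro π _ π' _ h
    exact Finpartition.ext h
  · intro P hP
    have h := mem_ncPairings.1 hP
    refine ⟨Finpartition.ofExistsUnique P (fun B _ => Finset.subset_univ _) (fun x _ => ?_) ?_,
      ?_, rfl⟩
    · obtain ⟨B, hB, hx⟩ := h.exists_mem x (Finset.mem_univ x)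
      exact ⟨B, ⟨hB, hx⟩, fun C hC => h.unique C hC.1 B hB x hC.2 hx⟩
    · intro hmem
      simpa using h.card ∅ hmem
    · exact Finset.mem_filter.2 ⟨Finset.mem_univ _, h.card, h.noncrossing⟩
  · intro π _
    refine Finset.prod_congr rfl fun B _ => ?_
    rw [blockWeight]
    congr 1
    split_ifs <;> rfl

lemma isSemicircular_wordMoment (σ : I → ℝ) : IsSemicircular σ (wordMoment σ) where
  nil := by
    rw [wordMoment_eq_ncMoment]
    exact ncMoment_empty σ _
  cons i w := by
    rw [wordMoment_eq_ncMoment, ncMoment_eq_sum σ _ (a₀ := (⟨0, by simp⟩ : Fin (i :: w).length))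
      (fun x _ => Nat.zero_le x.1) (Finset.mem_univ _)]
    -- A partner at position `a` of `w` stands at position `a + 1` of `i :: w`. The points inside
    -- the pair are then `1, …, a`, which carry `w.take a`, and those beyond it start at `a + 2` and
    -- carry `w.drop (a + 1)`.
    let e : Fin w.length ↪ Fin (i :: w).length :=
      ⟨fun a => ⟨a.1 + 1, by simp⟩, fun a b h => by
        have h' : a.1 + 1 = b.1 + 1 := congrArg Fin.val h
        exact Fin.ext (by omega)⟩
    have he : ∀ a, (e a).1 = a.1 + 1 := fun _ => rfl
    have herase : (Finset.univ : Finset (Fin (i :: w).length)).erase ⟨0, by simp⟩ =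
        Finset.univ.map e := by
      ext x
      simp only [Finset.mem_erase, Finset.mem_univ, and_true, Finset.mem_map, true_and,
        ne_eq, Fin.ext_iff, he]
      constructor
      · intro hx
        have := x.2
        simp only [List.length_cons] at this
        exact ⟨⟨x.1 - 1, by omega⟩, by simp; omega⟩
      · rintro ⟨a, ha⟩
        omega
    rw [herase, Finset.sum_map]
    refine Finset.sum_congr rfl fun a _ => ?_
    have ha := a.2
    have h1 : ncMoment σ (i :: w).get (Finset.univ.filter fun x : Fin (i :: w).length =>
        (⟨0, by simp⟩ : Fin (i :: w).length) < x ∧ x < ⟨a.1 + 1, by simp⟩) =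
        wordMoment σ (w.take a) := by
      have hl : (w.take a).length = a := by rw [List.length_take]; omega
      let f : Fin (w.take a).length ↪o Fin (i :: w).length :=
        OrderEmbedding.ofStrictMono (fun x => ⟨x.1 + 1, by simp; omega⟩)
          (fun x y h => by simp only [Fin.lt_def] at h ⊢; omega)
      have hfv : ∀ x, (f x).1 = x.1 + 1 := fun x => rfl
      have hf : (Finset.univ.filter fun x : Fin (i :: w).length =>
          (⟨0, by simp⟩ : Fin (i :: w).length) < x ∧ x < ⟨a.1 + 1, by simp⟩) =
          Finset.univ.map f.toEmbedding := by
        ext x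
        simp only [Finset.mem_filter, Finset.mem_univ, true_and, Finset.mem_map, Fin.lt_def,
          RelEmbedding.coe_toEmbedding, Fin.ext_iff, hfv]
        constructor
        · intro hx
          exact ⟨⟨x.1 - 1, by omega⟩, by simp; omega⟩
        · rintro ⟨y, hy⟩
          have := y.2
          omega
      rw [hf, ncMoment_map, wordMoment_eq_ncMoment]
      congr 1
      ext x
      simp [hfv]
    have h2 : ncMoment σ (i :: w).get (Finset.univ.filter fun x : Fin (i :: w).length =>
        (⟨a.1 + 1, by simp⟩ : Fin (i :: w).length) < x) = wordMoment σ (w.drop (a + 1)) := by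
      have hl : (w.drop (a + 1)).length = w.length - (a + 1) := List.length_drop
      let f : Fin (w.drop (a + 1)).length ↪o Fin (i :: w).length :=
        OrderEmbedding.ofStrictMono (fun x => ⟨a + 1 + x.1 + 1, by have := x.2; simp; omega⟩)
          (fun x y h => by simp only [Fin.lt_def] at h ⊢; omega)
      have hfv : ∀ x, (f x).1 = a + 1 + x.1 + 1 := fun x => rfl
      have hf : (Finset.univ.filter fun x : Fin (i :: w).length =>
          (⟨a.1 + 1, by simp⟩ : Fin (i :: w).length) < x) = Finset.univ.map f.toEmbedding := by
        ext x
        simp only [Finset.mem_filter, Finset.mem_univ, true_and, Finset.mem_map, Fin.lt_def,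
          RelEmbedding.coe_toEmbedding, Fin.ext_iff, hfv]
        constructor
        · intro hx
          have := x.2
          simp only [List.length_cons] at this
          exact ⟨⟨x.1 - (a + 2), by omega⟩, by simp; omega⟩
        · rintro ⟨y, hy⟩
          omega
      rw [hf, ncMoment_map, wordMoment_eq_ncMoment]
      congr 1
      ext x
      simp [hfv]
    have hea : e a = ⟨a.1 + 1, by simp⟩ := rfl
    rw [hea, h1, h2]
    simp

end Words

end RandomBand

end

noncomputable section

namespace RandomBand

/-! ### Product measures are stable under resampling -/

/-- Checked on finite boxes: their preimages are boxes in which the constraint on the coordinate `e`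
has moved to the fresh variable. -/
lemma resamples_infinitePi {ι : Type*} (ν : ι → Measure ℂ) [∀ i, IsProbabilityMeasure (ν i)] :
    Resamples (Measure.infinitePi ν) := by
  classical
  intro e
  have hmeas : Measurable fun p : (ι → ℂ) × ℂ => upd p.1 e p.2 := measurable_update_prod e
  refine ⟨hmeas, Measure.eq_infinitePi _ fun s t ht => ?_⟩
  have hmap : (Measure.infinitePi ν).map (fun z => z e) = ν e :=
    (measurePreserving_eval_infinitePi ν e).map_eq
  rw [Measure.map_apply hmeas (.pi s.countable_toSet fun i _ => ht i), hmap]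
  have hpre : (fun p : (ι → ℂ) × ℂ => upd p.1 e p.2) ⁻¹' (Set.pi s t) =
      (Set.pi (s.erase e : Finset ι) t) ×ˢ (if e ∈ s then t e else Set.univ) := by
    ext ⟨z, u⟩
    simp only [Set.mem_preimage, Set.mem_pi, Set.mem_prod, Finset.mem_coe, Finset.mem_erase]
    constructor
    · intro h
      refine ⟨fun i hi => ?_, ?_⟩
      · simpa only [upd_of_ne hi.1] using h i hi.2
      · split_ifs with he
        · simpa using h e he
        · trivial
    · rintro ⟨h1, h2⟩ i hi
      by_cases hie : i = e
      · subst hie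
        rw [if_pos hi] at h2
        simpa using h2
      · rw [upd_of_ne hie]
        exact h1 i ⟨hie, hi⟩
  rw [hpre, Measure.prod_prod, Measure.infinitePi_pi _ fun i _ => ht i]
  split_ifs with he
  · exact Finset.prod_erase_mul s (fun i => ν i (t i)) he
  · rw [measure_univ, mul_one, Finset.erase_eq_of_notMem he]

/-! ### Periodic bands -/

lemma periodicDist_comm (N : ℕ) (j k : Fin N) : periodicDist N j k = periodicDist N k j := by
  unfold periodicDist
  have : ((j : ℤ) - (k : ℤ)).natAbs = ((k : ℤ) - (j : ℤ)).natAbs := by omega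
  rw [this]

/-- If `N ≤ 2b + 1`, every periodic distance is at most `b`. Otherwise the band around `j` is a
cyclic interval of `2b + 1` points. -/
lemma card_periodicDist_le (N b : ℕ) (j : Fin N) :
    (Finset.univ.filter fun k => periodicDist N j k ≤ b).card = xi N b := by
  have hj := j.2
  unfold xi
  rcases le_or_gt N (2 * b + 1) with h | h
  · rw [min_eq_right h, Finset.filter_true_of_mem, Finset.card_univ, Fintype.card_fin]
    intro k _
    have := k.2
    unfold periodicDist
    omega
  · rw [min_eq_left h.le, ← Finset.card_range (2 * b + 1)]
    -- The bijection onto `{0, …, 2b}` is `k ↦ k - j + b` modulo `N`.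
    refine Finset.card_bij (fun k _ => if k.1 + b < j then k.1 + b + N - j
      else if N ≤ k.1 + b - j then k.1 + b - j - N else k.1 + b - j) ?_ ?_ ?_
    · intro k hk
      have := k.2
      rw [Finset.mem_filter, periodicDist] at hk
      rw [Finset.mem_range]
      split_ifs <;> omega
    · intro k hk l hl hkl
      have := k.2
      have := l.2
      rw [Finset.mem_filter, periodicDist] at hk hl
      rw [Fin.ext_iff]
      split_ifs at hkl <;> omega
    · intro m hm
      rw [Finset.mem_range] at hm
      -- The preimage of `m` is `m + j - b` modulo `N`; the three ranges of `m + j` below correspond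
      -- to wrapping upwards, not at all, or downwards.
      have key : ∀ k, k < N → min ((j : ℤ) - (k : ℤ)).natAbs (N - ((j : ℤ) - (k : ℤ)).natAbs) ≤ b →
          (if k + b < j then k + b + N - j else if N ≤ k + b - j then k + b - j - N
            else k + b - j) = m → ∃ (a : Fin N) (_ : a ∈ Finset.univ.filter fun k =>
              periodicDist N j k ≤ b), (if a.1 + b < j then a.1 + b + N - j
              else if N ≤ a.1 + b - j then a.1 + b - j - N else a.1 + b - j) = m :=
        fun k hk h1 h2 => ⟨⟨k, hk⟩, Finset.mem_filter.2 ⟨Finset.mem_univ _, h1⟩, h2⟩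
      rcases lt_or_ge (m + j) b with h1 | h1
      · refine key (m + j + N - b) ?_ ?_ ?_
        · omega
        · omega
        · split_ifs <;> omega
      rcases lt_or_ge (m + j - b) N with h2 | h2
      · refine key (m + j - b) h2 ?_ ?_
        · omega
        · split_ifs <;> omega
      · refine key (m + j - b - N) ?_ ?_ ?_
        · omega
        · omega
        · split_ifs <;> omega

/-- The standard deviation profile of a random band matrix with `σ = 1`. -/
def bandProfile (N b : ℕ) (j k : Fin N) : ℝ :=
  if periodicDist N j k ≤ b then (√(xi N b))⁻¹ else 0

lemma bandProfile_nonneg (N b : ℕ) (j k : Fin N) : 0 ≤ bandProfile N b j k := by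
  unfold bandProfile; split_ifs <;> positivity

lemma bandProfile_le (N b : ℕ) (j k : Fin N) : bandProfile N b j k ≤ (√(xi N b))⁻¹ := by
  unfold bandProfile; split_ifs
  · exact le_rfl
  · positivity

lemma bandProfile_comm (N b : ℕ) (j k : Fin N) : bandProfile N b j k = bandProfile N b k j := by
  rw [bandProfile, bandProfile, periodicDist_comm]

lemma sum_bandProfile_sq (N b : ℕ) (j : Fin N) : ∑ k, bandProfile N b j k ^ 2 = 1 := by
  have h0 : 0 < xi N b := by
    have := j.2
    unfold xi
    omega
  have h : ∀ k, bandProfile N b j k ^ 2 =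
      if periodicDist N j k ≤ b then ((xi N b : ℝ))⁻¹ else 0 := fun k => by
    unfold bandProfile
    split_ifs
    · rw [inv_pow, Real.sq_sqrt (Nat.cast_nonneg _)]
    · simp
  simp only [h]
  rw [← Finset.sum_filter, Finset.sum_const, card_periodicDist_le, nsmul_eq_mul,
    mul_inv_cancel₀ (by positivity)]

/-- An entry of a random band matrix as a function of the underlying variable. -/
def bandEntry (N b : ℕ) (j k : Fin N) (t : ℂ) : ℂ :=
  (bandProfile N b j k : ℂ) * if j ≤ k then t else conj t

/-- The independent variables underlying the random band matrices of size `N`. -/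
def bandVars {I Ω : Type*} (X : I → EntryIndex → Ω → ℂ) (N : ℕ) (ω : Ω)
    (q : I × Sym2 (Fin N)) : ℂ :=
  X q.1 ⟨N, Sym2.sortEquiv q.2⟩ ω

lemma sortEquiv_mk {N : ℕ} {j k : Fin N} (h : j ≤ k) :
    Sym2.sortEquiv s(j, k) = ⟨(j, k), h⟩ := by
  apply Sym2.sortEquiv.symm.injective
  simp

lemma rbm_apply {I Ω : Type*} (X : I → EntryIndex → Ω → ℂ) (b : I → ℕ → ℕ) (i : I) (N : ℕ) (ω : Ω)
    (j k : Fin N) :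
    rbm (X i) (b i) N ω j k = bandEntry N (b i N) j k (bandVars X N ω (i, s(j, k))) := by
  have h1 : rbm (X i) (b i) N ω j k = ((√(xi N (b i N)) : ℝ) : ℂ)⁻¹ *
      ((if periodicDist N j k ≤ b i N then 1 else 0) * (if h : j ≤ k then X i ⟨N, (j, k), h⟩ ω
        else conj (X i ⟨N, (k, j), (not_le.mp h).le⟩ ω))) := rfl
  rw [h1, ← mul_assoc, bandEntry, bandVars, bandProfile]
  congr 1
  · split_ifs <;> simp
  · by_cases h : j ≤ k
    · rw [dif_pos h, if_pos h, sortEquiv_mk h]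
    · rw [dif_neg h, if_neg h, Sym2.eq_swap, sortEquiv_mk (not_le.mp h).le]

/-! ### The joint law of the entries as a band model. -/

section Law

variable {I Ω : Type*} [MeasurableSpace Ω] {μ : Measure Ω}
  {σ : I → ℝ} {X : I → EntryIndex → Ω → ℂ}

lemma measurable_bandVars (hX : ∀ i, IsWignerEntries μ (σ i) (X i)) (N : ℕ) :
    Measurable (bandVars X N) :=
  measurable_pi_iff.2 fun q => (hX q.1).measurable _

/-- Independence within each family and between the families combine to joint independence of all
entries. Sorting unordered pairs selects distinct ones, so the joint law is a product measure. -/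
lemma resamples_bandVars [IsProbabilityMeasure μ] (hX : ∀ i, IsWignerEntries μ (σ i) (X i))
    (hindep : iIndepFun (fun (i : I) (ω : Ω) (e : EntryIndex) => X i e ω) μ) (N : ℕ) :
    Resamples (μ.map (bandVars X N)) := by
  have h1 : iIndepFun (fun (p : I × EntryIndex) ω => X p.1 p.2 ω) μ :=
    iIndepFun_uncurry' (fun i e => (hX i).measurable e) hindep fun i => (hX i).indep
  have hinj : Function.Injective fun q : I × Sym2 (Fin N) =>
      ((q.1, ⟨N, Sym2.sortEquiv q.2⟩) : I × EntryIndex) := by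
    rintro ⟨i, q⟩ ⟨i', q'⟩ h
    simp only [Prod.mk.injEq, Sigma.mk.injEq, heq_eq_eq, true_and,
      EmbeddingLike.apply_eq_iff_eq] at h
    exact Prod.ext h.1 h.2
  have h2 := h1.precomp hinj
  have hm : ∀ q : I × Sym2 (Fin N), Measurable fun ω => bandVars X N ω q :=
    fun q => (hX q.1).measurable _
  have h3 := h2.map_fun_eq_infinitePi_map hm
  have h4 : μ.map (bandVars X N) = Measure.infinitePi fun q => μ.map fun ω => bandVars X N ω q := h3
  rw [h4]
  have : ∀ q : I × Sym2 (Fin N), IsProbabilityMeasure (μ.map fun ω => bandVars X N ω q) :=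
    fun q => Measure.isProbabilityMeasure_map (hm q).aemeasurable
  exact resamples_infinitePi _

lemma allMoments_map_iff {Ω' : Type*} [MeasurableSpace Ω'] {Z : Ω → Ω'} (hZ : Measurable Z)
    {f : Ω' → ℂ} (hf : Measurable f) :
    AllMoments (μ.map Z) f ↔ AllMoments μ fun ω => f (Z ω) :=
  ⟨fun h => ⟨hf.comp hZ, fun k => (h.memLp k).comp_of_map hZ.aemeasurable⟩,
    fun h => ⟨hf, fun k => (memLp_map_measure_iff hf.aestronglyMeasurable hZ.aemeasurable).2
      (h.memLp k)⟩⟩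

lemma nrm_map {Ω' : Type*} [MeasurableSpace Ω'] {Z : Ω → Ω'} (hZ : Measurable Z)
    {f : Ω' → ℂ} (hf : Measurable f) (k : ℕ) :
    nrm (μ.map Z) k f = nrm μ k fun ω => f (Z ω) := by
  rw [nrm, eLpNorm_map_measure hf.aestronglyMeasurable hZ.aemeasurable]
  rfl

lemma IsWignerEntries.exists_bound {s : ℝ} {Y : EntryIndex → Ω → ℂ} (h : IsWignerEntries μ s Y)
    (l : ℕ) : ∃ C : ℝ≥0∞, C < ∞ ∧ ∀ e, eLpNorm (Y e) ((2 : ℝ≥0∞) ^ (l + 1)) μ ≤ C := by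
  set B := ⨆ e : EntryIndex, ∫⁻ ω, ‖Y e ω‖ₑ ^ (2 ^ (l + 1)) ∂μ with hB
  have hp : ((2 : ℝ≥0∞) ^ (l + 1)).toReal = ((2 ^ (l + 1) : ℕ) : ℝ) := by simp
  refine ⟨B ^ (1 / ((2 ^ (l + 1) : ℕ) : ℝ)), ENNReal.rpow_lt_top_of_nonneg (by positivity)
    (h.moments _).ne, fun e => ?_⟩
  rw [eLpNorm_eq_lintegral_rpow_enorm_toReal (by positivity) (by simp), hp]
  refine ENNReal.rpow_le_rpow ?_ (by positivity)
  simp only [ENNReal.rpow_natCast]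
  exact le_iSup (fun e : EntryIndex => ∫⁻ ω, ‖Y e ω‖ₑ ^ (2 ^ (l + 1)) ∂μ) e

lemma IsWignerEntries.allMoments {s : ℝ} {Y : EntryIndex → Ω → ℂ} (h : IsWignerEntries μ s Y)
    (e : EntryIndex) : AllMoments μ (Y e) :=
  ⟨h.measurable e, fun k => by
    obtain ⟨C, hC, hle⟩ := h.exists_bound k
    exact ⟨(h.measurable e).aestronglyMeasurable, (hle e).trans_lt hC⟩⟩

/-- A bound for the norms of the variables with labels in a finite set. -/
lemma exists_nrm_le (hX : ∀ i, IsWignerEntries μ (σ i) (X i)) (w : List I) :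
    ∃ K : ℕ → ℝ, (∀ l, 0 ≤ K l) ∧ ∀ i ∈ w, ∀ l e, nrm μ l (X i e) ≤ K l := by
  choose C hC hle using fun (i : I) (l : ℕ) => (hX i).exists_bound l
  refine ⟨fun l => (w.map fun i => (C i l).toReal).sum, fun l => ?_, fun i hi l e => ?_⟩
  · exact List.sum_nonneg (by simp)
  · refine (ENNReal.toReal_mono (hC i l).ne (hle i l e)).trans ?_
    exact List.single_le_sum (by simp) _ (List.mem_map.2 ⟨i, hi, rfl⟩)

lemma nrm_conj (k : ℕ) (f : Ω → ℂ) : nrm μ k (fun ω => conj (f ω)) = nrm μ k f := by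
  rw [nrm, nrm, eLpNorm_congr_norm_ae (g := f) (Eventually.of_forall fun ω => by simp)]

open Classical in
/-- The random band matrices with labels in a word `w` form a band model. -/
lemma isVarianceModel_band [IsProbabilityMeasure μ]
    (hX : ∀ i, IsWignerEntries μ (σ i) (X i))
    (hindep : iIndepFun (fun (i : I) (ω : Ω) (e : EntryIndex) => X i e ω) μ) (b : I → ℕ → ℕ)
    (w : List I) {K : ℕ → ℝ} (hK0 : ∀ l, 0 ≤ K l) (hK : ∀ i ∈ w, ∀ l e, nrm μ l (X i e) ≤ K l)
    (N : ℕ) :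
    IsVarianceModel K (fun i => if i ∈ w then σ i else 0) (μ.map (bandVars X N))
      (fun i j k t => if i ∈ w then bandEntry N (b i N) j k t else 0)
      (fun i j k => bandProfile N (b i N) j k) := by
  have hZ := measurable_bandVars hX N
  have hprob : IsProbabilityMeasure (μ.map (bandVars X N)) :=
    Measure.isProbabilityMeasure_map hZ.aemeasurable
  have hem : ∀ i j k, Measurable fun t => if i ∈ w then bandEntry N (b i N) j k t else 0 := by
    intro i j k
    by_cases hi : i ∈ w <;> by_cases hjk : j ≤ k <;> simp only [hi, hjk, bandEntry, if_true,
      if_false]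
    · exact measurable_id.const_mul _
    · exact Complex.continuous_conj.measurable.const_mul _
    · exact measurable_const
    · exact measurable_const
  have hem' : ∀ i j k q, Measurable fun z : I × Sym2 (Fin N) → ℂ =>
      if i ∈ w then bandEntry N (b i N) j k (z (i, q)) else 0 := fun i j k q =>
    (hem i j k).comp (measurable_pi_apply (i, q))
  have hvm : ∀ i q, AllMoments μ fun ω => bandVars X N ω (i, q) := fun i q => (hX i).allMoments _
  refine ⟨⟨hprob, resamples_bandVars hX hindep N, ?_, ?_, ?_, ?_, ?_, ?_, ?_⟩, ?_, ?_⟩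
  · intro i j k
    simp [bandEntry]
  · intro i j k
    rw [allMoments_map_iff hZ (hem' i j k s(j, k))]
    by_cases hi : i ∈ w <;> simp only [hi, if_true, if_false]
    · by_cases hjk : j ≤ k <;> simp only [bandEntry, hjk, if_true, if_false]
      · exact (AllMoments.const _).mul (hvm _ _)
      · exact (AllMoments.const _).mul (hvm _ _).star
    · exact AllMoments.const 0
  · intro i j k l
    rw [nrm_map hZ (hem' i j k s(j, k))]
    by_cases hi : i ∈ w <;> simp only [hi, if_true, if_false]
    · have hle : nrm μ l (fun ω => bandVars X N ω (i, s(j, k))) ≤ K l := hK i hi l _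
      have h0 := bandProfile_nonneg N (b i N) j k
      by_cases hjk : j ≤ k <;> simp only [bandEntry, hjk, if_true, if_false] <;>
        rw [nrm_const_mul, Complex.norm_real, Real.norm_of_nonneg h0, mul_comm]
      · exact mul_le_mul_of_nonneg_right hle h0
      · rw [nrm_conj]
        exact mul_le_mul_of_nonneg_right hle h0
    · rw [nrm_zero]
      exact mul_nonneg (hK0 l) (bandProfile_nonneg _ _ _ _)
  · intro i j k; exact bandProfile_nonneg _ _ _ _
  · intro i j k; exact bandProfile_comm _ _ _ _
  · intro i j; exact (sum_bandProfile_sq _ _ _).le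
  · intro i j k hjk
    rw [integral_map hZ.aemeasurable (hem' i j k s(j, k)).aestronglyMeasurable]
    by_cases hi : i ∈ w <;> simp only [hi, if_true, if_false, integral_zero]
    rcases lt_or_gt_of_ne hjk with h | h
    · simp only [bandEntry, h.le, if_true]
      rw [integral_const_mul]
      simp only [bandVars, sortEquiv_mk h.le]
      rw [(hX i).centered N j k h, mul_zero]
    · simp only [bandEntry, not_le.2 h, if_false]
      rw [integral_const_mul, integral_conj]
      simp only [bandVars, Sym2.eq_swap (a := j), sortEquiv_mk h.le]
      rw [(hX i).centered N k j h, map_zero, mul_zero]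
  · intro i j; exact sum_bandProfile_sq _ _ _
  · intro i j k hjk
    have hmm : Measurable fun z : I × Sym2 (Fin N) → ℂ =>
        (if i ∈ w then bandEntry N (b i N) j k (z (i, s(j, k))) else 0) *
          if i ∈ w then bandEntry N (b i N) k j (z (i, s(j, k))) else 0 :=
      (hem' i j k s(j, k)).mul (hem' i k j s(j, k))
    rw [integral_map hZ.aemeasurable hmm.aestronglyMeasurable]
    by_cases hi : i ∈ w <;> simp only [hi, if_true, if_false, integral_zero, mul_zero]
    · have hvar : ∫ ω, ‖bandVars X N ω (i, s(j, k))‖ ^ 2 ∂μ = σ i ^ 2 := by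
        rcases lt_or_gt_of_ne hjk with h | h
        · simp only [bandVars, sortEquiv_mk h.le]
          exact (hX i).variance N j k h
        · simp only [bandVars, Sym2.eq_swap (a := j), sortEquiv_mk h.le]
          exact (hX i).variance N k j h
      -- For `j ≠ k` exactly one of the two entries is conjugated, so Hermitian symmetry turns the
      -- product into a squared modulus and only `E |X|²` enters.
      have hpt : ∀ ω, bandEntry N (b i N) j k (bandVars X N ω (i, s(j, k))) *
          bandEntry N (b i N) k j (bandVars X N ω (i, s(j, k))) =
          ((bandProfile N (b i N) j k ^ 2 * ‖bandVars X N ω (i, s(j, k))‖ ^ 2 : ℝ) : ℂ) := by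
        intro ω
        have hc := Complex.mul_conj (bandVars X N ω (i, s(j, k)))
        rw [Complex.normSq_eq_norm_sq] at hc
        rw [bandEntry, bandEntry, bandProfile_comm N (b i N) k j, Complex.ofReal_mul, ← hc]
        rcases lt_or_gt_of_ne hjk with h | h
        · rw [if_pos h.le, if_neg (not_le.2 h)]; push_cast; ring
        · rw [if_pos h.le, if_neg (not_le.2 h)]; push_cast; ring
      simp only [hpt]
      rw [integral_complex_ofReal, integral_const_mul, hvar, mul_comm]
    · simp

end Law

end RandomBand

end

noncomputable section

namespace RandomBand

open Matrix

lemma wordMoment_congr {I : Type*} {σ σ' : I → ℝ} (w : List I) (h : ∀ i ∈ w, σ i = σ' i) :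
    wordMoment σ w = wordMoment σ' w := by
  unfold wordMoment
  refine Finset.sum_congr rfl fun π _ => Finset.prod_congr rfl fun B _ => ?_
  congr 1
  exact Finset.prod_congr rfl fun j _ => h _ (List.get_mem _ _)

/-- The sum of the inverse square roots of the `ξ`s of the letters of a word. -/
def bandScale {I : Type*} (b : I → ℕ → ℕ) (N : ℕ) (w : List I) : ℝ :=
  (w.map fun i => (√(xi N (b i N)))⁻¹).sum

lemma bandScale_nonneg {I : Type*} (b : I → ℕ → ℕ) (N : ℕ) (w : List I) : 0 ≤ bandScale b N w :=
  List.sum_nonneg (by simp)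

/-! ### Deviation bounds for words in band matrices. -/

section Words

variable {I Ω : Type*} [MeasurableSpace Ω] {μ : Measure Ω} [IsProbabilityMeasure μ]
  {σ : I → ℝ} {X : I → EntryIndex → Ω → ℂ}

/-- The isotropic deviation of a word of random band matrices. -/
def wordDev (σ : I → ℝ) (X : I → EntryIndex → Ω → ℂ) (b : I → ℕ → ℕ) (w : List I) (N : ℕ)
    (y x : Fin N → ℂ) (ω : Ω) : ℂ :=
  y ⬝ᵥ (w.map fun i => rbm (X i) (b i) N ω).prod *ᵥ x - (wordMoment σ w : ℂ) * (y ⬝ᵥ x)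

-- The moment bounds need not be uniform in `i`, so the letters outside `w` are switched off: their
-- entries and their `σ` are set to zero while the profile is kept. Neither the word nor its moment
-- changes. The profile of each letter of `w` is bounded by `bandScale`, which serves as `η`.
open Classical in
lemma exists_nrm_wordDev_le (hX : ∀ i, IsWignerEntries μ (σ i) (X i))
    (hindep : iIndepFun (fun (i : I) (ω : Ω) (e : EntryIndex) => X i e ω) μ) (b : I → ℕ → ℕ)
    (w : List I) (m : ℕ) :
    ∃ C : ℝ, 0 ≤ C ∧ ∀ N (y x : Fin N → ℂ), AllMoments μ (wordDev σ X b w N y x) ∧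
      nrm μ m (wordDev σ X b w N y x) ≤ C * (bandScale b N w * (l2 y * l2 x)) := by
  obtain ⟨K, hK0, hK⟩ := exists_nrm_le hX w
  obtain ⟨C, hC0, hC⟩ := exists_isotropicBound K hK0 (fun i => if i ∈ w then σ i else 0) _
    (isSemicircular_wordMoment _) w m
  refine ⟨C, hC0, fun N y x => ?_⟩
  have hM := isVarianceModel_band hX hindep b w hK0 hK N
  have hZ := measurable_bandVars hX N
  have hprob := hM.prob
  have hmom := (hM.toIsBandModel.moments_form w y x).sub
    (AllMoments.const ((wordMoment σ w : ℂ) * (y ⬝ᵥ x)))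
  have hle := hC hM (bandScale b N w) (bandScale_nonneg _ _ _) (fun i hi j k =>
    (bandProfile_le _ _ _ _).trans (List.single_le_sum (by simp) _ (List.mem_map.2 ⟨i, hi, rfl⟩)))
    x y
  rw [wordMoment_congr (σ' := σ) w fun i hi => if_pos hi] at hle
  have hword : ∀ ω, wordMat (fun i j k t => if i ∈ w then bandEntry N (b i N) j k t else 0) w
      (bandVars X N ω) = (w.map fun i => rbm (X i) (b i) N ω).prod := fun ω => by
    unfold wordMat
    congr 1
    refine List.map_congr_left fun i hi => ?_
    ext j k
    rw [rbm_apply]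
    simp [mat, hi]
  have hdev : wordDev σ X b w N y x = fun ω => y ⬝ᵥ wordMat (fun i j k t =>
      if i ∈ w then bandEntry N (b i N) j k t else 0) w (bandVars X N ω) *ᵥ x -
      (wordMoment σ w : ℂ) * (y ⬝ᵥ x) := by
    ext ω
    rw [hword, wordDev]
  rw [hdev]
  refine ⟨(allMoments_map_iff hZ hmom.measurable).1 hmom, ?_⟩
  rwa [nrm_map hZ hmom.measurable] at hle

/-- Summable moment bounds give almost sure convergence. -/
lemma ae_tendsto_zero_of_summable {D : ℕ → Ω → ℂ} (hD : ∀ n, AllMoments μ (D n)) (m : ℕ)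
    {a : ℕ → ℝ} (ha : ∀ n, nrm μ m (D n) ≤ a n) (hsum : Summable fun n => a n ^ 2 ^ (m + 1)) :
    ∀ᵐ ω ∂μ, Tendsto (fun n => D n ω) atTop (𝓝 0) := by
  have hint : ∀ n, Integrable (fun ω => ‖D n ω‖ ^ 2 ^ (m + 1)) μ := fun n =>
    integrable_norm_pow (hD n) _
  have hs : Summable fun n => ∫ ω, ‖‖D n ω‖ ^ 2 ^ (m + 1)‖ ∂μ := by
    refine hsum.of_nonneg_of_le (fun n => integral_nonneg fun ω => norm_nonneg _) fun n => ?_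
    simp only [norm_pow, norm_norm]
    rw [← nrm_pow (hD n)]
    exact pow_le_pow_left₀ (nrm_nonneg _ _) (ha n) _
  have hae := summable_norm_of_tsum_eLpNorm_ne_top le_rfl
    (fun n => (hint n).aestronglyMeasurable) (by
      simp only [eLpNorm_one_eq_lintegral_enorm, ← ofReal_integral_norm_eq_lintegral_enorm (hint _)]
      exact hs.tsum_ofReal_ne_top)
  filter_upwards [hae] with ω hω
  have h1 := hω.of_norm.tendsto_atTop_zero
  rw [tendsto_zero_iff_norm_tendsto_zero]
  have h2 := h1.rpow_const (p := ((2 ^ (m + 1) : ℕ) : ℝ)⁻¹) (Or.inr (by positivity))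
  rw [Real.zero_rpow (by positivity)] at h2
  refine h2.congr fun n => ?_
  rw [Real.pow_rpow_inv_natCast (norm_nonneg _) (by positivity)]

end Words

/-! ### Noncommutative polynomials -/

lemma basisFreeMonoid_apply {I : Type*} (w : FreeMonoid I) :
    FreeAlgebra.basisFreeMonoid ℂ I w = FreeMonoid.lift (FreeAlgebra.ι ℂ) w := by
  simp [FreeAlgebra.basisFreeMonoid, FreeAlgebra.equivMonoidAlgebraFreeMonoid]

lemma polyEval_eq_sum {I : Type*} {N : ℕ} (Z : I → Matrix (Fin N) (Fin N) ℂ) (p : FreeAlgebra ℂ I) :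
    polyEval Z p = ∑ w ∈ ((FreeAlgebra.basisFreeMonoid ℂ I).repr p).support,
      (FreeAlgebra.basisFreeMonoid ℂ I).repr p w • ((FreeMonoid.toList w).map Z).prod := by
  conv_lhs => rw [← (FreeAlgebra.basisFreeMonoid ℂ I).linearCombination_repr p]
  rw [Finsupp.linearCombination_apply, Finsupp.sum, polyEval, map_sum]
  refine Finset.sum_congr rfl fun w _ => ?_
  rw [map_smul, basisFreeMonoid_apply, FreeMonoid.lift_apply, map_list_prod, List.map_map]
  congr 3
  ext i : 1
  simp

lemma semicircularState_eq_sum {I : Type*} (σ : I → ℝ) (p : FreeAlgebra ℂ I) :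
    semicircularState σ p = ∑ w ∈ ((FreeAlgebra.basisFreeMonoid ℂ I).repr p).support,
      (FreeAlgebra.basisFreeMonoid ℂ I).repr p w * (wordMoment σ (FreeMonoid.toList w) : ℂ) := by
  rw [semicircularState, Module.Basis.constr_apply, Finsupp.sum]
  simp only [smul_eq_mul]

/-! ### Products of rank one matrices -/

lemma prod_ofFn_vecMulVec {N n : ℕ} (u v : Fin (n + 1) → Fin N → ℂ) :
    (List.ofFn fun s => vecMulVec (u s) (v s)).prod =
      (∏ s : Fin n, v s.castSucc ⬝ᵥ u s.succ) • vecMulVec (u 0) (v (Fin.last n)) := by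
  induction n with
  | zero => simp
  | succ n ih =>
    rw [List.ofFn_succ, List.prod_cons, ih (fun s => u s.succ) (fun s => v s.succ),
      Matrix.mul_smul, vecMulVec_mul_vecMulVec, Fin.prod_univ_succ, vecMulVec_smul, smul_smul]
    simp only [Fin.succ_last, Fin.castSucc_zero, Fin.succ_castSucc]
    congr 1
    rw [mul_comm]

/-- In a product of rank one matrices each row factor `y^{(s)*} p_s` meets the next column factor
`x^{(s)}`, and the trace pairs the last row factor with the first column factor. -/
lemma cyclicTrace_eq_prod {I : Type*} {r N : ℕ} [NeZero r] (x y : Fin r → EuclideanSpace ℂ (Fin N))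
    (p : Fin r → FreeAlgebra ℂ I) (Z : I → Matrix (Fin N) (Fin N) ℂ) :
    cyclicTrace x y p Z = ∏ s, star (y s).ofLp ⬝ᵥ polyEval Z (p s) *ᵥ (x s).ofLp := by
  obtain ⟨n, rfl⟩ := Nat.exists_eq_succ_of_ne_zero (NeZero.ne r)
  have h : ∀ s : Fin (n + 1), outer (x (s - 1)) (y s) * polyEval Z (p s) =
      vecMulVec (x (s - 1)).ofLp (star (y s).ofLp ᵥ* polyEval Z (p s)) := fun s => by
    rw [outer, vecMulVec_mul]
  have h1 : ∀ s : Fin n, s.succ - 1 = s.castSucc := fun s => by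
    rw [sub_eq_iff_eq_add, Fin.coeSucc_eq_succ]
  -- Subtraction wraps around, which is the convention `x^{(0)} = x^{(r)}`.
  have h2 : (0 : Fin (n + 1)) - 1 = Fin.last n := by
    rw [sub_eq_iff_eq_add, Fin.last_add_one]
  unfold cyclicTrace
  simp only [h]
  rw [prod_ofFn_vecMulVec, trace_smul, trace_vecMulVec, Fin.prod_univ_castSucc, h2, smul_eq_mul]
  simp only [h1, dotProduct_mulVec]
  rw [dotProduct_comm (x _).ofLp]

/-! ### Convergence -/

lemma l2_ofLp {N : ℕ} (x : EuclideanSpace ℂ (Fin N)) : l2 x.ofLp = ‖x‖ :=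
  (EuclideanSpace.norm_eq x).symm

lemma l2_star {N : ℕ} (x : Fin N → ℂ) : l2 (star x) = l2 x := by
  simp [l2]

/-- Unit norm is impossible in dimension zero, where the only vector is zero; the weaker bound holds
for every `N`. -/
lemma norm_le_one_of_forall_one_le {N : ℕ} {x : EuclideanSpace ℂ (Fin N)}
    (h : 1 ≤ N → ‖x‖ = 1) : ‖x‖ ≤ 1 := by
  rcases N.eq_zero_or_pos with rfl | h0
  · rw [Subsingleton.elim x 0, norm_zero]
    exact zero_le_one
  · exact (h h0).le

/-- The words of a noncommutative polynomial. -/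
def wordsOf {I : Type*} (p : FreeAlgebra ℂ I) : Finset (FreeMonoid I) :=
  ((FreeAlgebra.basisFreeMonoid ℂ I).repr p).support

lemma dotProduct_polyEval_mulVec {I Ω : Type*} (σ : I → ℝ) (X : I → EntryIndex → Ω → ℂ)
    (b : I → ℕ → ℕ) (p : FreeAlgebra ℂ I) (N : ℕ) (y x : Fin N → ℂ) (ω : Ω) :
    y ⬝ᵥ polyEval (fun i => rbm (X i) (b i) N ω) p *ᵥ x =
      ∑ w ∈ wordsOf p, (FreeAlgebra.basisFreeMonoid ℂ I).repr p w *
        wordDev σ X b (FreeMonoid.toList w) N y x ω + y ⬝ᵥ x * semicircularState σ p := by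
  rw [polyEval_eq_sum, semicircularState_eq_sum, Finset.mul_sum, wordsOf, ← Finset.sum_add_distrib,
    sum_mulVec, dotProduct_sum]
  refine Finset.sum_congr rfl fun w _ => ?_
  rw [smul_mulVec, dotProduct_smul, wordDev, smul_eq_mul]
  ring

section Convergence

variable {I Ω : Type*} [MeasurableSpace Ω] {μ : Measure Ω} [IsProbabilityMeasure μ]
  {σ : I → ℝ} {X : I → EntryIndex → Ω → ℂ} {b : I → ℕ → ℕ}

/-- Stated along an arbitrary sequence of sizes, since it serves both for sparse subsequences and
for the full sequence. -/
lemma ae_tendsto_polyEval (hX : ∀ i, IsWignerEntries μ (σ i) (X i))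
    (hindep : iIndepFun (fun (i : I) (ω : Ω) (e : EntryIndex) => X i e ω) μ)
    (p : FreeAlgebra ℂ I) (x y : (N : ℕ) → EuclideanSpace ℂ (Fin N)) (hx : ∀ N, ‖x N‖ ≤ 1)
    (hy : ∀ N, ‖y N‖ ≤ 1) {c : ℂ} (hc : Tendsto (fun N => inner ℂ (y N) (x N)) atTop (𝓝 c))
    {Ns : ℕ → ℕ} (hNs : Tendsto Ns atTop atTop) (m : ℕ)
    (hsum : ∀ w ∈ wordsOf p, Summable fun n =>
      bandScale b (Ns n) (FreeMonoid.toList w) ^ 2 ^ (m + 1)) :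
    ∀ᵐ ω ∂μ, Tendsto (fun n => star (y (Ns n)).ofLp ⬝ᵥ
      polyEval (fun i => rbm (X i) (b i) (Ns n) ω) p *ᵥ (x (Ns n)).ofLp) atTop
      (𝓝 (c * semicircularState σ p)) := by
  have hword : ∀ w ∈ wordsOf p, ∀ᵐ ω ∂μ, Tendsto (fun n => wordDev σ X b (FreeMonoid.toList w)
      (Ns n) (star (y (Ns n)).ofLp) (x (Ns n)).ofLp ω) atTop (𝓝 0) := fun w hw => by
    obtain ⟨C, hC0, hC⟩ := exists_nrm_wordDev_le hX hindep b (FreeMonoid.toList w) m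
    refine ae_tendsto_zero_of_summable (fun n => (hC _ _ _).1) m
      (a := fun n => C * bandScale b (Ns n) (FreeMonoid.toList w)) (fun n => ?_) ?_
    · refine (hC _ _ _).2.trans (mul_le_mul_of_nonneg_left ?_ hC0)
      refine mul_le_of_le_one_right (bandScale_nonneg _ _ _) ?_
      rw [l2_star, l2_ofLp, l2_ofLp]
      exact mul_le_one₀ (hy _) (norm_nonneg _) (hx _)
    · simp only [mul_pow]
      exact (hsum w hw).mul_left _
  filter_upwards [(Finset.eventually_all (wordsOf p)).2 hword] with ω hω
  simp only [dotProduct_polyEval_mulVec σ]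
  have h1 := tendsto_finsetSum (wordsOf p) fun w hw =>
    (hω w hw).const_mul ((FreeAlgebra.basisFreeMonoid ℂ I).repr p w)
  have h2 : Tendsto (fun n => star (y (Ns n)).ofLp ⬝ᵥ (x (Ns n)).ofLp) atTop (𝓝 c) := by
    refine (hc.comp hNs).congr fun n => ?_
    rw [Function.comp_apply, EuclideanSpace.inner_eq_star_dotProduct, dotProduct_comm]
  simpa using h1.add (h2.mul_const (semicircularState σ p))

lemma ae_tendsto_cyclicTrace (hX : ∀ i, IsWignerEntries μ (σ i) (X i))
    (hindep : iIndepFun (fun (i : I) (ω : Ω) (e : EntryIndex) => X i e ω) μ) {r : ℕ} [NeZero r]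
    (p : Fin r → FreeAlgebra ℂ I) (x y : (N : ℕ) → Fin r → EuclideanSpace ℂ (Fin N))
    (hx : ∀ N s, ‖x N s‖ ≤ 1) (hy : ∀ N s, ‖y N s‖ ≤ 1) {c : Fin r → ℂ}
    (hc : ∀ s, Tendsto (fun N => inner ℂ (y N s) (x N s)) atTop (𝓝 (c s)))
    {Ns : ℕ → ℕ} (hNs : Tendsto Ns atTop atTop) (m : ℕ)
    (hsum : ∀ s, ∀ w ∈ wordsOf (p s), Summable fun n =>
      bandScale b (Ns n) (FreeMonoid.toList w) ^ 2 ^ (m + 1)) :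
    ∀ᵐ ω ∂μ, Tendsto (fun n => cyclicTrace (x (Ns n)) (y (Ns n)) p
      (fun i => rbm (X i) (b i) (Ns n) ω)) atTop (𝓝 (∏ s, (c s * semicircularState σ (p s)))) := by
  have h := ae_all_iff.2 fun s => ae_tendsto_polyEval hX hindep (p s) (fun N => x N s)
    (fun N => y N s) (fun N => hx N s) (fun N => hy N s) (hc s) hNs m (hsum s)
  filter_upwards [h] with ω hω
  simp only [cyclicTrace_eq_prod]
  exact tendsto_finsetProd _ fun s _ => hω s

lemma measurable_cyclicTrace (hX : ∀ i, IsWignerEntries μ (σ i) (X i))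
    (hindep : iIndepFun (fun (i : I) (ω : Ω) (e : EntryIndex) => X i e ω) μ) {r N : ℕ} [NeZero r]
    (p : Fin r → FreeAlgebra ℂ I) (x y : Fin r → EuclideanSpace ℂ (Fin N)) :
    Measurable fun ω => cyclicTrace x y p (fun i => rbm (X i) (b i) N ω) := by
  simp only [cyclicTrace_eq_prod, dotProduct_polyEval_mulVec σ]
  refine Finset.measurable_prod _ fun s _ => (Finset.measurable_sum _ fun w _ => ?_).add_const _
  obtain ⟨C, -, hC⟩ := exists_nrm_wordDev_le hX hindep b (FreeMonoid.toList w) 0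
  exact (hC _ _ _).1.measurable.const_mul _

end Convergence

lemma tendsto_bandScale {I : Type*} {b : I → ℕ → ℕ} (hb : ∀ i, Tendsto (b i) atTop atTop)
    (w : List I) : Tendsto (fun N => bandScale b N w) atTop (𝓝 0) := by
  have hxi : ∀ i, Tendsto (fun N => (√(xi N (b i N)))⁻¹) atTop (𝓝 0) := fun i => by
    have h1 : Tendsto (fun N => xi N (b i N)) atTop atTop := by
      refine tendsto_atTop.2 fun n => ?_
      filter_upwards [(tendsto_atTop.1 (hb i)) n, eventually_ge_atTop n] with N h1 h2
      unfold xi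
      omega
    exact (Real.tendsto_sqrt_atTop.comp (tendsto_natCast_atTop_atTop.comp h1)).inv_tendsto_atTop
  induction w with
  | nil => simp [bandScale]
  | cons i w ih => simpa [bandScale] using (hxi i).add ih

lemma inv_sqrt_eventually_le {ξ : ℕ → ℕ} {ε : ℝ}
    (h : (fun N : ℕ => (N : ℝ) ^ ε) =o[atTop] fun N : ℕ => (ξ N : ℝ)) :
    ∀ᶠ N : ℕ in atTop, (√(ξ N))⁻¹ ≤ (N : ℝ) ^ (-(ε / 2)) := by
  filter_upwards [h.bound one_pos, eventually_ge_atTop 1] with N hN h1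
  have hN0 : (0 : ℝ) < N := by exact_mod_cast h1
  rw [one_mul, Real.norm_of_nonneg (by positivity), Real.norm_of_nonneg (by positivity)] at hN
  rw [Real.rpow_neg hN0.le]
  refine inv_anti₀ (by positivity) (Real.le_sqrt_of_sq_le ?_)
  rwa [← Real.rpow_natCast, ← Real.rpow_mul hN0.le, Nat.cast_ofNat, div_mul_cancel₀ _ two_ne_zero]

lemma bandScale_eventually_le {I : Type*} {b : I → ℕ → ℕ} {ε : ℝ} (w : List I)
    (h : ∀ i ∈ w, (fun N : ℕ => (N : ℝ) ^ ε) =o[atTop] fun N : ℕ => (xi N (b i N) : ℝ)) :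
    ∀ᶠ N : ℕ in atTop, bandScale b N w ≤ w.length * (N : ℝ) ^ (-(ε / 2)) := by
  induction w with
  | nil => simp [bandScale]
  | cons i w ih =>
    filter_upwards [ih fun j hj => h j (List.mem_cons_of_mem _ hj),
      inv_sqrt_eventually_le (h i List.mem_cons_self)] with N h1 h2
    simp only [bandScale, List.map_cons, List.sum_cons, List.length_cons] at h1 ⊢
    push_cast
    linarith

lemma summable_bandScale_pow {I : Type*} {b : I → ℕ → ℕ} {ε : ℝ} (w : List I)
    (h : ∀ i ∈ w, (fun N : ℕ => (N : ℝ) ^ ε) =o[atTop] fun N : ℕ => (xi N (b i N) : ℝ))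
    {m : ℕ} (hm : 1 < 2 ^ m * ε) : Summable fun N => bandScale b N w ^ 2 ^ (m + 1) := by
  -- A power `2^{m+1}` of the rate `N^{-ε/2}` is `N^{-2^m ε}`.
  have hs : Summable fun N : ℕ => (w.length : ℝ) ^ 2 ^ (m + 1) * (N : ℝ) ^ (-(2 ^ m * ε)) :=
    (Real.summable_nat_rpow.2 (by linarith)).mul_left _
  refine hs.of_norm_bounded_eventually_nat ?_
  filter_upwards [bandScale_eventually_le w h] with N hN
  rw [norm_pow, Real.norm_of_nonneg (bandScale_nonneg _ _ _)]
  refine (pow_le_pow_left₀ (bandScale_nonneg _ _ _) hN _).trans_eq ?_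
  rw [mul_pow]
  congr 1
  rw [← Real.rpow_natCast, ← Real.rpow_mul (Nat.cast_nonneg _)]
  congr 1
  push_cast
  ring

end RandomBand

end

theorem mainTheorem2 {I Ω : Type*} [MeasurableSpace Ω] (μ : Measure Ω) [IsProbabilityMeasure μ]
    (σ : I → ℝ) (X : I → RandomBand.EntryIndex → Ω → ℂ)
    (hX : ∀ i, RandomBand.IsWignerEntries μ (σ i) (X i))
    (hindep : iIndepFun (fun (i : I) (ω : Ω) (e : RandomBand.EntryIndex) => X i e ω) μ)
    (b : I → ℕ → ℕ) (hb : ∀ i, Tendsto (b i) atTop atTop)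
    (r : ℕ) [NeZero r]
    (x y : (N : ℕ) → Fin r → EuclideanSpace ℂ (Fin N))
    (hx : ∀ N, 1 ≤ N → ∀ s, ‖x N s‖ = 1) (hy : ∀ N, 1 ≤ N → ∀ s, ‖y N s‖ = 1)
    (c : Fin r → ℂ)
    -- `inner ℂ y x` is the sum of the products `x(j) * conj (y(j))`
    (hc : ∀ s, Tendsto (fun N => inner ℂ (y N s) (x N s)) atTop (𝓝 (c s)))
    (p : Fin r → FreeAlgebra ℂ I) :
    TendstoInMeasure μ
      (fun (N : ℕ) (ω : Ω) =>
        RandomBand.cyclicTrace (x N) (y N) p (fun i => RandomBand.rbm (X i) (b i) N ω))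
      atTop (fun _ => ∏ s, (c s * RandomBand.semicircularState σ (p s))) ∧
    ((∃ ε : ℝ, 0 < ε ∧ ∀ s, ∀ i ∈ RandomBand.variablesOf (p s),
        (fun N : ℕ => (N : ℝ) ^ ε) =o[atTop] fun N : ℕ => (RandomBand.xi N (b i N) : ℝ)) →
      ∀ᵐ ω ∂μ, Tendsto
        (fun N : ℕ =>
          RandomBand.cyclicTrace (x N) (y N) p (fun i => RandomBand.rbm (X i) (b i) N ω))
        atTop (𝓝 (∏ s, (c s * RandomBand.semicircularState σ (p s))))) := by
  have hx' : ∀ N s, ‖x N s‖ ≤ 1 := fun N s =>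
    RandomBand.norm_le_one_of_forall_one_le fun h => hx N h s
  have hy' : ∀ N s, ‖y N s‖ ≤ 1 := fun N s =>
    RandomBand.norm_le_one_of_forall_one_le fun h => hy N h s
  refine ⟨?_, fun ⟨ε, hε, hξ⟩ => ?_⟩
  -- Convergence in probability means that every subsequence has a further subsequence converging
  -- almost surely. The latter is chosen so sparse that the scales of the finitely many words
  -- involved are at most `2^{-n}`; second moments (index 0) then suffice.
  · rw [exists_seq_tendstoInMeasure_atTop_iff fun N =>
      (RandomBand.measurable_cyclicTrace hX hindep p (x N) (y N)).aestronglyMeasurable]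
    intro ns hns
    have hsmall : ∀ n : ℕ, ∀ᶠ k in atTop, ∀ s, ∀ w ∈ RandomBand.wordsOf (p s),
        RandomBand.bandScale b (ns k) (FreeMonoid.toList w) ≤ (1 / 2) ^ n := fun n => by
      refine eventually_all.2 fun s => (Finset.eventually_all _).2 fun w _ => ?_
      exact (((RandomBand.tendsto_bandScale hb _).comp hns.tendsto_atTop).eventually_lt_const
        (by positivity)).mono fun _ h => h.le
    obtain ⟨φ, hφ, hle⟩ := extraction_forall_of_eventually hsmall
    refine ⟨φ, hφ, RandomBand.ae_tendsto_cyclicTrace hX hindep p x y hx' hy' hc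
      (Ns := fun n => ns (φ n)) (hns.comp hφ).tendsto_atTop 0 fun s w hw => ?_⟩
    have hg : Summable fun n : ℕ => ((1 / 2 : ℝ) ^ 2) ^ n :=
      summable_geometric_of_lt_one (by norm_num) (by norm_num)
    refine hg.of_nonneg_of_le (fun n => pow_nonneg (RandomBand.bandScale_nonneg _ _ _) _)
      fun n => ?_
    rw [pow_right_comm]
    exact pow_le_pow_left₀ (RandomBand.bandScale_nonneg _ _ _) (hle n s w hw) _
  -- A moment so high that `2^m ε > 1` makes the bounds summable over all `N`.
  · obtain ⟨m, hm⟩ := pow_unbounded_of_one_lt (1 / ε) (one_lt_two (α := ℝ))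
    refine RandomBand.ae_tendsto_cyclicTrace hX hindep p x y hx' hy' hc (Ns := id) tendsto_id m
      fun s w hw => RandomBand.summable_bandScale_pow (ε := ε) _ (fun i hi => ?_)
        ((div_lt_iff₀ hε).1 hm)
    exact hξ s i ⟨w, hw, hi⟩
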